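/- For every odd integer $k\ge 3$ there exists $n_k$ such that the following holds for all $n\ge n_k$. Let $H$ be an $n$-vertex $k$-uniform hypergraph, i.e. a set of $k$-element subsets (edges) of an $n$-element vertex set. A $2$-regular subgraph of $H$ consists of a nonempty set $W$ of vertices and a set $F$ of edges of $H$, all contained in $W$, such that every vertex of $W$ lies in exactly two edges of $F$. If $H$ has no $2$-regular subgraph, then $$|H|\le \binom{n-1}{k-1}+\left\lfloor\frac{n-1}{k}\right\rfloor .$$ Moreover, equality holds if and only if, for some vertex $v$, $H$ is the full $k$-star with center $v$ (all $k$-element vertex sets containing $v$) together with a maximal matching omitting $v$ (an inclusion-maximal family of pairwise disjoint $k$-element vertex sets not containing $v$). Every hypergraph of this last form indeed has no $2$-regular subgraph, so the bound is attained. -/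

import Mathlib

/-! A hypergraph on the finite vertex set `V` is given by its set of edges
`H : Finset (Finset V)`; isolated vertices are allowed.
That `H` is `k`-uniform is Mathlib's `(H : Set (Finset V)).Sized k`. -/

namespace UniformHypergraph

variable {V : Type*}

/-- The degree of the vertex `x`: the number of edges of `H` containing it. -/
def degree [DecidableEq V] (H : Finset (Finset V)) (x : V) : ℕ :=
  (H.filter (fun e => x ∈ e)).card

/-- `H` has an `r`-regular subgraph: a nonempty set `W` of vertices and a set `F` of edges of `H`
that lie inside `W`, such that every vertex of `W` lies in exactly `r` edges of `F`. -/
def HasRegularSubgraph [DecidableEq V] (r : ℕ) (H : Finset (Finset V)) : Prop :=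
  ∃ (W : Finset V) (F : Finset (Finset V)),
    W.Nonempty ∧ F ⊆ H ∧ (∀ e ∈ F, e ⊆ W) ∧ ∀ x ∈ W, degree F x = r

/-- The full `k`-star with center `v`: all `k`-element vertex sets containing `v`. -/
def fullStar [Fintype V] [DecidableEq V] (k : ℕ) (v : V) : Finset (Finset V) :=
  (Finset.univ.powersetCard k).filter (fun e => v ∈ e)

/-- `M` is a matching of `k`-element sets omitting `v`: its edges are pairwise disjoint `k`-sets,
none of which contains `v`. -/
def IsMatchingOmitting (k : ℕ) (v : V) (M : Finset (Finset V)) : Prop :=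
  (M : Set (Finset V)).Sized k ∧ (∀ e ∈ M, v ∉ e) ∧ (M : Set (Finset V)).PairwiseDisjoint id

/-- `H` is a full `k`-star with some center `v` together with an (inclusion-)maximal matching
of `k`-sets omitting `v`. -/
def IsStarWithMaximalMatching [Fintype V] [DecidableEq V] (k : ℕ) (H : Finset (Finset V)) : Prop :=
  ∃ (v : V) (M : Finset (Finset V)),
    Maximal (IsMatchingOmitting k v) M ∧ H = fullStar k v ∪ M

end UniformHypergraph

/-! Everything rests on one observation: two distinct matchings with the same vertex set have a
2-regular symmetric difference (`hasRegularSubgraph_of_matchings`). Without 2-regular subgraphs a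
matching is therefore determined by its union, so greedy lower bounds on the number of matchings
compete with the number of possible unions.

Stability. This competition shows that a hypergraph of small maximum degree has few edges
(`card_le_of_degree_le`) and that only few vertices have large degree (`exists_degree_le`). Hence
almost all edges meet some small set `T` in exactly one vertex (`exists_card_le_sum_linkOutside`).
Exchanges between pairs of edges make the links of the vertices of `T` almost disjoint, so if `H`
has at least `(n - 1).choose (k - 1)` edges, almost every `(k - 1)`-set lies in the link of some
vertex of `T`, which serves as its color. A further exchange shows that replacing one vertex of the
set rarely changes the color. Replacing the vertices one by one, almost all pairs of sets agree, so
one color `v` dominates, and the family `N` of `(k - 1)`-sets missing from its link has size `o(n ^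
(k - 1))` (`exists_card_missingLink_le`).

Exact bound. `H` has `(n - 1).choose (k - 1) - |N|` edges through `v`, so the edges avoiding `v`
have to be weighed against `N`. Let two of these meet, and split their symmetric difference into
halves `R`, `S` of equal size. A set `J` that completes both `R` and `S` to edges through `v` would
give a 2-regular subgraph with four edges, so `R` or `S` lies in a positive proportion of missing
sets: it is bad (`isBad_or_isBad`). Counting with this shows that at most `|N| / 8` edges avoiding
`v` have a bad vertex or a bad subset of intermediate size. Any two of the others share at most one
vertex, and at each vertex all but one of them leave a member of `N` when the vertex is removed; so
they number at most `(n - 1 + |N|) / k` (`mul_card_le_of_linear`). If `|N| ≥ 2`, this puts `H`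
strictly below the bound. If `|N| ≤ 1`, the edges avoiding `v` form a matching, because a meeting
pair would produce two missing sets.

Sharpness is a parity argument: the matching edges would have to tile the symmetric difference of
two star edges. -/

namespace UniformHypergraph
open Finset

/-! ### Matchings with the same vertex set -/

section
variable {V : Type*} [DecidableEq V]

lemma hasRegularSubgraph_of_forall_mem {r : ℕ} {H F : Finset (Finset V)} (hF : F ⊆ H)
    (hne : ∃ e ∈ F, e.Nonempty) (h : ∀ e ∈ F, ∀ x ∈ e, degree F x = r) :
    HasRegularSubgraph r H := by
  obtain ⟨e, he, x, hx⟩ := hne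
  refine ⟨F.biUnion id, F, ⟨x, mem_biUnion.2 ⟨e, he, hx⟩⟩, hF,
    fun e he => subset_biUnion_of_mem id he, fun y hy => ?_⟩
  obtain ⟨e', he', hy'⟩ := mem_biUnion.1 hy
  exact h e' he' y hy'

/-- Each matching covers `x` exactly once, and the edge of `M'` through `x` is not in `M`, where it
would have to coincide with `e`. -/
lemma degree_symmDiff_of_matchings {M M' : Finset (Finset V)}
    (hd : (M : Set (Finset V)).PairwiseDisjoint id)
    (hd' : (M' : Set (Finset V)).PairwiseDisjoint id)
    (hU : M.biUnion id = M'.biUnion id) {e : Finset V} (he : e ∈ M \ M') {x : V} (hx : x ∈ e) :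
    degree (M \ M' ∪ M' \ M) x = 2 := by
  have key : ∀ {N : Finset (Finset V)}, (N : Set (Finset V)).PairwiseDisjoint id →
      ∀ {a b : Finset V}, a ∈ N → b ∈ N → x ∈ a → x ∈ b → a = b := by
    intro N hN a b ha hb hxa hxb
    by_contra hab
    exact (Finset.disjoint_left.1 (hN ha hb hab)) hxa hxb
  rw [mem_sdiff] at he
  have hx' : x ∈ M'.biUnion id := hU ▸ mem_biUnion.2 ⟨e, he.1, hx⟩
  obtain ⟨e', he', hxe'⟩ := mem_biUnion.1 hx'
  simp only [id] at hxe'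
  have hne : e ≠ e' := fun h => he.2 (h ▸ he')
  have he'M : e' ∉ M := fun h => hne (key hd he.1 h hx hxe')
  rw [degree, card_eq_two]
  refine ⟨e, e', hne, ?_⟩
  ext a
  simp only [mem_filter, mem_union, mem_sdiff, mem_insert, mem_singleton]
  constructor
  · rintro ⟨h | h, hxa⟩
    · exact Or.inl (key hd h.1 he.1 hxa hx)
    · exact Or.inr (key hd' h.1 he' hxa hxe')
  · rintro (rfl | rfl)
    · exact ⟨Or.inl he, hx⟩
    · exact ⟨Or.inr ⟨he', he'M⟩, hxe'⟩

/-- Two distinct matchings of nonempty edges with the same vertex set yield a `2`-regular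
subgraph, namely their symmetric difference. -/
lemma hasRegularSubgraph_of_matchings {H M M' : Finset (Finset V)} (hM : M ⊆ H) (hM' : M' ⊆ H)
    (hd : (M : Set (Finset V)).PairwiseDisjoint id)
    (hd' : (M' : Set (Finset V)).PairwiseDisjoint id)
    (hU : M.biUnion id = M'.biUnion id) (hne : M ≠ M') (hpos : ∀ e ∈ H, e.Nonempty) :
    HasRegularSubgraph 2 H := by
  have hF : M \ M' ∪ M' \ M ⊆ H :=
    union_subset (sdiff_subset.trans hM) (sdiff_subset.trans hM')
  refine hasRegularSubgraph_of_forall_mem hF ?_ ?_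
  · have : (M \ M' ∪ M' \ M).Nonempty := by
      rw [nonempty_iff_ne_empty]
      intro h
      rw [union_eq_empty, sdiff_eq_empty_iff_subset, sdiff_eq_empty_iff_subset] at h
      exact hne (h.1.antisymm h.2)
    obtain ⟨e, he⟩ := this
    exact ⟨e, he, hpos e (hF he)⟩
  · intro e he x hx
    rcases mem_union.1 he with h | h
    · exact degree_symmDiff_of_matchings hd hd' hU h hx
    · rw [union_comm]
      exact degree_symmDiff_of_matchings hd' hd hU.symm h hx

/-- The case of two-edge matchings, which drives the exchange arguments on links. -/
lemma hasRegularSubgraph_of_pairs {H : Finset (Finset V)} (hpos : ∀ e ∈ H, e.Nonempty)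
    {a b c d : Finset V} (ha : a ∈ H) (hb : b ∈ H) (hc : c ∈ H) (hd : d ∈ H)
    (hab : Disjoint a b) (hcd : Disjoint c d) (hU : a ∪ b = c ∪ d) (hac : a ≠ c) (had : a ≠ d) :
    HasRegularSubgraph 2 H := by
  have pd : ∀ {a b : Finset V}, Disjoint a b →
      (({a, b} : Finset (Finset V)) : Set (Finset V)).PairwiseDisjoint id := by
    intro a b h x hx y hy hxy
    simp only [coe_insert, coe_singleton, Set.mem_insert_iff, Set.mem_singleton_iff] at hx hy
    rcases hx with rfl | rfl <;> rcases hy with rfl | rfl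
    · exact absurd rfl hxy
    · exact h
    · exact h.symm
    · exact absurd rfl hxy
  refine hasRegularSubgraph_of_matchings (M := {a, b}) (M' := {c, d}) ?_ ?_ (pd hab) (pd hcd)
    ?_ ?_ hpos
  · simp [insert_subset_iff, ha, hb]
  · simp [insert_subset_iff, hc, hd]
  · simpa using hU
  · intro h
    have : a ∈ ({c, d} : Finset (Finset V)) := h ▸ mem_insert_self a {b}
    simp [hac, had] at this

/-! ### Counting set families and disjoint tuples -/

/-- A family of `k`-subsets of `U` containing `P` has at most `|U| ^ (k - |P|)` members. -/
lemma card_le_pow_of_superset {𝓕 : Finset (Finset V)} {U P : Finset V} {k : ℕ}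
    (h : ∀ e ∈ 𝓕, e.card = k ∧ e ⊆ U ∧ P ⊆ e) : 𝓕.card ≤ U.card ^ (k - P.card) := by
  calc 𝓕.card ≤ (powersetCard (k - P.card) U).card := by
        refine card_le_card_of_injOn (fun e => e \ P) ?_ ?_
        · intro e he
          obtain ⟨h1, h2, h3⟩ := h e he
          refine mem_coe.2 (mem_powersetCard.2 ⟨sdiff_subset.trans h2, ?_⟩)
          rw [card_sdiff_of_subset h3, h1]
        · intro e he e' he' hee
          have h3 := (h e he).2.2
          have h3' := (h e' he').2.2
          simp only at hee
          rw [← sdiff_union_of_subset h3, hee, sdiff_union_of_subset h3']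
    _ ≤ _ := by rw [card_powersetCard]; exact Nat.choose_le_pow _ _

/-- A family of `k`-subsets of `U` all of which contain `x` and meet `Z ∌ x`. -/
lemma card_filter_not_disjoint_le {𝓕 : Finset (Finset V)} {U Z : Finset V} {P : Finset V} {k : ℕ}
    (hZ : Disjoint P Z) (h : ∀ e ∈ 𝓕, e.card = k ∧ e ⊆ U ∧ P ⊆ e) :
    (𝓕.filter (fun e => ¬ Disjoint e Z)).card ≤ Z.card * U.card ^ (k - (P.card + 1)) := by
  have hsub : 𝓕.filter (fun e => ¬ Disjoint e Z) ⊆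
      Z.biUnion (fun z => 𝓕.filter (fun e => z ∈ e)) := by
    intro e he
    rw [mem_filter, Finset.not_disjoint_iff] at he
    obtain ⟨he, z, hze, hz⟩ := he
    exact mem_biUnion.2 ⟨z, hz, mem_filter.2 ⟨he, hze⟩⟩
  refine (card_le_card hsub).trans (card_biUnion_le_card_mul _ _ _ fun z hz => ?_)
  have hzP : z ∉ P := Finset.disjoint_right.1 hZ hz
  rw [← card_insert_of_notMem hzP]
  refine card_le_pow_of_superset fun e he => ?_
  rw [mem_filter] at he
  obtain ⟨h1, h2, h3⟩ := h e he.1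
  exact ⟨h1, h2, insert_subset he.2 h3⟩

/-- Greedy counting of tuples of pairwise disjoint sets. -/
lemma pow_le_card_disjoint_tuples {j d s : ℕ} : ∀ {m : ℕ} (_ : j * m ≤ s)
    (E : Fin m → Finset (Finset V))
    (_ : ∀ i, ∀ e ∈ E i, e.card ≤ j)
    -- Only sets `Z` covered by the families matter, being unions of sets already chosen. For links
    -- outside `T` this keeps the vertices of `T` out of `Z`.
    (_ : ∀ i, ∀ Z : Finset V, Z.card ≤ s → (∀ z ∈ Z, ∃ i', ∃ e ∈ E i', z ∈ e) →
      d ≤ ((E i).filter (fun e => Disjoint e Z)).card),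
    d ^ m ≤ ((Fintype.piFinset E).filter
      (fun f => ∀ i i', i ≠ i' → Disjoint (f i) (f i'))).card
  | 0, _, E, _, _ => by
      rw [pow_zero, Nat.one_le_iff_ne_zero, ← Nat.pos_iff_ne_zero, card_pos]
      exact ⟨Fin.elim0, mem_filter.2 ⟨Fintype.mem_piFinset.2 (fun i => i.elim0), fun i => i.elim0⟩⟩
  | m + 1, hs, E, hE, h => by
      have hs' : j * m ≤ s := le_trans (Nat.mul_le_mul_left j (Nat.le_succ m)) hs
      have ih := pow_le_card_disjoint_tuples hs' (fun i => E i.succ) (fun i => hE i.succ)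
        (fun i Z hZ hZE => h i.succ Z hZ (fun z hz => by
          obtain ⟨i', e, he, hze⟩ := hZE z hz
          exact ⟨i'.succ, e, he, hze⟩))
      set 𝒢 := (Fintype.piFinset (fun i : Fin m => E i.succ)).filter
        (fun f => ∀ i i', i ≠ i' → Disjoint (f i) (f i')) with h𝒢
      have hcard : d ^ (m + 1) ≤
          (𝒢.sigma (fun g => (E 0).filter (fun e => Disjoint e (univ.biUnion g)))).card := by
        rw [card_sigma, pow_succ]
        calc d ^ m * d ≤ 𝒢.card * d := Nat.mul_le_mul_right d ih
          _ = ∑ _g ∈ 𝒢, d := by rw [sum_const, smul_eq_mul]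
          _ ≤ _ := by
            refine sum_le_sum fun g hg => h 0 _ ?_ ?_
            · calc (univ.biUnion g).card ≤ (univ : Finset (Fin m)).card * j := by
                    refine card_biUnion_le_card_mul _ _ _ fun i _ => ?_
                    exact hE i.succ _ (Fintype.mem_piFinset.1 (mem_filter.1 hg).1 i)
                _ ≤ s := by rw [card_univ, Fintype.card_fin, mul_comm]; exact hs'
            · intro z hz
              obtain ⟨i, _, hzi⟩ := mem_biUnion.1 hz
              exact ⟨i.succ, g i, Fintype.mem_piFinset.1 (mem_filter.1 hg).1 i, hzi⟩
      refine hcard.trans (card_le_card_of_injOn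
        (fun p => (Fin.cons p.2 p.1 : Fin (m + 1) → Finset V)) ?_ ?_)
      · rintro ⟨g, e⟩ hp
        have hp' := mem_sigma.1 (mem_coe.1 hp)
        simp only [mem_filter] at hp'
        obtain ⟨hg, he, hd⟩ := hp'
        have hg' := mem_filter.1 hg
        have hdi : ∀ i, Disjoint e (g i) := fun i =>
          Finset.disjoint_of_subset_right (subset_biUnion_of_mem g (mem_univ i)) hd
        refine mem_coe.2 (mem_filter.2 ⟨Fintype.mem_piFinset.2 fun i => ?_, fun i i' hii => ?_⟩)
        · refine Fin.cases ?_ (fun i => ?_) i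
          · simpa using he
          · simpa using Fintype.mem_piFinset.1 hg'.1 i
        · revert hii
          refine Fin.cases ?_ (fun i => ?_) i <;> refine Fin.cases ?_ (fun i' => ?_) i'
          · intro h; exact absurd rfl h
          · intro _; simpa using hdi i'
          · intro _; simpa using (hdi i).symm
          · intro hii
            simpa using hg'.2 i i' (fun h => hii (by rw [h]))
      · rintro ⟨g, e⟩ _ ⟨g', e'⟩ _ hgg
        simp only at hgg
        have h1 := Fin.cons_injective2 hgg
        rw [h1.1, h1.2]

/-- A finite set has at most `m!` enumerations by `Fin m`. -/
lemma card_injective_image_eq_le {α : Type*} [DecidableEq α] {m : ℕ}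
    (𝒢 : Finset (Fin m → α)) (M : Finset α)
    (h : ∀ f ∈ 𝒢, Function.Injective f ∧ univ.image f = M) : 𝒢.card ≤ m.factorial := by
  rcases 𝒢.eq_empty_or_nonempty with rfl | ⟨f₀, hf₀⟩
  · simp
  have hsub : 𝒢 ⊆ (univ : Finset (Equiv.Perm (Fin m))).image (fun σ : Equiv.Perm (Fin m) => f₀ ∘ ⇑σ) := by
    intro f hf
    obtain ⟨hi, him⟩ := h f hf
    obtain ⟨hi₀, him₀⟩ := h f₀ hf₀
    have hex : ∀ i, ∃ i', f₀ i' = f i := by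
      intro i
      have : f i ∈ univ.image f₀ := by
        rw [him₀, ← him]; exact mem_image_of_mem f (mem_univ i)
      obtain ⟨i', _, hi'⟩ := mem_image.1 this
      exact ⟨i', hi'⟩
    choose σ hσ using hex
    have hσi : Function.Injective σ := by
      intro a b hab
      apply hi
      rw [← hσ a, ← hσ b, hab]
    refine mem_image.2 ⟨Equiv.ofBijective σ (Finite.injective_iff_bijective.1 hσi), mem_univ _, ?_⟩
    funext i
    simpa using hσ i
  calc 𝒢.card ≤ _ := card_le_card hsub
    _ ≤ _ := card_image_le
    _ = m.factorial := by rw [card_univ, Fintype.card_perm, Fintype.card_fin]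

end

/-- A term of the exponential series gives `a ^ a / a! ≤ e ^ a`, and `e < 3`. -/
lemma div_three_pow_le_factorial (a : ℕ) : ((a : ℝ) / 3) ^ a ≤ a.factorial := by
  have h1 := Real.pow_div_factorial_le_exp (a : ℝ) (Nat.cast_nonneg a) a
  have hf : (0 : ℝ) < a.factorial := by exact_mod_cast a.factorial_pos
  rw [div_le_iff₀ hf] at h1
  have h2 : Real.exp a ≤ 3 ^ a := by
    have : Real.exp (a : ℝ) = Real.exp 1 ^ a := by rw [← Real.exp_nat_mul, mul_one]
    rw [this]
    exact pow_le_pow_left₀ (Real.exp_pos 1).le Real.exp_one_lt_three.le a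
  rw [div_pow, div_le_iff₀ (by positivity)]
  calc (a : ℝ) ^ a ≤ Real.exp a * a.factorial := h1
    _ ≤ 3 ^ a * a.factorial := by gcongr
    _ = _ := by ring

/-- The bound is an `m`-th power, so that `m`-th roots can be taken against the greedy count `d ^
m`. -/
lemma choose_mul_le_pow {n j m : ℕ} (hj : 1 ≤ j) (hm : 1 ≤ m) :
    ((n.choose (j * m) : ℕ) : ℝ) ≤ ((3 * n / (j * m)) ^ j) ^ m := by
  have hjm : (0 : ℝ) < j * m := by positivity
  have h1 : ((n.choose (j * m) : ℕ) : ℝ) ≤ (n : ℝ) ^ (j * m) / (j * m).factorial :=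
    Nat.choose_le_pow_div _ _
  have h2 := div_three_pow_le_factorial (j * m)
  rw [← pow_mul]
  refine h1.trans ?_
  have h3 : (0 : ℝ) < (((j * m : ℕ) : ℝ) / 3) ^ (j * m) := by push_cast; positivity
  calc (n : ℝ) ^ (j * m) / (j * m).factorial ≤ (n : ℝ) ^ (j * m) / (((j * m : ℕ) : ℝ) / 3) ^ (j * m) :=
        div_le_div_of_nonneg_left (by positivity) h3 h2
    _ = _ := by
      rw [← div_pow]; congr 1; push_cast; field_simp

/-! ### Degree bounds from counting matchings -/

section
variable {V : Type*} [DecidableEq V]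

/-- Otherwise the two tuples would be distinct matchings with the same vertex set. Disjoint tuples
can thus be counted, up to order, by their unions. -/
lemma image_eq_of_biUnion_eq {H : Finset (Finset V)} (hfree : ¬ HasRegularSubgraph 2 H)
    (hpos : ∀ e ∈ H, e.Nonempty) {m : ℕ} {f f' : Fin m → Finset V}
    (hf : ∀ i, f i ∈ H) (hf' : ∀ i, f' i ∈ H)
    (hd : ∀ i i', i ≠ i' → Disjoint (f i) (f i')) (hd' : ∀ i i', i ≠ i' → Disjoint (f' i) (f' i'))
    (h : univ.biUnion f = univ.biUnion f') : univ.image f = univ.image f' := by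
  by_contra hne
  have pd : ∀ {f : Fin m → Finset V}, (∀ i i', i ≠ i' → Disjoint (f i) (f i')) →
      ((univ.image f : Finset (Finset V)) : Set (Finset V)).PairwiseDisjoint id := by
    intro f hd a ha b hb hab
    obtain ⟨i, _, rfl⟩ := mem_image.1 (mem_coe.1 ha)
    obtain ⟨i', _, rfl⟩ := mem_image.1 (mem_coe.1 hb)
    exact hd i i' (fun h => hab (by rw [h]))
  refine hfree (hasRegularSubgraph_of_matchings (M := univ.image f) (M' := univ.image f')
    ?_ ?_ (pd hd) (pd hd') ?_ hne hpos)
  · exact image_subset_iff.2 fun i _ => hf i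
  · exact image_subset_iff.2 fun i _ => hf' i
  · rw [image_biUnion, image_biUnion]; exact h

lemma nonempty_of_sized {k : ℕ} (hk : 1 ≤ k) {H : Finset (Finset V)}
    (hs : (H : Set (Finset V)).Sized k) : ∀ e ∈ H, e.Nonempty := by
  intro e he
  rw [← card_pos, hs he]; exact hk

lemma card_biUnion_of_disjoint_tuple {m j : ℕ} {f : Fin m → Finset V}
    (hd : ∀ i i', i ≠ i' → Disjoint (f i) (f i')) (hc : ∀ i, (f i).card = j) :
    (univ.biUnion f).card = j * m := by
  rw [card_biUnion (fun i _ i' _ h => hd i i' h), sum_congr rfl (fun i _ => hc i), sum_const,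
    card_univ, Fintype.card_fin, smul_eq_mul, mul_comm]

/-- A `k`-graph on `U` of small maximum degree without `2`-regular subgraphs has few edges. -/
lemma card_le_of_degree_le {k : ℕ} (hk : 3 ≤ k) {H : Finset (Finset V)} {U : Finset V}
    (hs : (H : Set (Finset V)).Sized k) (hU : ∀ e ∈ H, e ⊆ U)
    (hfree : ¬ HasRegularSubgraph 2 H) {Δ : ℕ} (hΔ : ∀ x, degree H x ≤ Δ) {m : ℕ} (hm : 1 ≤ m) :
    (H.card : ℝ) ≤ (U.card : ℝ) ^ k / (m : ℝ) ^ (k - 1) + k * m * Δ := by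
  set n := U.card with hn
  -- The edges chosen earlier cover at most `k * m` vertices, which spoil at most `k * m * Δ` edges;
  -- `d` choices remain at each step.
  set d := H.card - k * m * Δ with hd
  have hpos := nonempty_of_sized (by omega) hs
  have hgreedy := pow_le_card_disjoint_tuples (j := k) (d := d) (s := k * m) (m := m) le_rfl
    (fun _ => H) (fun _ e he => (hs he).le) (by
      intro _ Z hZ _
      have h1 := card_filter_add_card_filter_not (s := H) (fun e => Disjoint e Z)
      have h2 : (H.filter (fun e => ¬ Disjoint e Z)).card ≤ k * m * Δ := by
        have hsub : H.filter (fun e => ¬ Disjoint e Z) ⊆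
            Z.biUnion (fun z => H.filter (fun e => z ∈ e)) := by
          intro e he
          rw [mem_filter, Finset.not_disjoint_iff] at he
          obtain ⟨he, z, hze, hz⟩ := he
          exact mem_biUnion.2 ⟨z, hz, mem_filter.2 ⟨he, hze⟩⟩
        calc _ ≤ _ := card_le_card hsub
          _ ≤ Z.card * Δ := card_biUnion_le_card_mul _ _ _ fun z _ => hΔ z
          _ ≤ _ := Nat.mul_le_mul_right Δ hZ
      omega)
  set 𝒢 := (Fintype.piFinset (fun _ : Fin m => H)).filter
    (fun f => ∀ i i', i ≠ i' → Disjoint (f i) (f i')) with h𝒢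
  have hmem : ∀ f ∈ 𝒢, (∀ i, f i ∈ H) ∧ ∀ i i', i ≠ i' → Disjoint (f i) (f i') := by
    intro f hf
    exact ⟨Fintype.mem_piFinset.1 (mem_filter.1 hf).1, (mem_filter.1 hf).2⟩
  have hcount : 𝒢.card ≤ m.factorial * (powersetCard (k * m) U).card := by
    refine card_le_mul_card_image_of_maps_to (f := fun f => univ.biUnion f) ?_ _ ?_
    · intro f hf
      obtain ⟨h1, h2⟩ := hmem f hf
      exact mem_powersetCard.2 ⟨biUnion_subset.2 fun i _ => hU _ (h1 i),
        card_biUnion_of_disjoint_tuple h2 fun i => hs (h1 i)⟩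
    · intro W _
      rcases (𝒢.filter (fun f => univ.biUnion f = W)).eq_empty_or_nonempty with h | ⟨f₀, hf₀⟩
      · rw [h]; simp
      rw [mem_filter] at hf₀
      obtain ⟨h1, h2⟩ := hmem f₀ hf₀.1
      refine card_injective_image_eq_le _ (univ.image f₀) fun f hf => ?_
      rw [mem_filter] at hf
      obtain ⟨h1', h2'⟩ := hmem f hf.1
      refine ⟨fun a b hab => ?_, image_eq_of_biUnion_eq hfree hpos h1' h1 h2' h2
        (hf.2.trans hf₀.2.symm)⟩
      by_contra hne
      have := h2' a b hne
      rw [hab, disjoint_self_iff_empty] at this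
      exact (hpos _ (h1' b)).ne_empty this
  rw [card_powersetCard] at hcount
  have hm' : (0 : ℝ) < m := by exact_mod_cast hm
  have hk' : (3 : ℝ) ≤ k := by exact_mod_cast hk
  have hreal : (d : ℝ) ^ m ≤ (m * (3 * n / (k * m)) ^ k) ^ m := by
    calc (d : ℝ) ^ m ≤ (m.factorial * n.choose (k * m) : ℕ) := by
          exact_mod_cast hgreedy.trans hcount
      _ = (m.factorial : ℝ) * (n.choose (k * m) : ℕ) := by push_cast; rfl
      _ ≤ (m : ℝ) ^ m * ((3 * n / (k * m)) ^ k) ^ m := by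
          gcongr
          · exact_mod_cast Nat.factorial_le_pow m
          · exact choose_mul_le_pow (by omega) hm
      _ = _ := by rw [mul_pow]
  have hd1 : (d : ℝ) ≤ m * (3 * n / (k * m)) ^ k :=
    (pow_le_pow_iff_left₀ (by positivity) (by positivity) (by omega)).1 hreal
  -- The factor 3 of the factorial estimate is absorbed by `3 ≤ k`.
  have hd2 : (m : ℝ) * (3 * n / (k * m)) ^ k ≤ (n : ℝ) ^ k / (m : ℝ) ^ (k - 1) := by
    have h3 : (3 * n / (k * m) : ℝ) ≤ n / m := by
      rw [div_le_div_iff₀ (by positivity) hm']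
      have : (0 : ℝ) ≤ n * m := by positivity
      nlinarith
    calc (m : ℝ) * (3 * n / (k * m)) ^ k ≤ m * (n / m : ℝ) ^ k := by gcongr
      _ = _ := by
        obtain ⟨j, rfl⟩ : ∃ j, k = j + 1 := ⟨k - 1, by omega⟩
        rw [Nat.add_sub_cancel, div_pow, pow_succ (m : ℝ)]
        field_simp
  have hle : (H.card : ℝ) ≤ d + k * m * Δ := by
    have : H.card ≤ d + k * m * Δ := by omega
    exact_mod_cast this
  linarith

/-- The `(k - 1)`-sets of `U \ T` which together with `x` form an edge of `H`. -/
def linkOutside (H : Finset (Finset V)) (U T : Finset V) (k : ℕ) (x : V) : Finset (Finset V) :=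
  (powersetCard (k - 1) (U \ T)).filter (fun A => insert x A ∈ H)

lemma mem_linkOutside {H : Finset (Finset V)} {U T : Finset V} {k : ℕ} {x : V} {A : Finset V} :
    A ∈ linkOutside H U T k x ↔ (A ⊆ U \ T ∧ A.card = k - 1) ∧ insert x A ∈ H := by
  rw [linkOutside, mem_filter, mem_powersetCard]

/-- An edge through `x` is lost only if it contains another vertex of `T` or a vertex of `Z`; each
such vertex accounts for at most `|U| ^ (k - 2)` edges. -/
lemma degree_le_card_linkOutside_add {k : ℕ} {H : Finset (Finset V)} {U T Z : Finset V}
    (hs : (H : Set (Finset V)).Sized k) (hU : ∀ e ∈ H, e ⊆ U) {x : V}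
    (hxZ : x ∉ Z) :
    degree H x ≤ ((linkOutside H U T k x).filter (fun A => Disjoint A Z)).card
      + (T.card + Z.card) * U.card ^ (k - 2) := by
  have h1 := card_filter_add_card_filter_not (s := H.filter (fun e => x ∈ e))
    (fun e => Disjoint e (T.erase x ∪ Z))
  have h2 : ((H.filter (fun e => x ∈ e)).filter (fun e => ¬ Disjoint e (T.erase x ∪ Z))).card ≤
      (T.card + Z.card) * U.card ^ (k - 2) := by
    have := card_filter_not_disjoint_le (𝓕 := H.filter (fun e => x ∈ e)) (U := U)
      (Z := T.erase x ∪ Z) (P := {x}) (k := k) (by simp [hxZ]) (by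
        intro e he
        rw [mem_filter] at he
        exact ⟨hs he.1, hU e he.1, by simpa using he.2⟩)
    rw [card_singleton] at this
    refine this.trans (Nat.mul_le_mul_right _ ((card_union_le _ _).trans ?_))
    exact Nat.add_le_add_right (card_le_card (erase_subset _ _)) _
  have h3 : ((H.filter (fun e => x ∈ e)).filter (fun e => Disjoint e (T.erase x ∪ Z))).card ≤
      ((linkOutside H U T k x).filter (fun A => Disjoint A Z)).card := by
    refine card_le_card_of_injOn (fun e => e.erase x) ?_ ?_
    · intro e he
      have he' := mem_coe.1 he
      simp only [mem_filter] at he'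
      obtain ⟨⟨heH, hxe⟩, hd⟩ := he'
      rw [disjoint_union_right] at hd
      refine mem_coe.2 (mem_filter.2 ⟨mem_linkOutside.2 ⟨⟨fun y hy => ?_, ?_⟩, ?_⟩, ?_⟩)
      · rw [mem_erase] at hy
        rw [mem_sdiff]
        exact ⟨hU e heH hy.2, fun hyT =>
          (Finset.disjoint_left.1 hd.1) hy.2 (mem_erase.2 ⟨hy.1, hyT⟩)⟩
      · rw [card_erase_of_mem hxe, hs heH]
      · rw [insert_erase hxe]; exact heH
      · exact Finset.disjoint_of_subset_left (erase_subset _ _) hd.2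
    · intro e he e' he' hee
      have hxe : x ∈ e := (mem_filter.1 (mem_filter.1 (mem_coe.1 he)).1).2
      have hxe' : x ∈ e' := (mem_filter.1 (mem_filter.1 (mem_coe.1 he')).1).2
      simp only at hee
      rw [← insert_erase hxe, hee, insert_erase hxe']
  have h4 : degree H x = (H.filter (fun e => x ∈ e)).card := rfl
  omega

/-- The factor `(3 / j) ^ j` is at most 1 for `j ≥ 3` and equals `9 / 4` for `j = 2`; the constant 3
covers both. -/
lemma three_mul_div_pow_le {n m j : ℕ} (hj : 2 ≤ j) (hm : 1 ≤ m) :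
    (3 * (n : ℝ) / (j * m)) ^ j ≤ 3 * ((n : ℝ) / m) ^ j := by
  have hm' : (0 : ℝ) < m := by exact_mod_cast hm
  have hj' : (0 : ℝ) < j := by exact_mod_cast (by omega : 0 < j)
  have h1 : (3 * (n : ℝ) / (j * m)) = 3 / j * (n / m) := by field_simp
  rw [h1, mul_pow]
  gcongr
  rcases hj.eq_or_lt with rfl | hj
  · norm_num
  · have : (3 : ℝ) / j ≤ 1 := by
      rw [div_le_one hj']; exact_mod_cast hj
    calc (3 / j : ℝ) ^ j ≤ 1 := pow_le_one₀ (by positivity) this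
      _ ≤ 3 := by norm_num

/-- In a `k`-graph on `U` without `2`-regular subgraphs, every set of `m` vertices contains
a vertex of small degree. -/
lemma exists_degree_le {k : ℕ} (hk : 3 ≤ k) {H : Finset (Finset V)} {U : Finset V}
    (hs : (H : Set (Finset V)).Sized k) (hU : ∀ e ∈ H, e ⊆ U)
    (hfree : ¬ HasRegularSubgraph 2 H) {T : Finset V} (hT : 1 ≤ T.card) :
    ∃ x ∈ T, (degree H x : ℝ) ≤ 3 * ((U.card : ℝ) / T.card) ^ (k - 1)
      + k * T.card * (U.card : ℝ) ^ (k - 2) := by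
  by_contra hcon
  push Not at hcon
  set m := T.card with hm
  set n := U.card with hn
  have hpos := nonempty_of_sized (by omega) hs
  set B : ℝ := 3 * ((n : ℝ) / m) ^ (k - 1) with hB
  have hB0 : 0 ≤ B := by positivity
  -- An integer strictly above `B`, so that the final bound `d ≤ B` is contradictory.
  set d : ℕ := ⌊B⌋₊ + 1 with hd
  let x : Fin m → V := fun i => (T.equivFin.symm i : V)
  have hxT : ∀ i, x i ∈ T := fun i => (T.equivFin.symm i).2
  have hxi : Function.Injective x := fun a b hab => T.equivFin.symm.injective (Subtype.ext hab)
  have hxs : ∀ y ∈ T, ∃ i, x i = y := fun y hy => ⟨T.equivFin ⟨y, hy⟩, by simp [x]⟩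
  have hdeg : ∀ i, d + k * m * n ^ (k - 2) ≤ degree H (x i) := by
    intro i
    have h1 := hcon (x i) (hxT i)
    have h2 : B < ((degree H (x i) - k * m * n ^ (k - 2) : ℤ) : ℝ) := by
      push_cast; linarith
    have h3 : ((⌊B⌋₊ : ℤ) : ℝ) < ((degree H (x i) - k * m * n ^ (k - 2) : ℤ) : ℝ) :=
      lt_of_le_of_lt (by exact_mod_cast Nat.floor_le hB0) h2
    have h4 : (⌊B⌋₊ : ℤ) < degree H (x i) - k * m * n ^ (k - 2) := by exact_mod_cast h3
    zify
    rw [hd]; push_cast; linarith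
  have hgreedy := pow_le_card_disjoint_tuples (j := k - 1) (d := d) (s := (k - 1) * m) (m := m)
    le_rfl (fun i => linkOutside H U T k (x i))
    (fun i A hA => (mem_linkOutside.1 hA).1.2.le) (by
      intro i Z hZ hZE
      have hxZ : x i ∉ Z := by
        intro hx
        obtain ⟨i', A, hA, hxA⟩ := hZE _ hx
        exact (mem_sdiff.1 ((mem_linkOutside.1 hA).1.1 hxA)).2 (hxT i)
      have h1 := degree_le_card_linkOutside_add (T := T) hs hU hxZ
      have h2 := hdeg i
      have h3 : (T.card + Z.card) * U.card ^ (k - 2) ≤ k * m * n ^ (k - 2) := by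
        refine Nat.mul_le_mul_right _ ?_
        obtain ⟨j, rfl⟩ : ∃ j, k = j + 1 := ⟨k - 1, by omega⟩
        rw [Nat.add_sub_cancel] at hZ
        rw [← hm]; linarith [add_mul j 1 m]
      omega)
  set 𝒢 := (Fintype.piFinset (fun i : Fin m => linkOutside H U T k (x i))).filter
    (fun f => ∀ i i', i ≠ i' → Disjoint (f i) (f i')) with h𝒢
  have hmem : ∀ f ∈ 𝒢, (∀ i, ((f i) ⊆ U \ T ∧ (f i).card = k - 1) ∧ insert (x i) (f i) ∈ H) ∧
      ∀ i i', i ≠ i' → Disjoint (f i) (f i') := by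
    intro f hf
    exact ⟨fun i => mem_linkOutside.1 (Fintype.mem_piFinset.1 (mem_filter.1 hf).1 i),
      (mem_filter.1 hf).2⟩
  have hnot : ∀ f ∈ 𝒢, ∀ i i', x i ∉ f i' := by
    intro f hf i i' hx
    exact (mem_sdiff.1 (((hmem f hf).1 i').1.1 hx)).2 (hxT i)
  have hdis : ∀ f ∈ 𝒢, ∀ i i', i ≠ i' → Disjoint (insert (x i) (f i)) (insert (x i') (f i')) := by
    intro f hf i i' hii
    rw [disjoint_insert_left, disjoint_insert_right]
    refine ⟨?_, hnot f hf i' i, (hmem f hf).2 i i' hii⟩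
    rw [mem_insert]
    rintro (h | h)
    · exact hii (hxi h)
    · exact hnot f hf i i' h
  -- The vertices of `T` are common to all tuples, so the union of the link sets fixes the union of
  -- the edges and hence the matching. The edge through `x i` then returns `f i`, so no factor `m!`
  -- is lost.
  have hcount : 𝒢.card ≤ (powersetCard ((k - 1) * m) U).card := by
    refine card_le_card_of_injOn (fun f => univ.biUnion f) ?_ ?_
    · intro f hf
      obtain ⟨h1, h2⟩ := hmem f hf
      exact mem_coe.2 (mem_powersetCard.2 ⟨biUnion_subset.2 fun i _ => (h1 i).1.1.trans sdiff_subset,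
        card_biUnion_of_disjoint_tuple h2 fun i => (h1 i).1.2⟩)
    · intro f hf f' hf' hff
      simp only at hff
      have hun : ∀ f : Fin m → Finset V,
          univ.biUnion (fun i => insert (x i) (f i)) = univ.image x ∪ univ.biUnion f := by
        intro f
        ext y
        simp only [mem_biUnion, mem_univ, true_and, mem_insert, mem_union, mem_image]
        constructor
        · rintro ⟨i, h | h⟩
          · exact Or.inl ⟨i, h.symm⟩
          · exact Or.inr ⟨i, h⟩
        · rintro (⟨i, h⟩ | ⟨i, h⟩)
          · exact ⟨i, Or.inl h.symm⟩
          · exact ⟨i, Or.inr h⟩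
      have him := image_eq_of_biUnion_eq hfree hpos (f := fun i => insert (x i) (f i))
        (f' := fun i => insert (x i) (f' i)) (fun i => ((hmem f hf).1 i).2)
        (fun i => ((hmem f' hf').1 i).2) (hdis f hf) (hdis f' hf') (by rw [hun, hun, hff])
      funext i
      have hi : insert (x i) (f i) ∈ univ.image (fun i => insert (x i) (f' i)) := by
        rw [← him]; exact mem_image_of_mem _ (mem_univ i)
      obtain ⟨l, _, hl⟩ := mem_image.1 hi
      have hxl : x i ∈ insert (x l) (f' l) := hl ▸ mem_insert_self _ _
      rcases mem_insert.1 hxl with h | h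
      · have := hxi h
        subst this
        have := congrArg (fun s => s.erase (x i)) hl
        rw [erase_insert (hnot f' hf' i i), erase_insert (hnot f hf i i)] at this
        exact this.symm
      · exact absurd h (hnot f' hf' i l)
  rw [card_powersetCard] at hcount
  have hreal : (d : ℝ) ^ m ≤ ((3 * n / ((k - 1 : ℕ) * m)) ^ (k - 1)) ^ m := by
    calc (d : ℝ) ^ m ≤ (n.choose ((k - 1) * m) : ℕ) := by exact_mod_cast hgreedy.trans hcount
      _ ≤ _ := choose_mul_le_pow (by omega) hT
  have hd1 : (d : ℝ) ≤ (3 * n / ((k - 1 : ℕ) * m)) ^ (k - 1) :=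
    (pow_le_pow_iff_left₀ (by positivity) (by positivity) (by omega)).1 hreal
  have hd2 := three_mul_div_pow_le (n := n) (m := m) (j := k - 1) (by omega) hT
  have hd3 : B < d := by rw [hd]; push_cast; exact Nat.lt_floor_add_one B
  exact absurd (hd1.trans hd2) (not_le.2 hd3)

lemma HasRegularSubgraph.mono {r : ℕ} {H H' : Finset (Finset V)} (h : HasRegularSubgraph r H)
    (hH : H ⊆ H') : HasRegularSubgraph r H' := by
  obtain ⟨W, F, hW, hF, h⟩ := h
  exact ⟨W, F, hW, hF.trans hH, h⟩

/-! ### A small set that almost every edge meets exactly once -/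

/-- Measuring `n` on the scale `r ^ 12` makes every auxiliary size below (`r ^ 4`, `r ^ 7`, `r ^ 8`)
an integer power of `r`. -/
lemma exists_twelfth_root {n : ℕ} (hn : 1 ≤ n) : ∃ r, 1 ≤ r ∧ r ^ 12 ≤ n ∧ n < (r + 1) ^ 12 := by
  have h1 : (1 : ℕ) ^ 12 ≤ n := by simpa using hn
  refine ⟨Nat.findGreatest (fun r => r ^ 12 ≤ n) n, Nat.le_findGreatest hn h1,
    Nat.findGreatest_spec (P := fun r => r ^ 12 ≤ n) hn h1, ?_⟩
  by_contra h
  push Not at h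
  have h2 := Nat.le_findGreatest (P := fun r => r ^ 12 ≤ n)
    ((Nat.le_self_pow (by norm_num) _).trans h) h
  omega

/-- If `|U|` is about `r ^ 12`, then a `k`-graph on `U` without `2`-regular subgraphs has a set `T`
of at most `r ^ 4` vertices such that almost all edges meet `T` in exactly one vertex. -/
lemma exists_card_le_sum_linkOutside {k : ℕ} (hk : 3 ≤ k) {H : Finset (Finset V)} {U : Finset V}
    (hs : (H : Set (Finset V)).Sized k) (hU : ∀ e ∈ H, e ⊆ U)
    (hfree : ¬ HasRegularSubgraph 2 H) {r : ℕ} (hr : 1 ≤ r) (hrn : r ^ 12 ≤ U.card)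
    (hnr : U.card < (r + 1) ^ 12) :
    ∃ T ⊆ U, T.card ≤ r ^ 4 ∧ (H.card : ℝ) ≤ ∑ x ∈ T, ((linkOutside H U T k x).card : ℝ)
      + (4097 + k * (k + 3)) * ((U.card : ℝ) ^ (k - 1) / r) := by
  set n := U.card with hn
  have hr1 : (1 : ℝ) ≤ r := by exact_mod_cast hr
  have hr0 : (0 : ℝ) < r := by linarith
  have hrn' : (r : ℝ) ^ 12 ≤ n := by exact_mod_cast hrn
  have hn0 : (0 : ℝ) < n := lt_of_lt_of_le (by positivity) hrn'
  have hnr' : (n : ℝ) ≤ 4096 * r ^ 12 := by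
    calc (n : ℝ) ≤ ((r : ℝ) + 1) ^ 12 := by exact_mod_cast hnr.le
      _ ≤ (2 * r) ^ 12 := by gcongr; linarith
      _ = _ := by ring
  -- The bound of `exists_degree_le` for sets of `r ^ 4` vertices; it therefore cannot be exceeded
  -- at every vertex of such a set.
  set D : ℝ := 3 * ((n : ℝ) / (r ^ 4 : ℕ)) ^ (k - 1) + k * (r ^ 4 : ℕ) * (n : ℝ) ^ (k - 2) with hD
  have hD0 : 0 ≤ D := by positivity
  set T := U.filter (fun x => D < degree H x) with hT
  have hTU : T ⊆ U := filter_subset _ _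
  have hTc : T.card ≤ r ^ 4 := by
    by_contra hlt
    push Not at hlt
    obtain ⟨T', hT', hc⟩ := exists_subset_card_eq hlt.le
    obtain ⟨x, hx, hdx⟩ := exists_degree_le hk hs hU hfree (T := T')
      (by rw [hc]; exact Nat.one_le_pow _ _ hr)
    rw [hc] at hdx
    exact absurd (mem_filter.1 (hT' hx)).2 (not_lt.2 hdx)
  have hnpow : (n : ℝ) ^ (k - 1) = n ^ (k - 2) * n := by
    rw [← pow_succ]; congr 1; omega
  have hq : ∀ c : ℝ, 0 ≤ c → c * (n : ℝ) ^ (k - 2) ≤ c * ((n : ℝ) ^ (k - 1) / r ^ 12) := by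
    intro c hc
    refine mul_le_mul_of_nonneg_left ?_ hc
    rw [hnpow, le_div_iff₀ (by positivity)]
    gcongr
  have hDle : D ≤ (k + 3) * ((n : ℝ) ^ (k - 1) / r ^ 8) := by
    have h1 : ((n : ℝ) / (r ^ 4 : ℕ)) ^ (k - 1) ≤ (n : ℝ) ^ (k - 1) / r ^ 8 := by
      rw [div_pow]
      refine div_le_div_of_nonneg_left (by positivity) (by positivity) ?_
      push_cast
      calc (r : ℝ) ^ 8 = ((r : ℝ) ^ 4) ^ 2 := by ring
        _ ≤ ((r : ℝ) ^ 4) ^ (k - 1) := pow_le_pow_right₀ (one_le_pow₀ hr1) (by omega)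
    have h2 := hq (k * (r ^ 4 : ℕ)) (by positivity)
    have h3 : (k : ℝ) * (r ^ 4 : ℕ) * ((n : ℝ) ^ (k - 1) / r ^ 12)
        = k * ((n : ℝ) ^ (k - 1) / r ^ 8) := by
      push_cast; field_simp
    rw [h3] at h2
    rw [hD]; linarith
  -- edges avoiding `T`
  have hH0 : ((H.filter (fun e => (e ∩ T).card = 0)).card : ℝ) ≤
      (4096 + k * (k + 3)) * ((n : ℝ) ^ (k - 1) / r) := by
    have hdeg : ∀ x, degree (H.filter (fun e => (e ∩ T).card = 0)) x ≤ ⌊D⌋₊ := by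
      intro x
      by_cases hxT : x ∈ T
      · have : degree (H.filter (fun e => (e ∩ T).card = 0)) x = 0 := by
          rw [degree, card_eq_zero, filter_eq_empty_iff]
          intro e he hxe
          have := (mem_filter.1 he).2
          rw [card_eq_zero] at this
          exact notMem_empty x (this ▸ mem_inter.2 ⟨hxe, hxT⟩)
        omega
      · refine Nat.le_floor ?_
        have hle : degree (H.filter (fun e => (e ∩ T).card = 0)) x ≤ degree H x :=
          card_le_card (filter_subset_filter _ (filter_subset _ _))
        by_cases hxU : x ∈ U
        · have hxD : (degree H x : ℝ) ≤ D := by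
            by_contra h
            exact hxT (mem_filter.2 ⟨hxU, not_le.1 h⟩)
          exact le_trans (by exact_mod_cast hle) hxD
        · have : degree H x = 0 := by
            rw [degree, card_eq_zero, filter_eq_empty_iff]
            exact fun e he hxe => hxU (hU e he hxe)
          rw [this] at hle
          rw [Nat.le_zero.1 hle]; simpa using hD0
    -- The choice `m = r ^ 7` balances the two terms: `n ^ k / m ^ (k - 1)` is at most `n ^ k / r ^
    -- 14` with `n` of order `r ^ 12`, and `m * D` is of order `n ^ (k - 1) / r`.
    have h1 := card_le_of_degree_le hk (H := H.filter (fun e => (e ∩ T).card = 0)) (U := U)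
      (fun e he => hs (mem_filter.1 he).1) (fun e he => hU e (mem_filter.1 he).1)
      (fun h => hfree (h.mono (filter_subset _ _))) hdeg (m := r ^ 7) (Nat.one_le_pow _ _ hr)
    have hfl : ((⌊D⌋₊ : ℕ) : ℝ) ≤ (k + 3) * ((n : ℝ) ^ (k - 1) / r ^ 8) :=
      (Nat.floor_le hD0).trans hDle
    have h2 : (n : ℝ) ^ k / ((r ^ 7 : ℕ) : ℝ) ^ (k - 1) ≤ 4096 * ((n : ℝ) ^ (k - 1) / r) := by
      have hkk : (n : ℝ) ^ k = n ^ (k - 1) * n := by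
        rw [← pow_succ]; congr 1; omega
      have h3 : (r : ℝ) ^ 14 ≤ ((r ^ 7 : ℕ) : ℝ) ^ (k - 1) := by
        push_cast
        calc (r : ℝ) ^ 14 = ((r : ℝ) ^ 7) ^ 2 := by ring
          _ ≤ ((r : ℝ) ^ 7) ^ (k - 1) := pow_le_pow_right₀ (one_le_pow₀ hr1) (by omega)
      calc (n : ℝ) ^ k / ((r ^ 7 : ℕ) : ℝ) ^ (k - 1) ≤ n ^ k / r ^ 14 :=
            div_le_div_of_nonneg_left (by positivity) (by positivity) h3
        _ ≤ n ^ (k - 1) * (4096 * r ^ 12) / r ^ 14 := by rw [hkk]; gcongr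
        _ = 4096 * (n ^ (k - 1) / r ^ 2) := by field_simp
        _ ≤ _ := by
          gcongr
          exact le_self_pow₀ hr1 (by norm_num)
    have h4 : (k : ℝ) * ((r ^ 7 : ℕ) : ℝ) * (⌊D⌋₊ : ℕ) ≤ k * (k + 3) * ((n : ℝ) ^ (k - 1) / r) := by
      calc (k : ℝ) * ((r ^ 7 : ℕ) : ℝ) * (⌊D⌋₊ : ℕ)
          ≤ k * ((r ^ 7 : ℕ) : ℝ) * ((k + 3) * ((n : ℝ) ^ (k - 1) / r ^ 8)) := by gcongr
        _ = _ := by push_cast; field_simp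
    linarith
  have hH1 : (H.filter (fun e => (e ∩ T).card = 1)).card ≤
      ∑ x ∈ T, (linkOutside H U T k x).card := by
    have hsub : H.filter (fun e => (e ∩ T).card = 1) ⊆
        T.biUnion (fun x => (linkOutside H U T k x).image (insert x)) := by
      intro e he
      rw [mem_filter, card_eq_one] at he
      obtain ⟨heH, x, hx⟩ := he
      have hx' : x ∈ e ∩ T := by rw [hx]; exact mem_singleton_self x
      rw [mem_inter] at hx'
      refine mem_biUnion.2 ⟨x, hx'.2, mem_image.2 ⟨e.erase x, mem_linkOutside.2
        ⟨⟨fun y hy => ?_, ?_⟩, ?_⟩, insert_erase hx'.1⟩⟩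
      · rw [mem_erase] at hy
        refine mem_sdiff.2 ⟨hU e heH hy.2, fun hyT => hy.1 ?_⟩
        have : y ∈ e ∩ T := mem_inter.2 ⟨hy.2, hyT⟩
        rwa [hx, mem_singleton] at this
      · rw [card_erase_of_mem hx'.1, hs heH]
      · rw [insert_erase hx'.1]; exact heH
    exact (card_le_card hsub).trans (card_biUnion_le.trans (sum_le_sum fun x _ => card_image_le))
  have hH2 : ((H.filter (fun e => 2 ≤ (e ∩ T).card)).card : ℝ) ≤ (n : ℝ) ^ (k - 1) / r := by
    have hsub : H.filter (fun e => 2 ≤ (e ∩ T).card) ⊆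
        T.offDiag.biUnion (fun p => H.filter (fun e => {p.1, p.2} ⊆ e)) := by
      intro e he
      rw [mem_filter] at he
      obtain ⟨a, ha, b, hb, hab⟩ := one_lt_card.1 he.2
      rw [mem_inter] at ha hb
      refine mem_biUnion.2 ⟨(a, b), mem_offDiag.2 ⟨ha.2, hb.2, hab⟩, mem_filter.2 ⟨he.1, ?_⟩⟩
      simp [insert_subset_iff, ha.1, hb.1]
    have h1 : (H.filter (fun e => 2 ≤ (e ∩ T).card)).card ≤ r ^ 8 * n ^ (k - 2) := by
      refine (card_le_card hsub).trans ((card_biUnion_le_card_mul _ _ (n ^ (k - 2))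
        fun p hp => ?_).trans (Nat.mul_le_mul_right _ ?_))
      · have hne := (mem_offDiag.1 hp).2.2
        rw [← card_pair hne]
        exact card_le_pow_of_superset fun e he =>
          ⟨hs (mem_filter.1 he).1, hU e (mem_filter.1 he).1, (mem_filter.1 he).2⟩
      · rw [offDiag_card]
        calc T.card * T.card - T.card ≤ T.card * T.card := Nat.sub_le _ _
          _ ≤ r ^ 4 * r ^ 4 := Nat.mul_le_mul hTc hTc
          _ = r ^ 8 := by ring
    calc ((H.filter (fun e => 2 ≤ (e ∩ T).card)).card : ℝ) ≤ r ^ 8 * (n : ℝ) ^ (k - 2) := by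
          exact_mod_cast h1
      _ ≤ r ^ 8 * ((n : ℝ) ^ (k - 1) / r ^ 12) := hq _ (by positivity)
      _ = (n : ℝ) ^ (k - 1) / r ^ 4 := by field_simp
      _ ≤ _ := by
        gcongr
        exact le_self_pow₀ hr1 (by norm_num)
  refine ⟨T, hTU, hTc, ?_⟩
  have hsplit : H.card ≤ (H.filter (fun e => (e ∩ T).card = 0)).card +
      (H.filter (fun e => (e ∩ T).card = 1)).card +
      (H.filter (fun e => 2 ≤ (e ∩ T).card)).card := by
    refine (card_le_card (t := H.filter (fun e => (e ∩ T).card = 0) ∪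
      H.filter (fun e => (e ∩ T).card = 1) ∪ H.filter (fun e => 2 ≤ (e ∩ T).card)) ?_).trans
      ((card_union_le _ _).trans (Nat.add_le_add_right (card_union_le _ _) _))
    intro e he
    simp only [mem_union, mem_filter, he, true_and]
    omega
  have hsplit' : (H.card : ℝ) ≤ ((H.filter (fun e => (e ∩ T).card = 0)).card : ℝ) +
      (H.filter (fun e => (e ∩ T).card = 1)).card +
      (H.filter (fun e => 2 ≤ (e ∩ T).card)).card := by exact_mod_cast hsplit
  have hH1' : ((H.filter (fun e => (e ∩ T).card = 1)).card : ℝ) ≤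
      ∑ x ∈ T, ((linkOutside H U T k x).card : ℝ) := by exact_mod_cast hH1
  linarith

/-- If two common link sets `A`, `A₀` were disjoint, then `xA, yA₀` and `xA₀, yA` would be matchings
with the same union. So all common sets meet a fixed one. -/
lemma card_linkOutside_inter_le {k : ℕ} (hk : 3 ≤ k) {H : Finset (Finset V)} {U T : Finset V}
    (hs : (H : Set (Finset V)).Sized k) (hfree : ¬ HasRegularSubgraph 2 H) {x y : V}
    (hx : x ∈ T) (hy : y ∈ T) (hxy : x ≠ y) :
    (linkOutside H U T k x ∩ linkOutside H U T k y).card ≤ k * U.card ^ (k - 2) := by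
  rcases (linkOutside H U T k x ∩ linkOutside H U T k y).eq_empty_or_nonempty with h | ⟨A₀, hA₀⟩
  · rw [h]; simp
  have hdis : ∀ A ∈ linkOutside H U T k x ∩ linkOutside H U T k y, ¬ Disjoint A A₀ := by
    intro A hA hd
    simp only [mem_inter, mem_linkOutside] at hA hA₀
    have nm : ∀ {z : V} {B : Finset V}, z ∈ T → B ⊆ U \ T → z ∉ B :=
      fun hz hB hzB => (mem_sdiff.1 (hB hzB)).2 hz
    have hxA := nm hx hA.1.1.1
    have hyA := nm hy hA.1.1.1
    have hxA₀ := nm hx hA₀.1.1.1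
    have hyA₀ := nm hy hA₀.1.1.1
    refine hfree (hasRegularSubgraph_of_pairs (nonempty_of_sized (by omega) hs)
      (a := insert x A) (b := insert y A₀) (c := insert x A₀) (d := insert y A)
      hA.1.2 hA₀.2.2 hA₀.1.2 hA.2.2 ?_ ?_ ?_ ?_ ?_)
    · simp [disjoint_insert_left, disjoint_insert_right, hxy.symm, hxA₀, hyA, hd]
    · simp [disjoint_insert_left, disjoint_insert_right, hxy.symm, hxA, hyA₀, hd.symm]
    · ext z; simp only [mem_union, mem_insert]; tauto
    · intro h
      have h' := congrArg (fun s => s.erase x) h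
      simp only [erase_insert hxA, erase_insert hxA₀] at h'
      rw [h', disjoint_self_iff_empty] at hd
      have := hA₀.1.1.2
      rw [hd, card_empty] at this
      omega
    · intro h
      have : x ∈ insert y A := h ▸ mem_insert_self x A
      rw [mem_insert] at this
      tauto
  have h1 := card_filter_not_disjoint_le (𝓕 := linkOutside H U T k x ∩ linkOutside H U T k y)
    (U := U) (Z := A₀) (P := ∅) (k := k - 1) (by simp) (by
      intro A hA
      simp only [mem_inter, mem_linkOutside] at hA
      exact ⟨hA.1.1.2, hA.1.1.1.trans sdiff_subset, empty_subset _⟩)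
  rw [filter_true_of_mem hdis] at h1
  simp only [mem_inter, mem_linkOutside] at hA₀
  rw [hA₀.1.1.2, card_empty] at h1
  refine h1.trans (Nat.mul_le_mul (by omega) (le_of_eq ?_))
  congr 1

/-- Adding the links one at a time, each overlaps the union of the earlier ones in at most `|T|`
small pairwise intersections. -/
lemma sum_card_linkOutside_le {k : ℕ} (hk : 3 ≤ k) {H : Finset (Finset V)} {U T : Finset V}
    (hs : (H : Set (Finset V)).Sized k) (hfree : ¬ HasRegularSubgraph 2 H) :
    ∑ x ∈ T, (linkOutside H U T k x).card ≤
      (T.biUnion (linkOutside H U T k)).card + T.card * (T.card * (k * U.card ^ (k - 2))) := by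
  suffices h : ∀ S ⊆ T, ∑ x ∈ S, (linkOutside H U T k x).card ≤
      (S.biUnion (linkOutside H U T k)).card + S.card * (T.card * (k * U.card ^ (k - 2))) from
    h T Subset.rfl
  intro S
  induction S using Finset.induction_on with
  | empty => simp
  | insert x S hxS ih =>
    intro hST
    rw [insert_subset_iff] at hST
    have ih := ih hST.2
    rw [sum_insert hxS, biUnion_insert, card_insert_of_notMem hxS]
    have h1 := card_union_add_card_inter (linkOutside H U T k x) (S.biUnion (linkOutside H U T k))
    have h2 : (linkOutside H U T k x ∩ S.biUnion (linkOutside H U T k)).card ≤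
        T.card * (k * U.card ^ (k - 2)) := by
      rw [inter_biUnion]
      refine (card_biUnion_le_card_mul _ _ (k * U.card ^ (k - 2)) fun y hy => ?_).trans
        (Nat.mul_le_mul_right _ (card_le_card hST.2))
      exact card_linkOutside_inter_le hk hs hfree hST.1 (hST.2 hy) (fun h => hxS (h ▸ hy))
    rw [add_mul, one_mul]
    omega

/-- The colored `(k - 1)`-sets account for almost all edges. -/
lemma exists_card_le_biUnion_linkOutside {k : ℕ} (hk : 3 ≤ k) {H : Finset (Finset V)}
    {U : Finset V} (hs : (H : Set (Finset V)).Sized k) (hU : ∀ e ∈ H, e ⊆ U)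
    (hfree : ¬ HasRegularSubgraph 2 H) {r : ℕ} (hr : 1 ≤ r) (hrn : r ^ 12 ≤ U.card)
    (hnr : U.card < (r + 1) ^ 12) :
    ∃ T ⊆ U, T.card ≤ r ^ 4 ∧ (H.card : ℝ) ≤ ((T.biUnion (linkOutside H U T k)).card : ℝ)
      + (4097 + k * (k + 4)) * ((U.card : ℝ) ^ (k - 1) / r) := by
  obtain ⟨T, hTU, hTc, hT⟩ := exists_card_le_sum_linkOutside hk hs hU hfree hr hrn hnr
  refine ⟨T, hTU, hTc, ?_⟩
  have h1 : ((∑ x ∈ T, (linkOutside H U T k x).card : ℕ) : ℝ) ≤ _ :=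
    Nat.cast_le.2 (sum_card_linkOutside_le hk hs hfree (U := U) (T := T))
  push_cast at h1
  have hr1 : (1 : ℝ) ≤ r := by exact_mod_cast hr
  have hrn' : (r : ℝ) ^ 12 ≤ U.card := by exact_mod_cast hrn
  have hTc' : (T.card : ℝ) ≤ r ^ 4 := by exact_mod_cast hTc
  have h2 : (T.card : ℝ) * (T.card * (k * (U.card : ℝ) ^ (k - 2))) ≤
      k * ((U.card : ℝ) ^ (k - 1) / r) := by
    have hnpow : (U.card : ℝ) ^ (k - 1) = U.card ^ (k - 2) * U.card := by
      rw [← pow_succ]; congr 1; omega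
    calc (T.card : ℝ) * (T.card * (k * (U.card : ℝ) ^ (k - 2)))
        ≤ r ^ 4 * (r ^ 4 * (k * (U.card : ℝ) ^ (k - 2))) := by gcongr
      _ = k * (U.card ^ (k - 2) * r ^ 9 / r) := by field_simp
      _ ≤ k * (U.card ^ (k - 2) * r ^ 12 / r) := by
        refine mul_le_mul_of_nonneg_left (div_le_div_of_nonneg_right ?_ (by positivity))
          (by positivity)
        exact mul_le_mul_of_nonneg_left (pow_le_pow_right₀ hr1 (by norm_num)) (by positivity)
      _ ≤ _ := by rw [hnpow]; gcongr
  linarith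

/-- A `k`-graph on `U` without `2`-regular subgraphs has `O(|U| ^ (k - 1))` edges. -/
lemma card_le_mul_pow {k : ℕ} (hk : 3 ≤ k) {H : Finset (Finset V)} {U : Finset V}
    (hs : (H : Set (Finset V)).Sized k) (hU : ∀ e ∈ H, e ⊆ U)
    (hfree : ¬ HasRegularSubgraph 2 H) :
    (H.card : ℝ) ≤ (4098 + k * (k + 4)) * (U.card : ℝ) ^ (k - 1) := by
  rcases Nat.eq_zero_or_pos U.card with h0 | hpos
  · have : H = ∅ := by
      rw [eq_empty_iff_forall_notMem]
      intro e he
      have h1 := card_le_card (hU e he)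
      rw [hs he, h0] at h1
      omega
    rw [this, card_empty]
    push_cast; positivity
  obtain ⟨r, hr, hrn, hnr⟩ := exists_twelfth_root hpos
  obtain ⟨T, hTU, hTc, hT⟩ := exists_card_le_biUnion_linkOutside hk hs hU hfree hr hrn hnr
  have h1 : (T.biUnion (linkOutside H U T k)).card ≤ U.card ^ (k - 1) := by
    have := card_le_pow_of_superset (𝓕 := T.biUnion (linkOutside H U T k)) (U := U) (P := ∅)
      (k := k - 1) (by
        intro A hA
        obtain ⟨x, _, hx⟩ := mem_biUnion.1 hA
        rw [mem_linkOutside] at hx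
        exact ⟨hx.1.2, hx.1.1.trans sdiff_subset, empty_subset _⟩)
    simpa using this
  have h1' : ((T.biUnion (linkOutside H U T k)).card : ℝ) ≤ (U.card : ℝ) ^ (k - 1) := by
    exact_mod_cast h1
  have hr1 : (1 : ℝ) ≤ r := by exact_mod_cast hr
  have h2 : (U.card : ℝ) ^ (k - 1) / r ≤ (U.card : ℝ) ^ (k - 1) :=
    div_le_self (by positivity) hr1
  have h3 : (4097 + k * (k + 4) : ℝ) * ((U.card : ℝ) ^ (k - 1) / r) ≤
      (4097 + k * (k + 4)) * (U.card : ℝ) ^ (k - 1) := by gcongr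
  linarith

end

/-! ### Tuples, hybrids and the coloring by links -/

section
variable {V : Type*} [DecidableEq V] [Fintype V]

/-- Hybrid argument: two independent tuples get different values only if some single-coordinate
replacement changes the value. -/
lemma card_ne_le_sum_card_update_ne {ι α : Type*} [DecidableEq ι] [Fintype ι] [DecidableEq α]
    (c : (ι → V) → α) :
    ((univ : Finset ((ι → V) × (ι → V))).filter (fun p => c p.1 ≠ c p.2)).card ≤
      ∑ i, ((univ : Finset ((ι → V) × (ι → V))).filter
        (fun p => c p.1 ≠ c (Function.update p.1 i (p.2 i)))).card := by
  suffices h : ∀ s : Finset ι, ((univ : Finset ((ι → V) × (ι → V))).filter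
      (fun p => c p.1 ≠ c (s.piecewise p.2 p.1))).card ≤
      ∑ i ∈ s, ((univ : Finset ((ι → V) × (ι → V))).filter
        (fun p => c p.1 ≠ c (Function.update p.1 i (p.2 i)))).card by
    simpa using h univ
  intro s
  induction s using Finset.induction_on with
  | empty => simp
  | insert i s his ih =>
    rw [sum_insert his]
    have hsub : (univ : Finset ((ι → V) × (ι → V))).filter
        (fun p => c p.1 ≠ c ((insert i s).piecewise p.2 p.1)) ⊆
        univ.filter (fun p => c (s.piecewise p.2 p.1) ≠ c ((insert i s).piecewise p.2 p.1)) ∪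
        univ.filter (fun p => c p.1 ≠ c (s.piecewise p.2 p.1)) := by
      intro p hp
      simp only [mem_union, mem_filter, mem_univ, true_and] at hp ⊢
      by_contra hcon
      push Not at hcon
      exact hp (hcon.2.trans hcon.1)
    refine (card_le_card hsub).trans ((card_union_le _ _).trans (Nat.add_le_add ?_ ih))
    -- Swapping the coordinates in `s` between the two tuples turns two consecutive hybrids into a
    -- tuple and its update at `i`.
    refine card_le_card_of_injOn (fun p => (s.piecewise p.2 p.1, s.piecewise p.1 p.2)) ?_ ?_
    · intro p hp
      have hp := (mem_filter.1 (mem_coe.1 hp)).2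
      refine mem_coe.2 (mem_filter.2 ⟨mem_univ _, ?_⟩)
      rw [piecewise_insert] at hp
      simpa [his] using hp
    · rintro ⟨u, w⟩ _ ⟨u', w'⟩ _ h
      simp only [Prod.mk.injEq] at h
      ext l
      · have h1 := congrFun h.1 l
        have h2 := congrFun h.2 l
        by_cases hl : l ∈ s <;> simp [hl] at h1 h2 ⊢ <;> assumption
      · have h1 := congrFun h.1 l
        have h2 := congrFun h.2 l
        by_cases hl : l ∈ s <;> simp [hl] at h1 h2 ⊢ <;> assumption

/-- Replacing one coordinate by an independent one preserves the uniform distribution. -/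
lemma card_filter_update {ι : Type*} [DecidableEq ι] [Fintype ι] (P : (ι → V) → Prop)
    [DecidablePred P] (i : ι) :
    ((univ : Finset ((ι → V) × (ι → V))).filter
      (fun p => P (Function.update p.1 i (p.2 i)))).card ≤
    Fintype.card V ^ Fintype.card ι * ((univ : Finset (ι → V)).filter P).card := by
  have h : Fintype.card V ^ Fintype.card ι * ((univ : Finset (ι → V)).filter P).card =
      (((univ : Finset (ι → V)).filter P) ×ˢ (univ : Finset (ι → V))).card := by
    rw [card_product, card_univ, Fintype.card_fun, mul_comm]
  rw [h]
  refine card_le_card_of_injOn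
    (fun p => (Function.update p.1 i (p.2 i), Function.update p.2 i (p.1 i))) ?_ ?_
  · intro p hp
    have hp := (mem_filter.1 (mem_coe.1 hp)).2
    exact mem_coe.2 (mem_product.2 ⟨mem_filter.2 ⟨mem_univ _, hp⟩, mem_univ _⟩)
  · rintro ⟨u, w⟩ _ ⟨u', w'⟩ _ h
    simp only [Prod.mk.injEq] at h
    ext l
    · by_cases hl : l = i
      · subst hl; simpa using congrFun h.2 l
      · simpa [hl] using congrFun h.1 l
    · by_cases hl : l = i
      · subst hl; simpa using congrFun h.1 l
      · simpa [hl] using congrFun h.2 l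

lemma card_filter_apply_eq_apply_eq_le {K : ℕ} {i j : Fin K} (hij : i ≠ j) (a b : V) :
    ((univ : Finset (Fin K → V)).filter (fun t => t i = a ∧ t j = b)).card ≤
      Fintype.card V ^ (K - 2) := by
  have hsub : (univ : Finset (Fin K → V)).filter (fun t => t i = a ∧ t j = b) ⊆
      Fintype.piFinset (fun l => if l = i then {a} else if l = j then {b} else univ) := by
    intro t ht
    simp only [mem_filter, mem_univ, true_and] at ht
    rw [Fintype.mem_piFinset]
    intro l
    by_cases hl : l = i
    · subst hl; simp [ht.1]
    · by_cases hl' : l = j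
      · subst hl'; simp [hl, ht.2]
      · simp [hl, hl']
  refine (card_le_card hsub).trans ?_
  rw [Fintype.card_piFinset]
  have h1 : ∀ l, (if l = i then ({a} : Finset V) else if l = j then {b} else univ).card =
      if l ∈ ({i, j} : Finset (Fin K)) then 1 else Fintype.card V := by
    intro l
    by_cases hl : l = i
    · simp [hl]
    · by_cases hl' : l = j
      · simp [hl']; split_ifs <;> simp
      · simp [hl, hl', card_univ]
  rw [prod_congr rfl (fun l _ => h1 l), prod_ite, prod_const_one, one_mul, prod_const]
  refine le_of_eq ?_
  congr 1
  have : (univ.filter (fun l => l ∉ ({i, j} : Finset (Fin K)))) = univ \ {i, j} := by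
    ext; simp
  rw [this, card_sdiff_of_subset (subset_univ _), card_pair hij, card_univ, Fintype.card_fin]

lemma card_filter_apply_eq_apply_le {K : ℕ} {i j : Fin K} (hij : i ≠ j) :
    ((univ : Finset (Fin K → V)).filter (fun t => t i = t j)).card ≤
      Fintype.card V ^ (K - 1) := by
  have hsub : (univ : Finset (Fin K → V)).filter (fun t => t i = t j) ⊆
      univ.biUnion (fun a => univ.filter (fun t => t i = a ∧ t j = a)) := by
    intro t ht
    simp only [mem_filter, mem_univ, true_and, mem_biUnion] at ht ⊢
    exact ⟨t i, rfl, ht.symm⟩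
  refine (card_le_card hsub).trans ((card_biUnion_le_card_mul _ _ _ fun a _ =>
    card_filter_apply_eq_apply_eq_le hij a a).trans ?_)
  rw [card_univ, mul_comm, ← pow_succ]
  have := i.2
  have := j.2
  have : (i : ℕ) ≠ j := fun h => hij (Fin.ext h)
  refine le_of_eq ?_
  congr 1
  omega

lemma card_not_injective_le (K : ℕ) :
    ((univ : Finset (Fin K → V)).filter (fun t => ¬ Function.Injective t)).card ≤
      K * K * Fintype.card V ^ (K - 1) := by
  have hsub : (univ : Finset (Fin K → V)).filter (fun t => ¬ Function.Injective t) ⊆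
      (univ : Finset (Fin K)).offDiag.biUnion (fun p => univ.filter (fun t => t p.1 = t p.2)) := by
    intro t ht
    simp only [mem_filter, mem_univ, true_and, mem_biUnion, mem_offDiag] at ht ⊢
    rw [Function.Injective] at ht
    push Not at ht
    obtain ⟨a, b, hab, hne⟩ := ht
    exact ⟨(a, b), hne, hab⟩
  refine (card_le_card hsub).trans ((card_biUnion_le_card_mul _ _ _ fun p hp =>
    card_filter_apply_eq_apply_le (mem_offDiag.1 hp).2.2).trans (Nat.mul_le_mul_right _ ?_))
  rw [offDiag_card, card_univ, Fintype.card_fin]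
  exact Nat.sub_le _ _

lemma card_image_mem_le (K : ℕ) (𝓕 : Finset (Finset V)) (h : ∀ A ∈ 𝓕, A.card = K) :
    ((univ : Finset (Fin K → V)).filter (fun t => univ.image t ∈ 𝓕)).card ≤ 𝓕.card * K ^ K := by
  have hsub : (univ : Finset (Fin K → V)).filter (fun t => univ.image t ∈ 𝓕) ⊆
      𝓕.biUnion (fun A => Fintype.piFinset (fun _ => A)) := by
    intro t ht
    simp only [mem_filter, mem_univ, true_and] at ht
    refine mem_biUnion.2 ⟨_, ht, Fintype.mem_piFinset.2 fun i => mem_image_of_mem t (mem_univ i)⟩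
  refine (card_le_card hsub).trans (card_biUnion_le_card_mul _ _ _ fun A hA => ?_)
  rw [Fintype.card_piFinset, prod_const, card_univ, Fintype.card_fin, h A hA]

/-- For disjoint `S`, `S'` the pairs `xaS, ybS'` and `xaS', ybS` would be matchings with the same
union. -/
lemma not_disjoint_of_insert_mem_linkOutside {k : ℕ} {H : Finset (Finset V)}
    {U T : Finset V} (hs : (H : Set (Finset V)).Sized k) (hfree : ¬ HasRegularSubgraph 2 H)
    {x y a b : V} {S S' : Finset V} (hx : x ∈ T) (hy : y ∈ T) (hxy : x ≠ y) (hab : a ≠ b)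
    (hn : a ∉ S ∧ a ∉ S' ∧ b ∉ S ∧ b ∉ S') (hSne : S.Nonempty)
    (h1 : insert a S ∈ linkOutside H U T k x) (h2 : insert a S' ∈ linkOutside H U T k x)
    (h3 : insert b S ∈ linkOutside H U T k y) (h4 : insert b S' ∈ linkOutside H U T k y) :
    ¬ Disjoint S S' := by
  intro hSS
  obtain ⟨haS, haS', hbS, hbS'⟩ := hn
  have nm : ∀ {z w : V} {B : Finset V}, z ∈ T → B ∈ linkOutside H U T k w → z ∉ B :=
    fun hz hB hzB => (mem_sdiff.1 ((mem_linkOutside.1 hB).1.1 hzB)).2 hz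
  have hpos : ∀ e ∈ H, e.Nonempty := by
    refine nonempty_of_sized ?_ hs
    rw [← hs (mem_linkOutside.1 h1).2]
    exact card_pos.2 ⟨x, mem_insert_self _ _⟩
  have n1 := nm hx h1
  have n2 := nm hy h1
  have n3 := nm hx h2
  have n4 := nm hy h2
  have n5 := nm hx h3
  have n6 := nm hx h4
  simp only [mem_insert, not_or] at n1 n2 n3 n4 n5 n6
  refine hfree (hasRegularSubgraph_of_pairs hpos
    (a := insert x (insert a S)) (b := insert y (insert b S'))
    (c := insert x (insert a S')) (d := insert y (insert b S))
    (mem_linkOutside.1 h1).2 (mem_linkOutside.1 h4).2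
    (mem_linkOutside.1 h2).2 (mem_linkOutside.1 h3).2 ?_ ?_ ?_ ?_ ?_)
  · simp only [disjoint_insert_left, disjoint_insert_right, mem_insert, not_or]
    exact ⟨⟨hxy.symm, n2⟩, ⟨fun h => n6.1 h.symm, hab.symm, hbS⟩, n6.2, haS', hSS⟩
  · simp only [disjoint_insert_left, disjoint_insert_right, mem_insert, not_or]
    exact ⟨⟨hxy.symm, n4⟩, ⟨fun h => n5.1 h.symm, hab.symm, hbS'⟩, n5.2, haS, hSS.symm⟩
  · simp only [insert_eq]
    ac_rfl
  · intro h
    have h' : ((insert x (insert a S)).erase x).erase a =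
        ((insert x (insert a S')).erase x).erase a := by rw [h]
    have e1 : x ∉ insert a S := by simp [n1]
    have e2 : x ∉ insert a S' := by simp [n3]
    rw [erase_insert e1, erase_insert e2, erase_insert haS, erase_insert haS'] at h'
    rw [← h', disjoint_self_iff_empty] at hSS
    exact hSne.ne_empty hSS
  · intro h
    have : x ∈ insert y (insert b S) := h ▸ mem_insert_self x _
    rw [mem_insert, mem_insert] at this
    rcases this with h | h | h
    · exact hxy h
    · exact n5.1 h
    · exact n5.2 h

/-- Tuples in the link of `x` which a fixed single-coordinate change moves to the link of `y`. -/
lemma card_update_mem_linkOutside_le {k : ℕ} (hk : 3 ≤ k) {H : Finset (Finset V)}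
    {T : Finset V} (hs : (H : Set (Finset V)).Sized k) (hfree : ¬ HasRegularSubgraph 2 H) {x y : V}
    (hx : x ∈ T) (hy : y ∈ T) (hxy : x ≠ y) (i : Fin (k - 1)) (a b : V) :
    ((univ : Finset (Fin (k - 1) → V)).filter (fun t => t i = a ∧
      univ.image t ∈ linkOutside H univ T k x ∧
      univ.image (Function.update t i b) ∈ linkOutside H univ T k y ∧ a ≠ b)).card ≤
    (k * k) * Fintype.card V ^ (k - 1 - 2) := by
  set 𝒯 := (univ : Finset (Fin (k - 1) → V)).filter (fun t => t i = a ∧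
      univ.image t ∈ linkOutside H univ T k x ∧
      univ.image (Function.update t i b) ∈ linkOutside H univ T k y ∧ a ≠ b) with h𝒯
  have hinj : ∀ {t : Fin (k - 1) → V} {z : V}, univ.image t ∈ linkOutside H univ T k z →
      Function.Injective t := by
    intro t z ht
    have h1 := (mem_linkOutside.1 ht).1.2
    have h2 : (univ.image t).card = (univ : Finset (Fin (k - 1))).card := by
      rw [h1, card_univ, Fintype.card_fin]
    rw [card_image_iff] at h2
    intro p q hpq
    exact h2 (mem_coe.2 (mem_univ p)) (mem_coe.2 (mem_univ q)) hpq
  have hmeet : ∀ t ∈ 𝒯, ∀ t' ∈ 𝒯, ∃ j l, j ≠ i ∧ t j = t' l := by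
    intro t ht t' ht'
    by_contra hcon
    push Not at hcon
    simp only [h𝒯, mem_filter, mem_univ, true_and] at ht ht'
    obtain ⟨hta, htx, hty, hab⟩ := ht
    obtain ⟨hta', htx', hty', -⟩ := ht'
    have hti := hinj htx
    have hti' := hinj htx'
    have nm : ∀ {z w : V} {B : Finset V}, z ∈ T → B ∈ linkOutside H univ T k w → z ∉ B :=
      fun hz hB hzB => (mem_sdiff.1 ((mem_linkOutside.1 hB).1.1 hzB)).2 hz
    set S := (univ.erase i).image t with hS
    set S' := (univ.erase i).image t' with hS'
    have him : ∀ t : Fin (k - 1) → V, univ.image t = insert (t i) ((univ.erase i).image t) := by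
      intro t
      rw [← image_insert, insert_erase (mem_univ i)]
    have himu : ∀ t : Fin (k - 1) → V, univ.image (Function.update t i b) =
        insert b ((univ.erase i).image t) := by
      intro t
      rw [him]
      congr 1
      · simp
      · exact image_congr fun l hl => by
          have : l ≠ i := (mem_erase.1 (mem_coe.1 hl)).1
          simp [this]
    rw [him, hta] at htx
    rw [him, hta'] at htx'
    rw [himu] at hty hty'
    rw [← hS] at htx hty
    rw [← hS'] at htx' hty'
    have hSS : Disjoint S S' := by
      rw [Finset.disjoint_left]
      intro z hz hz'
      obtain ⟨j, hj, rfl⟩ := mem_image.1 hz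
      obtain ⟨l, hl, hjl⟩ := mem_image.1 hz'
      exact hcon j l (mem_erase.1 hj).1 hjl.symm
    have haS : a ∉ S := by
      intro h
      obtain ⟨j, hj, hja⟩ := mem_image.1 h
      exact (mem_erase.1 hj).1 (hti (hja.trans hta.symm))
    have haS' : a ∉ S' := by
      intro h
      obtain ⟨j, hj, hja⟩ := mem_image.1 h
      exact (mem_erase.1 hj).1 (hti' (hja.trans hta'.symm))
    have hcardS : ∀ {S : Finset V} {z w : V}, insert z S ∈ linkOutside H univ T k w →
        S.card = k - 2 → z ∉ S := by
      intro S z w h1 h2 h3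
      rw [insert_eq_of_mem h3] at h1
      have := (mem_linkOutside.1 h1).1.2
      omega
    have hSc : S.card = k - 2 := by
      have := (mem_linkOutside.1 htx).1.2
      rw [card_insert_of_notMem haS] at this
      omega
    have hSc' : S'.card = k - 2 := by
      have := (mem_linkOutside.1 htx').1.2
      rw [card_insert_of_notMem haS'] at this
      omega
    have hbS := hcardS hty hSc
    have hbS' := hcardS hty' hSc'
    exact not_disjoint_of_insert_mem_linkOutside hs hfree hx hy hxy hab ⟨haS, haS', hbS, hbS'⟩
      (card_pos.1 (by omega)) htx htx' hty hty' hSS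
  rcases 𝒯.eq_empty_or_nonempty with h | ⟨t₀, ht₀⟩
  · rw [h]; simp
  -- Relative to a fixed `t₀`, each tuple has two prescribed coordinates: `i`, and some `j ≠ i`
  -- whose value is an entry of `t₀`.
  have hsub : 𝒯 ⊆ ((univ.erase i) ×ˢ (univ : Finset (Fin (k - 1)))).biUnion
      (fun p => univ.filter (fun t => t p.1 = t₀ p.2 ∧ t i = a)) := by
    intro t ht
    obtain ⟨j, l, hj, hjl⟩ := hmeet t ht t₀ ht₀
    have hta : t i = a := (mem_filter.1 ht).2.1
    exact mem_biUnion.2 ⟨(j, l), mem_product.2 ⟨mem_erase.2 ⟨hj, mem_univ _⟩, mem_univ _⟩,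
      mem_filter.2 ⟨mem_univ _, hjl, hta⟩⟩
  refine (card_le_card hsub).trans ((card_biUnion_le_card_mul _ _ (Fintype.card V ^ (k - 1 - 2))
    fun p hp => ?_).trans (Nat.mul_le_mul_right _ ?_))
  · exact card_filter_apply_eq_apply_eq_le (mem_erase.1 (mem_product.1 hp).1).1 _ _
  · rw [card_product, card_univ, Fintype.card_fin]
    refine Nat.mul_le_mul ((card_le_card (erase_subset _ _)).trans ?_) (by omega)
    rw [card_univ, Fintype.card_fin]; omega

/-- The `k`-sets containing `v` that are not edges of `H`, with `v` removed. -/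
def missingLink (H : Finset (Finset V)) (k : ℕ) (v : V) : Finset (Finset V) :=
  (powersetCard (k - 1) (univ.erase v)).filter (fun A => insert v A ∉ H)

lemma mem_missingLink {H : Finset (Finset V)} {k : ℕ} {v : V} {A : Finset V} :
    A ∈ missingLink H k v ↔ (v ∉ A ∧ A.card = k - 1) ∧ insert v A ∉ H := by
  rw [missingLink, mem_filter, mem_powersetCard]
  simp only [subset_erase, subset_univ, true_and]

open Classical in
/-- Color a tuple by some vertex of `T` whose link contains the underlying set. -/
noncomputable def linkColor (H : Finset (Finset V)) (T : Finset V) (k : ℕ)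
    (t : Fin (k - 1) → V) : Option V :=
  if h : ∃ x ∈ T, univ.image t ∈ linkOutside H univ T k x then some h.choose else none

lemma linkColor_eq_some {H : Finset (Finset V)} {T : Finset V} {k : ℕ} {t : Fin (k - 1) → V}
    {x : V} (h : linkColor H T k t = some x) :
    x ∈ T ∧ univ.image t ∈ linkOutside H univ T k x := by
  unfold linkColor at h
  split_ifs at h with h'
  rw [Option.some.injEq] at h
  rw [← h]
  exact h'.choose_spec

lemma linkColor_eq_none {H : Finset (Finset V)} {T : Finset V} {k : ℕ} {t : Fin (k - 1) → V}
    (h : linkColor H T k t = none) :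
    univ.image t ∉ T.biUnion (linkOutside H univ T k) := by
  unfold linkColor at h
  split_ifs at h with h'
  intro hm
  obtain ⟨x, hx⟩ := mem_biUnion.1 hm
  exact h' ⟨x, hx⟩

lemma card_filter_apply_eq {K : ℕ} (i : Fin K) (b : V) :
    ((univ : Finset (Fin K → V)).filter (fun t => t i = b)).card ≤ Fintype.card V ^ (K - 1) := by
  have hsub : (univ : Finset (Fin K → V)).filter (fun t => t i = b) ⊆
      Fintype.piFinset (fun l => if l = i then {b} else univ) := by
    intro t ht
    simp only [mem_filter, mem_univ, true_and] at ht
    rw [Fintype.mem_piFinset]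
    intro l
    by_cases hl : l = i
    · subst hl; simp [ht]
    · simp [hl]
  refine (card_le_card hsub).trans ?_
  rw [Fintype.card_piFinset]
  have h1 : ∀ l, (if l = i then ({b} : Finset V) else univ).card =
      if l = i then 1 else Fintype.card V := by
    intro l; split_ifs <;> simp [card_univ]
  rw [prod_congr rfl (fun l _ => h1 l), prod_ite, prod_const_one, one_mul, prod_const,
    filter_ne', card_erase_of_mem (mem_univ i), card_univ, Fintype.card_fin]

/-- When the color changes, either one of the two tuples is uncolored, or the two colors `x ≠ y` and
the old and new values `a ≠ b` at `i` are specified, which leaves few tuples by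
`card_update_mem_linkOutside_le`. The last power of `n` counts the unused coordinates of the second
tuple. -/
lemma card_linkColor_update_ne_le {k : ℕ} (hk : 3 ≤ k) {H : Finset (Finset V)}
    {T : Finset V} (hs : (H : Set (Finset V)).Sized k) (hfree : ¬ HasRegularSubgraph 2 H)
    (i : Fin (k - 1)) :
    ((univ : Finset ((Fin (k - 1) → V) × (Fin (k - 1) → V))).filter (fun p =>
      linkColor H T k p.1 ≠ linkColor H T k (Function.update p.1 i (p.2 i)))).card ≤
    T.card * T.card * (Fintype.card V * Fintype.card V) *
        ((k * k) * Fintype.card V ^ (k - 1 - 2) * Fintype.card V ^ (k - 1 - 1)) +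
      2 * (Fintype.card V ^ (k - 1) *
        ((univ : Finset (Fin (k - 1) → V)).filter (fun t => linkColor H T k t = none)).card) := by
  set n := Fintype.card V with hn
  set Z := (univ : Finset (Fin (k - 1) → V)).filter (fun t => linkColor H T k t = none) with hZ
  set 𝒯 : (V × V) × (V × V) → Finset (Fin (k - 1) → V) := fun q =>
    (univ : Finset (Fin (k - 1) → V)).filter (fun t => t i = q.2.1 ∧
      univ.image t ∈ linkOutside H univ T k q.1.1 ∧
      univ.image (Function.update t i q.2.2) ∈ linkOutside H univ T k q.1.2 ∧ q.2.1 ≠ q.2.2)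
    with h𝒯
  have hsub : (univ : Finset ((Fin (k - 1) → V) × (Fin (k - 1) → V))).filter (fun p =>
      linkColor H T k p.1 ≠ linkColor H T k (Function.update p.1 i (p.2 i))) ⊆
      ((T.offDiag ×ˢ (univ : Finset (V × V))).biUnion
        (fun q => 𝒯 q ×ˢ univ.filter (fun t' => t' i = q.2.2))) ∪
      ((Z ×ˢ univ) ∪ univ.filter (fun p => linkColor H T k (Function.update p.1 i (p.2 i)) = none))
      := by
    rintro ⟨t, t'⟩ hp
    replace hp := (mem_filter.1 hp).2
    simp only at hp
    rcases h1 : linkColor H T k t with _ | x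
    · exact mem_union_right _ (mem_union_left _ (mem_product.2
        ⟨mem_filter.2 ⟨mem_univ _, h1⟩, mem_univ _⟩))
    rcases h2 : linkColor H T k (Function.update t i (t' i)) with _ | y
    · exact mem_union_right _ (mem_union_right _ (mem_filter.2 ⟨mem_univ _, h2⟩))
    have hxy : x ≠ y := fun h => hp (by rw [h1, h2, h])
    have hab : t i ≠ t' i := by
      intro h
      rw [← h, Function.update_eq_self] at hp
      exact hp rfl
    obtain ⟨hx, hxt⟩ := linkColor_eq_some h1
    obtain ⟨hy, hyt⟩ := linkColor_eq_some h2
    exact mem_union_left _ (mem_biUnion.2 ⟨((x, y), (t i, t' i)),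
      mem_product.2 ⟨mem_offDiag.2 ⟨hx, hy, hxy⟩, mem_univ _⟩,
      mem_product.2 ⟨mem_filter.2 ⟨mem_univ _, rfl, hxt, hyt, hab⟩,
        mem_filter.2 ⟨mem_univ _, rfl⟩⟩⟩)
  refine (card_le_card hsub).trans ((card_union_le _ _).trans (Nat.add_le_add ?_ ?_))
  · refine (card_biUnion_le_card_mul _ _ (k * k * n ^ (k - 1 - 2) * n ^ (k - 1 - 1))
      fun q hq => ?_).trans (Nat.mul_le_mul_right _ ?_)
    · have hq' := mem_offDiag.1 (mem_product.1 hq).1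
      rw [card_product]
      exact Nat.mul_le_mul (card_update_mem_linkOutside_le hk hs hfree hq'.1 hq'.2.1 hq'.2.2 i _ _)
        (card_filter_apply_eq i _)
    · rw [card_product, offDiag_card, card_univ, Fintype.card_prod]
      exact Nat.mul_le_mul_right _ (Nat.sub_le _ _)
  · have h1 := card_filter_update (V := V) (fun t => linkColor H T k t = none) i
    rw [Fintype.card_fin] at h1
    refine (card_union_le _ _).trans ?_
    rw [card_product, card_univ, Fintype.card_fun, Fintype.card_fin, two_mul, mul_comm]
    exact Nat.add_le_add le_rfl h1

/-! ### Stability -/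

set_option maxHeartbeats 1000000 in
/-- Stability: a large `k`-graph without `2`-regular subgraphs is close to a full star. -/
lemma exists_card_missingLink_le {k : ℕ} (hk : 3 ≤ k) {H : Finset (Finset V)}
    (hs : (H : Set (Finset V)).Sized k) (hfree : ¬ HasRegularSubgraph 2 H)
    (hcard : (Fintype.card V - 1).choose (k - 1) ≤ H.card) {r : ℕ} (hr : 1 ≤ r)
    (hrn : r ^ 12 ≤ Fintype.card V) (hnr : Fintype.card V < (r + 1) ^ 12) {c₁ c₂ c₃ : ℝ}
    (hc₁ : c₁ = 4097 + k * (k + 4))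
    (hc₂ : c₂ = k * k + (1 + c₁) * ((k - 1 : ℕ) : ℝ) ^ (k - 1))
    (hc₃ : c₃ = k * (k * k + 2 * c₂)) (hc₂r : 2 * c₂ ≤ r) :
    ∃ v, ((missingLink H k v).card : ℝ) ≤
      2 * c₃ * ((Fintype.card V : ℝ) ^ (k - 1) / r) := by
  set n := Fintype.card V with hn
  have hnu : (univ : Finset V).card = n := card_univ
  obtain ⟨T, -, hTc, hT⟩ := exists_card_le_biUnion_linkOutside hk hs (U := univ)
    (fun e _ => subset_univ e) hfree hr (by rwa [hnu]) (by rwa [hnu])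
  rw [hnu, ← hc₁] at hT
  set δ : ℝ := (n : ℝ) ^ (k - 1) / r with hδ
  have hr1 : (1 : ℝ) ≤ r := by exact_mod_cast hr
  have hrn' : (r : ℝ) ^ 12 ≤ n := by exact_mod_cast hrn
  have hn0 : (0 : ℝ) < n := lt_of_lt_of_le (by positivity) hrn'
  have hδ0 : 0 < δ := by positivity
  have hc₁0 : 0 ≤ c₁ := by rw [hc₁]; positivity
  have hc₂0 : 0 ≤ c₂ := by rw [hc₂]; positivity
  have hrn1 : (r : ℝ) ≤ n := (le_self_pow₀ hr1 (by norm_num)).trans hrn'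
  have hnpow : (n : ℝ) ^ (k - 1) = n ^ (k - 1 - 1) * n := by
    rw [← pow_succ]; congr 1; omega
  have hnδ : (n : ℝ) ^ (k - 1 - 1) ≤ δ := by
    rw [hδ, le_div_iff₀ (by linarith), hnpow]; gcongr
  -- uncolored sets
  set 𝒰 := T.biUnion (linkOutside H univ T k) with h𝒰
  set 𝒩 := powersetCard (k - 1) (univ : Finset V) \ 𝒰 with h𝒩
  have h𝒰sub : 𝒰 ⊆ powersetCard (k - 1) univ := by
    intro A hA
    obtain ⟨x, _, hx⟩ := mem_biUnion.1 hA
    exact mem_powersetCard.2 ⟨subset_univ _, (mem_linkOutside.1 hx).1.2⟩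
  -- The assumed lower bound on `|H|` enters here: colored sets nearly account for `H`, and by
  -- Pascal's rule `n.choose (k - 1)` exceeds `(n - 1).choose (k - 1)` only by lower-order terms.
  have h𝒩c : (𝒩.card : ℝ) ≤ (1 + c₁) * δ := by
    have h1 : 𝒩.card + 𝒰.card = n.choose (k - 1) := by
      rw [h𝒩, card_sdiff_add_card_eq_card h𝒰sub, card_powersetCard, hnu]
    have h2 : n.choose (k - 1) ≤ (n - 1).choose (k - 1) + n ^ (k - 1 - 1) := by
      have hnpos : 0 < n := by exact_mod_cast hn0
      obtain ⟨n', hn'⟩ : ∃ n', n = n' + 1 := ⟨n - 1, by omega⟩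
      obtain ⟨j, hj⟩ : ∃ j, k - 1 = j + 1 := ⟨k - 2, by omega⟩
      rw [hn', hj, Nat.choose_succ_succ, Nat.add_sub_cancel, Nat.add_sub_cancel, add_comm]
      refine Nat.add_le_add_left ((Nat.choose_le_pow _ _).trans ?_) _
      exact Nat.pow_le_pow_left (Nat.le_succ _) _
    have h3 : (𝒩.card : ℝ) + 𝒰.card ≤ H.card + (n : ℝ) ^ (k - 1 - 1) := by
      exact_mod_cast (h1.le.trans h2).trans (Nat.add_le_add_right hcard _)
    linarith
  -- uncolored tuples
  set Z := (univ : Finset (Fin (k - 1) → V)).filter (fun t => linkColor H T k t = none) with hZ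
  have hZc : (Z.card : ℝ) ≤ c₂ * δ := by
    have hsub : Z ⊆ univ.filter (fun t => ¬ Function.Injective t) ∪
        univ.filter (fun t => univ.image t ∈ 𝒩) := by
      intro t ht
      have ht' := (mem_filter.1 ht).2
      rw [mem_union]
      by_cases hi : Function.Injective t
      · refine Or.inr (mem_filter.2 ⟨mem_univ _, mem_sdiff.2 ⟨mem_powersetCard.2
          ⟨subset_univ _, ?_⟩, linkColor_eq_none ht'⟩⟩)
        rw [card_image_of_injective _ hi, card_univ, Fintype.card_fin]
      · exact Or.inl (mem_filter.2 ⟨mem_univ _, hi⟩)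
    have h1 : Z.card ≤ k * k * n ^ (k - 1 - 1) + 𝒩.card * (k - 1) ^ (k - 1) := by
      refine (card_le_card hsub).trans ((card_union_le _ _).trans (Nat.add_le_add ?_ ?_))
      · refine (card_not_injective_le (k - 1)).trans (Nat.mul_le_mul_right _ ?_)
        exact Nat.mul_le_mul (Nat.sub_le _ _) (Nat.sub_le _ _)
      · exact card_image_mem_le _ _ fun A hA => (mem_powersetCard.1 (mem_sdiff.1 hA).1).2
    calc (Z.card : ℝ) ≤ k * k * (n : ℝ) ^ (k - 1 - 1) + 𝒩.card * ((k - 1 : ℕ) : ℝ) ^ (k - 1) := by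
          exact_mod_cast h1
      _ ≤ k * k * δ + ((1 + c₁) * δ) * ((k - 1 : ℕ) : ℝ) ^ (k - 1) := by gcongr
      _ = c₂ * δ := by rw [hc₂]; ring
  -- pairs of differently colored tuples
  have hE : (((univ : Finset ((Fin (k - 1) → V) × (Fin (k - 1) → V))).filter
      (fun p => linkColor H T k p.1 ≠ linkColor H T k p.2)).card : ℝ) ≤
      c₃ * ((n : ℝ) ^ (k - 1) * δ) := by
    have h1 := (card_ne_le_sum_card_update_ne (linkColor H T k)).trans
      (sum_le_sum fun i _ => card_linkColor_update_ne_le (T := T) hk hs hfree i)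
    rw [sum_const, card_univ, Fintype.card_fin, smul_eq_mul] at h1
    have hTc' : (T.card : ℝ) ≤ r ^ 4 := by exact_mod_cast hTc
    have h2 : (T.card : ℝ) * T.card * ((n : ℝ) * n) *
        ((k * k) * (n : ℝ) ^ (k - 1 - 2) * (n : ℝ) ^ (k - 1 - 1)) ≤
        k * k * ((n : ℝ) ^ (k - 1) * δ) := by
      have hnpow2 : (n : ℝ) ^ (k - 1) = n ^ (k - 1 - 2) * (n * n) := by
        rw [← pow_two, ← pow_add]; congr 1; omega
      calc (T.card : ℝ) * T.card * ((n : ℝ) * n) *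
          ((k * k) * (n : ℝ) ^ (k - 1 - 2) * (n : ℝ) ^ (k - 1 - 1))
          ≤ r ^ 4 * r ^ 4 * ((n : ℝ) * n) *
          ((k * k) * (n : ℝ) ^ (k - 1 - 2) * (n : ℝ) ^ (k - 1 - 1)) := by gcongr
        _ = k * k * ((n : ℝ) ^ (k - 1) * (n ^ (k - 1 - 1) * r ^ 9 / r)) := by
          rw [hnpow2]; field_simp
        _ ≤ k * k * ((n : ℝ) ^ (k - 1) * (n ^ (k - 1 - 1) * n / r)) := by
          have : (r : ℝ) ^ 9 ≤ n := (pow_le_pow_right₀ hr1 (by norm_num)).trans hrn'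
          gcongr
        _ = _ := by rw [← hnpow]
    calc _ ≤ ((k - 1 : ℕ) : ℝ) * ((T.card : ℝ) * T.card * ((n : ℝ) * n) *
          ((k * k) * (n : ℝ) ^ (k - 1 - 2) * (n : ℝ) ^ (k - 1 - 1)) +
          2 * ((n : ℝ) ^ (k - 1) * Z.card)) := by exact_mod_cast h1
      _ ≤ k * (k * k * ((n : ℝ) ^ (k - 1) * δ) + 2 * ((n : ℝ) ^ (k - 1) * (c₂ * δ))) := by
        gcongr
        exact Nat.sub_le _ _
      _ = _ := by rw [hc₃]; ring
  set Y := (univ : Finset (Fin (k - 1) → V)).filter (fun t => linkColor H T k t ≠ none) with hY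
  have hYZ : (Z.card : ℝ) + Y.card = (n : ℝ) ^ (k - 1) := by
    have h1 := card_filter_add_card_filter_not (s := (univ : Finset (Fin (k - 1) → V)))
      (fun t => linkColor H T k t = none)
    rw [card_univ, Fintype.card_fun, Fintype.card_fin] at h1
    exact_mod_cast h1
  -- By `2 * c₂ ≤ r`, at least half of the tuples are colored.
  have hc₂δ : c₂ * δ ≤ (n : ℝ) ^ (k - 1) / 2 := by
    have hr0 : (0 : ℝ) < r := by linarith
    have : (n : ℝ) ^ (k - 1) = r * δ := by rw [hδ]; field_simp
    have h2 := mul_le_mul_of_nonneg_right hc₂r hδ0.le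
    rw [this]; linarith
  have hYc : (n : ℝ) ^ (k - 1) / 2 ≤ Y.card := by linarith
  have hnp : (0 : ℝ) < (n : ℝ) ^ (k - 1) := by positivity
  have hYne : Y.Nonempty := by
    rw [← card_pos]
    have : (0 : ℝ) < Y.card := by linarith
    exact_mod_cast this
  have hc₃0 : 0 ≤ c₃ := by rw [hc₃]; positivity
  -- By averaging, some colored tuple disagrees with few others; its color is the desired center.
  obtain ⟨u, huY, hu⟩ := exists_le_of_sum_le (s := Y)
    (f := fun u => (((univ : Finset (Fin (k - 1) → V)).filter
      (fun w => linkColor H T k u ≠ linkColor H T k w)).card : ℝ))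
    (g := fun _ => 2 * c₃ * δ) hYne (by
      rw [sum_const, nsmul_eq_mul]
      have h1 : (∑ u ∈ Y, ((univ : Finset (Fin (k - 1) → V)).filter
          (fun w => linkColor H T k u ≠ linkColor H T k w)).card) ≤
          ((univ : Finset ((Fin (k - 1) → V) × (Fin (k - 1) → V))).filter
            (fun p => linkColor H T k p.1 ≠ linkColor H T k p.2)).card := by
        rw [← card_sigma]
        refine card_le_card_of_injOn (fun p => (p.1, p.2)) ?_ ?_
        · rintro ⟨u, w⟩ hp
          have hp := (mem_filter.1 (mem_sigma.1 (mem_coe.1 hp)).2).2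
          exact mem_coe.2 (mem_filter.2 ⟨mem_univ _, hp⟩)
        · rintro ⟨u, w⟩ _ ⟨u', w'⟩ _ h
          simp only [Prod.mk.injEq] at h
          rw [h.1, h.2]
      calc _ ≤ c₃ * ((n : ℝ) ^ (k - 1) * δ) := le_trans (by exact_mod_cast h1) hE
        _ = (n : ℝ) ^ (k - 1) / 2 * (2 * c₃ * δ) := by ring
        _ ≤ _ := by gcongr)
  obtain ⟨v, hv⟩ := Option.ne_none_iff_exists'.1 (mem_filter.1 huY).2
  refine ⟨v, le_trans ?_ hu⟩
  -- An enumeration of a missing set cannot have color `v`, because color `v` certifies an edge.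
  have hsub : missingLink H k v ⊆ ((univ : Finset (Fin (k - 1) → V)).filter
      (fun w => linkColor H T k u ≠ linkColor H T k w)).image (fun t => univ.image t) := by
    intro A hA
    rw [mem_missingLink] at hA
    let e := A.equivFinOfCardEq hA.1.2
    have him : univ.image (fun i => (e.symm i : V)) = A := by
      ext z
      simp only [mem_image, mem_univ, true_and]
      constructor
      · rintro ⟨i, rfl⟩
        exact (e.symm i).2
      · intro hz
        exact ⟨e ⟨z, hz⟩, by simp⟩
    refine mem_image.2 ⟨fun i => (e.symm i : V), mem_filter.2 ⟨mem_univ _, fun h => ?_⟩, him⟩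
    rw [hv] at h
    have := (linkColor_eq_some h.symm).2
    rw [him] at this
    exact hA.2 (mem_linkOutside.1 this).2
  exact_mod_cast (card_le_card hsub).trans card_image_le

/-! ### Bad sets and the four-edge configuration -/

/-- The edges of `H` that avoid `v`. -/
def edgesAvoiding (H : Finset (Finset V)) (v : V) : Finset (Finset V) :=
  H.filter (fun e => v ∉ e)

/-- The number of members of `N` that contain `P`. -/
def codegree (N : Finset (Finset V)) (P : Finset V) : ℕ :=
  (N.filter (fun A => P ⊆ A)).card

/-- `P` lies in a positive proportion (at least `σ`) of missing sets of the link of `v`. -/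
def IsBad (H : Finset (Finset V)) (k : ℕ) (v : V) (σ : ℝ) (P : Finset V) : Prop :=
  σ * (Fintype.card V : ℝ) ^ (k - 1 - P.card) ≤ codegree (missingLink H k v) P

/-- The threshold above which a set counts as bad. -/
noncomputable def badThreshold (k : ℕ) : ℝ := 1 / (4 * 4 ^ k * k.factorial)

lemma badThreshold_pos (k : ℕ) : 0 < badThreshold k := by
  unfold badThreshold
  have := k.factorial_pos
  positivity

lemma IsBad.mono {H : Finset (Finset V)} {k : ℕ} {v : V} {σ τ : ℝ} {P : Finset V}
    (h : IsBad H k v τ P) (hστ : σ ≤ τ) : IsBad H k v σ P := by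
  unfold IsBad at h ⊢
  exact le_trans (by gcongr) h

/-- This explains the value of the threshold: the extensions spoiled by two sets that are not bad
cannot exhaust all `j`-subsets of the `m` available vertices, because `m.choose j ≥ (n / 4) ^ j /
j!`. -/
lemma two_mul_badThreshold_le {k j n m : ℕ} (hn : 4 * k ≤ n) (hj : j + 1 ≤ k) (hm : n ≤ m + 2 * k) :
    2 * (badThreshold k * (n : ℝ) ^ j) ≤ (m.choose j : ℕ) := by
  have h1 : ((m + 1 - j : ℕ) : ℝ) ^ j / j.factorial ≤ (m.choose j : ℕ) := Nat.pow_le_choose j m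
  refine le_trans ?_ h1
  have h2 : (n : ℝ) / 4 ≤ ((m + 1 - j : ℕ) : ℝ) := by
    rw [div_le_iff₀ (by norm_num)]
    have : n ≤ (m + 1 - j) * 4 := by omega
    exact_mod_cast this
  have hjf : (0 : ℝ) < j.factorial := by exact_mod_cast j.factorial_pos
  calc 2 * (badThreshold k * (n : ℝ) ^ j) = (n : ℝ) ^ j / (2 * 4 ^ k * k.factorial) := by
        unfold badThreshold; field_simp; norm_num
    _ ≤ (n : ℝ) ^ j / (4 ^ j * j.factorial) := by
        refine div_le_div_of_nonneg_left (by positivity) (by positivity) ?_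
        have h3 : (4 : ℝ) ^ j ≤ 4 ^ k := pow_le_pow_right₀ (by norm_num) (by omega)
        have h4 : (j.factorial : ℝ) ≤ k.factorial := by
          exact_mod_cast Nat.factorial_le (by omega)
        calc (4 : ℝ) ^ j * j.factorial ≤ 4 ^ k * k.factorial := by gcongr
          _ ≤ 2 * 4 ^ k * k.factorial := by
            have : (0 : ℝ) ≤ 4 ^ k * k.factorial := by positivity
            linarith
    _ = ((n : ℝ) / 4) ^ j / j.factorial := by rw [div_pow]; field_simp
    _ ≤ _ := by gcongr

lemma card_filter_union_mem_le (N : Finset (Finset V)) {j : ℕ} {P Z : Finset V} (hP : P ⊆ Z) :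
    ((powersetCard j (univ \ Z)).filter (fun J => P ∪ J ∈ N)).card ≤ codegree N P := by
  have hd : ∀ J ∈ (powersetCard j (univ \ Z)).filter (fun J => P ∪ J ∈ N), Disjoint J P := by
    intro J hJ
    have h1 := (mem_powersetCard.1 (mem_filter.1 hJ).1).1
    exact Finset.disjoint_left.2 fun x hx hxP => (mem_sdiff.1 (h1 hx)).2 (hP hxP)
  refine card_le_card_of_injOn (fun J => P ∪ J) ?_ ?_
  · intro J hJ
    exact mem_coe.2 (mem_filter.2 ⟨(mem_filter.1 (mem_coe.1 hJ)).2, subset_union_left⟩)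
  · intro J hJ J' hJ' h
    simp only at h
    rw [← (hd J hJ).sdiff_eq_left, ← (hd J' hJ').sdiff_eq_left, ← union_sdiff_left P J, h,
      union_sdiff_left]

/-- Two sets of equal size that are not bad have a common extension into the link of `v`. -/
lemma exists_common_extension {H : Finset (Finset V)} {k : ℕ} {v : V}
    (hn : 4 * k ≤ Fintype.card V) {P Q Z : Finset V} (hPZ : P ⊆ Z) (hQZ : Q ⊆ Z)
    (hvZ : v ∈ Z) (hZ : Z.card ≤ 2 * k) (hvP : v ∉ P) (hvQ : v ∉ Q) (hPQ : P.card = Q.card)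
    (hP1 : 1 ≤ P.card) (hPk : P.card ≤ k - 1)
    (hP : ¬ IsBad H k v (badThreshold k) P) (hQ : ¬ IsBad H k v (badThreshold k) Q) :
    ∃ J, J.card = k - 1 - P.card ∧ Disjoint J Z ∧ insert v (P ∪ J) ∈ H ∧
      insert v (Q ∪ J) ∈ H := by
  set N := missingLink H k v with hN
  set 𝒥 := powersetCard (k - 1 - P.card) (univ \ Z) with h𝒥
  have h𝒥c : 2 * (badThreshold k * (Fintype.card V : ℝ) ^ (k - 1 - P.card)) ≤ (𝒥.card : ℕ) := by
    rw [h𝒥, card_powersetCard]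
    refine two_mul_badThreshold_le hn (by omega) ?_
    rw [card_sdiff_of_subset (subset_univ _), card_univ]
    omega
  unfold IsBad at hP hQ
  rw [not_le] at hP hQ
  rw [← hPQ] at hQ
  have h1 := card_filter_union_mem_le N (j := k - 1 - P.card) hPZ
  have h2 := card_filter_union_mem_le N (j := k - 1 - P.card) hQZ
  have hlt : (𝒥.filter (fun J => P ∪ J ∈ N)).card + (𝒥.filter (fun J => Q ∪ J ∈ N)).card
      < 𝒥.card := by
    have h1' : ((𝒥.filter (fun J => P ∪ J ∈ N)).card : ℝ) ≤ codegree N P := by exact_mod_cast h1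
    have h2' : ((𝒥.filter (fun J => Q ∪ J ∈ N)).card : ℝ) ≤ codegree N Q := by exact_mod_cast h2
    have : ((𝒥.filter (fun J => P ∪ J ∈ N)).card : ℝ) + (𝒥.filter (fun J => Q ∪ J ∈ N)).card
        < 𝒥.card := by linarith
    exact_mod_cast this
  obtain ⟨J, hJ, hJn⟩ : ∃ J ∈ 𝒥, J ∉ 𝒥.filter (fun J => P ∪ J ∈ N) ∪
      𝒥.filter (fun J => Q ∪ J ∈ N) := by
    by_contra hcon
    push Not at hcon
    have := card_le_card (show 𝒥 ⊆ _ from hcon)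
    have := card_union_le (𝒥.filter (fun J => P ∪ J ∈ N)) (𝒥.filter (fun J => Q ∪ J ∈ N))
    omega
  rw [mem_union, mem_filter, mem_filter] at hJn
  push Not at hJn
  obtain ⟨hJZ, hJc⟩ := mem_powersetCard.1 hJ
  have hdJ : Disjoint J Z := Finset.disjoint_left.2 fun x hx => (mem_sdiff.1 (hJZ hx)).2
  have hvJ : v ∉ J := fun h => Finset.disjoint_left.1 hdJ h hvZ
  have key : ∀ Q : Finset V, Q ⊆ Z → v ∉ Q → Q.card = P.card → Q ∪ J ∉ N →
      insert v (Q ∪ J) ∈ H := by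
    intro Q hQZ hvQ hQc hQJ
    by_contra hcon
    refine hQJ (mem_missingLink.2 ⟨⟨by simp [hvQ, hvJ], ?_⟩, hcon⟩)
    rw [card_union_of_disjoint (Finset.disjoint_of_subset_left hQZ hdJ.symm), hJc, hQc]
    omega
  exact ⟨J, hJc, hdJ, key P hPZ hvP rfl (hJn.1 hJ), key Q hQZ hvQ hPQ.symm (hJn.2 hJ)⟩

lemma degree_four {a b c d : Finset V} (hab : a ≠ b) (hac : a ≠ c) (had : a ≠ d) (hbc : b ≠ c)
    (hbd : b ≠ d) (hcd : c ≠ d) (x : V) :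
    degree {a, b, c, d} x = (if x ∈ a then 1 else 0) + ((if x ∈ b then 1 else 0) +
      ((if x ∈ c then 1 else 0) + if x ∈ d then 1 else 0)) := by
  rw [degree, card_filter, sum_insert (by simp [hab, hac, had]), sum_insert (by simp [hbc, hbd]),
    sum_insert (by simp [hcd]), sum_singleton]

/-- If two edges avoiding `v` meet, then any balanced partition of their symmetric difference has
a bad part. -/
lemma isBad_or_isBad {H : Finset (Finset V)} {k : ℕ} {v : V}
    (hs : (H : Set (Finset V)).Sized k) (hfree : ¬ HasRegularSubgraph 2 H)
    (hn : 4 * k ≤ Fintype.card V) {B₁ B₂ R S : Finset V} (hB₁ : B₁ ∈ edgesAvoiding H v)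
    (hB₂ : B₂ ∈ edgesAvoiding H v) (hne : B₁ ≠ B₂) (hmeet : ¬ Disjoint B₁ B₂)
    (hRS : ∀ x, (x ∈ R ∨ x ∈ S) ↔ ((x ∈ B₁ ∧ x ∉ B₂) ∨ (x ∈ B₂ ∧ x ∉ B₁)))
    (hd : Disjoint R S) (hc : R.card = S.card) :
    IsBad H k v (badThreshold k) R ∨ IsBad H k v (badThreshold k) S := by
  by_contra hcon
  push Not at hcon
  rw [edgesAvoiding, mem_filter] at hB₁ hB₂
  have hk1 := hs hB₁.1
  have hk2 := hs hB₂.1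
  have hun : R ∪ S = (B₁ \ B₂) ∪ (B₂ \ B₁) := by
    ext x; simpa only [mem_union, mem_sdiff] using hRS x
  have hc1 := card_union_of_disjoint hd
  rw [hun, card_union_of_disjoint disjoint_sdiff_sdiff] at hc1
  have hi1 := card_sdiff_add_card_inter B₁ B₂
  have hi2 := card_sdiff_add_card_inter B₂ B₁
  rw [inter_comm] at hi2
  have hpos : 0 < (B₁ ∩ B₂).card := by
    rw [card_pos, ← not_disjoint_iff_nonempty_inter]; exact hmeet
  have hltk : (B₁ ∩ B₂).card < k := by
    rw [← hk1]
    refine card_lt_card ⟨inter_subset_left, fun h => hne ?_⟩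
    exact eq_of_subset_of_card_le (h.trans inter_subset_right) (by omega)
  have hui := card_union_add_card_inter B₁ B₂
  -- As the edges are distinct and meet, this size is between 1 and `k - 1`, as the common extension
  -- requires.
  have hRc : R.card = k - (B₁ ∩ B₂).card := by omega
  have hRsub : R ⊆ B₁ ∪ B₂ := by
    intro x hx
    have := (hRS x).1 (Or.inl hx)
    rw [mem_union]; tauto
  have hSsub : S ⊆ B₁ ∪ B₂ := by
    intro x hx
    have := (hRS x).1 (Or.inr hx)
    rw [mem_union]; tauto
  have hvB : v ∉ B₁ ∪ B₂ := by simp [hB₁.2, hB₂.2]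
  obtain ⟨J, hJc, hJd, hJ1, hJ2⟩ := exists_common_extension (H := H) (k := k) (v := v) hn
    (P := R) (Q := S) (Z := insert v (B₁ ∪ B₂)) (hRsub.trans (subset_insert _ _))
    (hSsub.trans (subset_insert _ _)) (mem_insert_self _ _)
    (by rw [card_insert_of_notMem hvB]; omega) (fun h => hvB (hRsub h)) (fun h => hvB (hSsub h))
    hc (by omega) (by omega) hcon.1 hcon.2
  have hRne : R.Nonempty := card_pos.1 (by omega)
  obtain ⟨x₀, hx₀⟩ := hRne
  have hx₀S : x₀ ∉ S := Finset.disjoint_left.1 hd hx₀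
  have hx₀Z : x₀ ∈ insert v (B₁ ∪ B₂) := mem_insert_of_mem (hRsub hx₀)
  have hx₀v : x₀ ≠ v := fun h => hvB (h ▸ hRsub hx₀)
  have hA : insert v (R ∪ J) ≠ insert v (S ∪ J) := by
    intro h
    have h1 : x₀ ∈ insert v (S ∪ J) := h ▸ (by simp [hx₀])
    rw [mem_insert, mem_union] at h1
    rcases h1 with h1 | h1 | h1
    · exact hx₀v h1
    · exact hx₀S h1
    · exact Finset.disjoint_left.1 hJd h1 hx₀Z
  have hBA : ∀ {B A : Finset V}, v ∉ B → B ≠ insert v A := by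
    intro B A h hBA
    exact h (hBA ▸ mem_insert_self v A)
  -- In this configuration a vertex of `B₁ ∩ B₂` lies in both old edges only, `v` and the vertices
  -- of `J` in both new edges only, and a vertex of the symmetric difference in one old and one new
  -- edge.
  refine hfree (hasRegularSubgraph_of_forall_mem
    (F := {B₁, B₂, insert v (R ∪ J), insert v (S ∪ J)}) ?_ ⟨B₁, by simp, ?_⟩ ?_)
  · simp [insert_subset_iff, hB₁.1, hB₂.1, hJ1, hJ2]
  · exact (not_disjoint_iff_nonempty_inter.1 hmeet).mono inter_subset_left
  · intro e he x hx
    rw [degree_four hne (hBA hB₁.2) (hBA hB₁.2) (hBA hB₂.2) (hBA hB₂.2) hA]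
    have hxall : x ∈ B₁ ∨ x ∈ B₂ ∨ (x = v ∨ x ∈ R ∨ x ∈ J) ∨ (x = v ∨ x ∈ S ∨ x ∈ J) := by
      simp only [mem_insert, mem_singleton] at he
      rcases he with rfl | rfl | rfl | rfl
      · exact Or.inl hx
      · exact Or.inr (Or.inl hx)
      · simp only [mem_insert, mem_union] at hx; exact Or.inr (Or.inr (Or.inl hx))
      · simp only [mem_insert, mem_union] at hx; exact Or.inr (Or.inr (Or.inr hx))
    have hJx : x ∈ J → x ≠ v ∧ x ∉ B₁ ∧ x ∉ B₂ := by
      intro h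
      have := Finset.disjoint_left.1 hJd h
      simpa [not_or] using this
    have hdx : x ∈ R → x ∉ S := fun h => Finset.disjoint_left.1 hd h
    have hRSx := hRS x
    have hv1 : x = v → x ∉ B₁ := fun h => h ▸ hB₁.2
    have hv2 : x = v → x ∉ B₂ := fun h => h ▸ hB₂.2
    simp only [mem_insert, mem_union]
    by_cases p1 : x = v
    · have q1 := hv1 p1
      have q2 := hv2 p1
      rw [if_neg q1, if_neg q2, if_pos (Or.inl p1), if_pos (Or.inl p1)]
    by_cases p2 : x ∈ J
    · obtain ⟨-, q1, q2⟩ := hJx p2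
      simp [p2, q1, q2]
    by_cases p3 : x ∈ B₁ <;> by_cases p4 : x ∈ B₂ <;> by_cases p5 : x ∈ R <;>
      by_cases p6 : x ∈ S <;> simp_all

/-! ### Extensions by vertices that are not bad -/

open Classical in
/-- The bad sets of size `s`. -/
noncomputable def badSets (H : Finset (Finset V)) (k : ℕ) (v : V) (σ : ℝ) (s : ℕ) :
    Finset (Finset V) :=
  (powersetCard s univ).filter (fun P => IsBad H k v σ P)

lemma mem_badSets {H : Finset (Finset V)} {k : ℕ} {v : V} {σ : ℝ} {s : ℕ} {P : Finset V} :
    P ∈ badSets H k v σ s ↔ P.card = s ∧ IsBad H k v σ P := by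
  simp [badSets, mem_powersetCard]

open Classical in
/-- The edges avoiding `v` that contain `P` and have no bad vertex outside `P`. -/
noncomputable def goodExtensions (H : Finset (Finset V)) (k : ℕ) (v : V) (σ : ℝ) (P : Finset V) :
    Finset (Finset V) :=
  (edgesAvoiding H v).filter (fun B => P ⊆ B ∧ ∀ a ∈ B \ P, ¬ IsBad H k v σ {a})

lemma mem_goodExtensions {H : Finset (Finset V)} {k : ℕ} {v : V} {σ : ℝ} {P B : Finset V} :
    B ∈ goodExtensions H k v σ P ↔
      B ∈ edgesAvoiding H v ∧ P ⊆ B ∧ ∀ a ∈ B \ P, ¬ IsBad H k v σ {a} := by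
  simp [goodExtensions]

lemma card_of_mem_edgesAvoiding {H : Finset (Finset V)} {k : ℕ} {v : V}
    (hs : (H : Set (Finset V)).Sized k) {B : Finset V} (hB : B ∈ edgesAvoiding H v) :
    B.card = k :=
  hs (mem_filter.1 hB).1

/-- Double counting of pairs `E ⊆ A` with `E` bad and `A` missing: each `E` lies in many `A`, while
each `A` has at most `2 ^ k` subsets. -/
lemma card_badSets_filter_mul_le (H : Finset (Finset V)) {k : ℕ} {v : V} {σ : ℝ} (s : ℕ)
    (P : Finset V) :
    (((badSets H k v σ s).filter (fun E => P ⊆ E)).card : ℝ) *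
      (σ * (Fintype.card V : ℝ) ^ (k - 1 - s)) ≤ 2 ^ k * codegree (missingLink H k v) P := by
  set 𝓑 := (badSets H k v σ s).filter (fun E => P ⊆ E) with h𝓑
  set N := missingLink H k v with hN
  have h1 : (∑ E ∈ 𝓑, codegree N E) ≤ 2 ^ k * codegree N P := by
    have hdc := sum_card_bipartiteAbove_eq_sum_card_bipartiteBelow (s := 𝓑) (t := N)
      (fun E A => E ⊆ A)
    simp only [bipartiteAbove, bipartiteBelow] at hdc
    calc (∑ E ∈ 𝓑, codegree N E) = ∑ A ∈ N, (𝓑.filter (fun E => E ⊆ A)).card := by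
          simp only [codegree]; exact hdc
      _ ≤ ∑ A ∈ N, if P ⊆ A then 2 ^ k else 0 := by
          refine sum_le_sum fun A hA => ?_
          split_ifs with hPA
          · calc _ ≤ A.powerset.card := card_le_card fun E hE => mem_powerset.2 (mem_filter.1 hE).2
              _ = 2 ^ (k - 1) := by rw [card_powerset, (mem_missingLink.1 hA).1.2]
              _ ≤ 2 ^ k := Nat.pow_le_pow_right (by norm_num) (Nat.sub_le _ _)
          · rw [Nat.le_zero, card_eq_zero, filter_eq_empty_iff]
            exact fun E hE hEA => hPA ((mem_filter.1 hE).2.trans hEA)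
      _ = 2 ^ k * codegree N P := by
          rw [← sum_filter, sum_const, smul_eq_mul, mul_comm, codegree]
  calc (𝓑.card : ℝ) * (σ * (Fintype.card V : ℝ) ^ (k - 1 - s))
      = ∑ _E ∈ 𝓑, σ * (Fintype.card V : ℝ) ^ (k - 1 - s) := by rw [sum_const, nsmul_eq_mul]
    _ ≤ ∑ E ∈ 𝓑, (codegree N E : ℝ) := by
        refine sum_le_sum fun E hE => ?_
        obtain ⟨hEc, hE⟩ := mem_badSets.1 (mem_filter.1 hE).1
        rw [← hEc]; exact hE
    _ ≤ _ := by exact_mod_cast h1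

/-- A nonempty set has few extensions to edges avoiding `v` by vertices that are not bad. -/
lemma card_goodExtensions_le {H : Finset (Finset V)} {k : ℕ} {v : V}
    (hs : (H : Set (Finset V)).Sized k) (hfree : ¬ HasRegularSubgraph 2 H)
    (hn : 4 * k ≤ Fintype.card V) {σ : ℝ} (hσ : σ ≤ badThreshold k) {P : Finset V}
    (hP : P.Nonempty) (hPk : P.card < k) :
    (goodExtensions H k v σ P).card ≤ Fintype.card V ^ (k - P.card - 1) := by
  have hex : ∀ B ∈ goodExtensions H k v σ P, ∃ a, a ∈ B \ P := by
    intro B hB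
    obtain ⟨hB, hPB, -⟩ := mem_goodExtensions.1 hB
    refine card_pos.1 ?_
    rw [card_sdiff_of_subset hPB, card_of_mem_edgesAvoiding hs hB]
    omega
  classical
  -- Deleting one chosen vertex outside `P` is injective: two extensions with the same image would
  -- differ by an exchange of `a` for `a'`, and then `{a}` or `{a'}` would be bad.
  let f : Finset V → Finset V := fun B =>
    if h : ∃ a, a ∈ B \ P then (B \ P).erase h.choose else ∅
  have hf : ∀ B ∈ goodExtensions H k v σ P, ∃ a ∈ B \ P, f B = (B \ P).erase a := by
    intro B hB
    have h := hex B hB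
    exact ⟨h.choose, h.choose_spec, dif_pos h⟩
  calc _ ≤ (powersetCard (k - P.card - 1) (univ : Finset V)).card := by
        refine card_le_card_of_injOn f ?_ ?_
        · intro B hB
          obtain ⟨a, ha, hfa⟩ := hf B (mem_coe.1 hB)
          obtain ⟨hB, hPB, -⟩ := mem_goodExtensions.1 (mem_coe.1 hB)
          refine mem_coe.2 (mem_powersetCard.2 ⟨subset_univ _, ?_⟩)
          rw [hfa, card_erase_of_mem ha, card_sdiff_of_subset hPB,
            card_of_mem_edgesAvoiding hs hB]
        · intro B hB B' hB' hff
          obtain ⟨a, ha, hfa⟩ := hf B (mem_coe.1 hB)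
          obtain ⟨a', ha', hfa'⟩ := hf B' (mem_coe.1 hB')
          obtain ⟨hB, hPB, hg⟩ := mem_goodExtensions.1 (mem_coe.1 hB)
          obtain ⟨hB', hPB', hg'⟩ := mem_goodExtensions.1 (mem_coe.1 hB')
          rw [hfa, hfa'] at hff
          by_contra hne
          have hmem : ∀ x, (x ∈ B ∧ x ∉ P ∧ x ≠ a) ↔ (x ∈ B' ∧ x ∉ P ∧ x ≠ a') := by
            intro x
            have := congrArg (fun s => x ∈ s) hff
            simp only [mem_erase, mem_sdiff, eq_iff_iff] at this
            tauto
          have haa : a ≠ a' := by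
            intro h
            subst h
            refine hne ?_
            rw [mem_sdiff] at ha ha'
            ext x
            by_cases hxa : x = a
            · rw [hxa]; exact iff_of_true ha.1 ha'.1
            by_cases hxP : x ∈ P
            · exact iff_of_true (hPB hxP) (hPB' hxP)
            exact ⟨fun h => ((hmem x).1 ⟨h, hxP, hxa⟩).1, fun h => ((hmem x).2 ⟨h, hxP, hxa⟩).1⟩
          have haB' : a ∉ B' := by
            intro h
            rw [mem_sdiff] at ha
            exact ((hmem a).2 ⟨h, ha.2, haa⟩).2.2 rfl
          have haB : a' ∉ B := by
            intro h
            rw [mem_sdiff] at ha'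
            exact ((hmem a').1 ⟨h, ha'.2, haa.symm⟩).2.2 rfl
          have hor := isBad_or_isBad hs hfree hn hB hB' hne (R := {a}) (S := {a'})
            (by
              obtain ⟨z, hz⟩ := hP
              exact Finset.not_disjoint_iff.2 ⟨z, hPB hz, hPB' hz⟩)
            (by
              intro x
              rw [mem_singleton, mem_singleton]
              rw [mem_sdiff] at ha ha'
              constructor
              · rintro (rfl | rfl)
                · exact Or.inl ⟨ha.1, haB'⟩
                · exact Or.inr ⟨ha'.1, haB⟩
              · rintro (⟨p, q⟩ | ⟨p, q⟩)
                · left; by_contra hxa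
                  exact q ((hmem x).1 ⟨p, fun hx => q (hPB' hx), hxa⟩).1
                · right; by_contra hxa
                  exact q ((hmem x).2 ⟨p, fun hx => q (hPB hx), hxa⟩).1)
            (by simpa using haa) (by simp)
          rcases hor with h | h
          · exact hg a ha (h.mono hσ)
          · exact hg' a' ha' (h.mono hσ)
    _ ≤ _ := by rw [card_powersetCard, card_univ]; exact Nat.choose_le_pow _ _

/-- Exchanging single vertices between two extensions of `P` bounds the number of extensions. -/
lemma card_goodExtensions_le_of_card_badSets_le {H : Finset (Finset V)} {k : ℕ} {v : V}
    (hs : (H : Set (Finset V)).Sized k) (hfree : ¬ HasRegularSubgraph 2 H)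
    (hn : 4 * k ≤ Fintype.card V) {σ : ℝ} (hσ : σ ≤ badThreshold k) {P : Finset V}
    (hP : P.Nonempty) (hPk : P.card + 2 ≤ k) {M : ℕ}
    (hM : ∀ a, ¬ IsBad H k v σ {a} →
      ((badSets H k v (badThreshold k) (k - P.card)).filter (fun E => {a} ⊆ E)).card ≤ M) :
    (goodExtensions H k v σ P).card ≤
      (k - P.card) * Fintype.card V ^ (k - P.card - 2) + 2 * ((k - P.card) * M) := by
  classical
  set 𝓖 := goodExtensions H k v σ P with h𝓖
  set s := k - P.card with hs'
  -- A vertex of `B` and all but one of the vertices of `B' \ P` form a bad set; the relation is not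
  -- symmetric.
  let D : Finset V → Finset V → Prop := fun B B' =>
    ∃ a ∈ B \ P, ∃ E, a ∈ E ∧ E.erase a ⊆ B' \ P ∧ E ∈ badSets H k v (badThreshold k) s
  have hGc : ∀ B ∈ 𝓖, (B \ P).card = s := by
    intro B hB
    obtain ⟨hB, hPB, -⟩ := mem_goodExtensions.1 hB
    rw [card_sdiff_of_subset hPB, card_of_mem_edgesAvoiding hs hB]
  have hmeetc : ∀ B ∈ 𝓖, (𝓖.filter (fun B' => ¬ Disjoint (B \ P) (B' \ P))).card ≤
      s * Fintype.card V ^ (s - 2) := by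
    intro B hB
    have hsub : 𝓖.filter (fun B' => ¬ Disjoint (B \ P) (B' \ P)) ⊆
        (B \ P).biUnion (fun a => goodExtensions H k v σ (insert a P) ) := by
      intro B' hB'
      rw [mem_filter, Finset.not_disjoint_iff] at hB'
      obtain ⟨hB', a, ha, ha'⟩ := hB'
      obtain ⟨hB'1, hB'2, hB'3⟩ := mem_goodExtensions.1 hB'
      refine mem_biUnion.2 ⟨a, ha, mem_goodExtensions.2 ⟨hB'1,
        insert_subset (mem_sdiff.1 ha').1 hB'2, fun b hb => hB'3 b ?_⟩⟩
      rw [mem_sdiff, mem_insert, not_or] at hb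
      exact mem_sdiff.2 ⟨hb.1, hb.2.2⟩
    refine (card_le_card hsub).trans ((card_biUnion_le_card_mul _ _ (Fintype.card V ^ (s - 2))
      fun a ha => ?_).trans (by rw [hGc B hB]))
    have haP : a ∉ P := (mem_sdiff.1 ha).2
    have h1 := card_goodExtensions_le hs hfree hn hσ (v := v) (P := insert a P)
      (insert_nonempty _ _) (by rw [card_insert_of_notMem haP]; omega)
    rw [card_insert_of_notMem haP] at h1
    have : k - (P.card + 1) - 1 = s - 2 := by omega
    rwa [this] at h1
  have hDc : ∀ B ∈ 𝓖, (𝓖.filter (fun B' => D B B')).card ≤ s * M := by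
    intro B hB
    have hsub : 𝓖.filter (fun B' => D B B') ⊆ (B \ P).biUnion (fun a =>
        ((badSets H k v (badThreshold k) s).filter (fun E => {a} ⊆ E)).biUnion (fun E =>
          𝓖.filter (fun B' => E.erase a ⊆ B' \ P))) := by
      intro B' hB'
      obtain ⟨hB', a, ha, E, haE, hEB, hE⟩ := mem_filter.1 hB'
      exact mem_biUnion.2 ⟨a, ha, mem_biUnion.2 ⟨E, mem_filter.2 ⟨hE, by simpa using haE⟩,
        mem_filter.2 ⟨hB', hEB⟩⟩⟩
    refine (card_le_card hsub).trans ((card_biUnion_le_card_mul _ _ M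
      fun a ha => ?_).trans (by rw [hGc B hB]))
    refine (card_biUnion_le_card_mul _ _ 1 fun E hE => ?_).trans ?_
    · rcases (𝓖.filter (fun B' => E.erase a ⊆ B' \ P)).eq_empty_or_nonempty with h | ⟨B₀, hB₀⟩
      · rw [h]; simp
      rw [mem_filter] at hE
      have haE : a ∈ E := by simpa using hE.2
      have hEc := (mem_badSets.1 hE.1).1
      have hEP := (mem_filter.1 hB₀).2
      have hdisj : Disjoint P (E.erase a) :=
        Finset.disjoint_right.2 fun x hx => (mem_sdiff.1 (hEP hx)).2
      have hc : (P ∪ E.erase a).card = k - 1 := by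
        rw [card_union_of_disjoint hdisj, card_erase_of_mem haE, hEc]; omega
      -- Here `k - 1` vertices are prescribed, so the bound is `n ^ 0 = 1`: `E` and `a` determine
      -- `B'`.
      have h1 := card_goodExtensions_le hs hfree hn hσ (v := v) (P := P ∪ E.erase a)
        (hP.mono subset_union_left) (by omega)
      have : k - (k - 1) - 1 = 0 := by omega
      rw [hc, this, pow_zero] at h1
      refine le_trans (card_le_card ?_) h1
      intro B' hB'
      obtain ⟨hB', hEB⟩ := mem_filter.1 hB'
      obtain ⟨hB'1, hB'2, hB'3⟩ := mem_goodExtensions.1 hB'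
      refine mem_goodExtensions.2 ⟨hB'1, union_subset hB'2 (hEB.trans sdiff_subset),
        fun b hb => hB'3 b ?_⟩
      rw [mem_sdiff, mem_union, not_or] at hb
      exact mem_sdiff.2 ⟨hb.1, hb.2.1⟩
    · rw [mul_one]
      exact hM a ((mem_goodExtensions.1 hB).2.2 a ha)
  -- If `B` and `B'` are disjoint outside `P`, exchanging `a` for `c` yields a balanced partition of
  -- the symmetric difference, whose bad part witnesses `D` in one direction.
  have hcover : ∀ B ∈ 𝓖, 𝓖 ⊆ 𝓖.filter (fun B' => ¬ Disjoint (B \ P) (B' \ P)) ∪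
      (𝓖.filter (fun B' => D B B') ∪ 𝓖.filter (fun B' => D B' B)) := by
    intro B hB B' hB'
    by_cases hd : Disjoint (B \ P) (B' \ P)
    swap
    · exact mem_union_left _ (mem_filter.2 ⟨hB', hd⟩)
    refine mem_union_right _ ?_
    obtain ⟨hB1, hB2, hB3⟩ := mem_goodExtensions.1 hB
    obtain ⟨hB'1, hB'2, hB'3⟩ := mem_goodExtensions.1 hB'
    have hBc := hGc B hB
    have hBc' := hGc B' hB'
    obtain ⟨a, ha⟩ : (B \ P).Nonempty := card_pos.1 (by omega)
    obtain ⟨c, hc⟩ : (B' \ P).Nonempty := card_pos.1 (by omega)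
    have haB' : a ∉ B' \ P := Finset.disjoint_left.1 hd ha
    have hcB : c ∉ B \ P := Finset.disjoint_right.1 hd hc
    have hne : B ≠ B' := by
      rintro rfl
      exact haB' ha
    have hd' : ∀ x, x ∈ B \ P → x ∉ B' \ P := fun x hx => Finset.disjoint_left.1 hd hx
    have hac : a ≠ c := fun h => haB' (h ▸ hc)
    have hRc : (insert a ((B' \ P).erase c)).card = s := by
      rw [card_insert_of_notMem (fun h => haB' (mem_of_mem_erase h)), card_erase_of_mem hc]; omega
    have hSc : (insert c ((B \ P).erase a)).card = s := by
      rw [card_insert_of_notMem (fun h => hcB (mem_of_mem_erase h)), card_erase_of_mem ha]; omega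
    have hor := isBad_or_isBad hs hfree hn hB1 hB'1 hne (R := insert a ((B' \ P).erase c))
      (S := insert c ((B \ P).erase a))
      (by
        obtain ⟨z, hz⟩ := hP
        exact Finset.not_disjoint_iff.2 ⟨z, hB2 hz, hB'2 hz⟩)
      (by
        intro x
        simp only [mem_insert, mem_erase, mem_sdiff] at ha hc haB' hcB hd' ⊢
        constructor
        · rintro ((rfl | ⟨-, p, q⟩) | (rfl | ⟨-, p, q⟩))
          · exact Or.inl ⟨ha.1, fun h => haB' ⟨h, ha.2⟩⟩
          · exact Or.inr ⟨p, fun h => hd' x ⟨h, q⟩ ⟨p, q⟩⟩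
          · exact Or.inr ⟨hc.1, fun h => hcB ⟨h, hc.2⟩⟩
          · exact Or.inl ⟨p, fun h => hd' x ⟨p, q⟩ ⟨h, q⟩⟩
        · rintro (⟨p, q⟩ | ⟨p, q⟩)
          · by_cases hxa : x = a
            · exact Or.inl (Or.inl hxa)
            · exact Or.inr (Or.inr ⟨hxa, p, fun h => q (hB'2 h)⟩)
          · by_cases hxc : x = c
            · exact Or.inr (Or.inl hxc)
            · exact Or.inl (Or.inr ⟨hxc, p, fun h => q (hB2 h)⟩))
      (by
        rw [disjoint_insert_left, disjoint_insert_right, mem_insert, not_or]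
        refine ⟨⟨hac, by simp⟩, by simp, ?_⟩
        exact Finset.disjoint_of_subset_left (erase_subset _ _)
          (Finset.disjoint_of_subset_right (erase_subset _ _) hd.symm))
      (by rw [hRc, hSc])
    rw [mem_union]
    rcases hor with h | h
    · refine Or.inl (mem_filter.2 ⟨hB', a, ha, _, mem_insert_self _ _, ?_,
        mem_badSets.2 ⟨hRc, h⟩⟩)
      rw [erase_insert (fun h => haB' (mem_of_mem_erase h))]
      exact erase_subset _ _
    · refine Or.inr (mem_filter.2 ⟨hB', c, hc, _, mem_insert_self _ _, ?_,
        mem_badSets.2 ⟨hSc, h⟩⟩)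
      rw [erase_insert (fun h => hcB (mem_of_mem_erase h))]
      exact erase_subset _ _
  -- All ordered pairs are counted; both directions of `D` have the same total, so bounding one
  -- suffices.
  have hsum : 𝓖.card * 𝓖.card ≤
      𝓖.card * (s * Fintype.card V ^ (s - 2) + 2 * (s * M)) := by
    have hsymm : ∑ B ∈ 𝓖, (𝓖.filter (fun B' => D B' B)).card =
        ∑ B ∈ 𝓖, (𝓖.filter (fun B' => D B B')).card :=
      (sum_card_bipartiteAbove_eq_sum_card_bipartiteBelow (s := 𝓖) (t := 𝓖) D).symm
    calc 𝓖.card * 𝓖.card = ∑ _B ∈ 𝓖, 𝓖.card := by rw [sum_const, smul_eq_mul]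
      _ ≤ ∑ B ∈ 𝓖, ((𝓖.filter (fun B' => ¬ Disjoint (B \ P) (B' \ P))).card +
          ((𝓖.filter (fun B' => D B B')).card + (𝓖.filter (fun B' => D B' B)).card)) :=
          sum_le_sum fun B hB => (card_le_card (hcover B hB)).trans ((card_union_le _ _).trans
            (Nat.add_le_add_left (card_union_le _ _) _))
      _ = ∑ B ∈ 𝓖, ((𝓖.filter (fun B' => ¬ Disjoint (B \ P) (B' \ P))).card +
          2 * (𝓖.filter (fun B' => D B B')).card) := by
          rw [sum_add_distrib, sum_add_distrib, hsymm, sum_add_distrib, ← mul_sum]; ring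
      _ ≤ ∑ _B ∈ 𝓖, (s * Fintype.card V ^ (s - 2) + 2 * (s * M)) :=
          sum_le_sum fun B hB => Nat.add_le_add (hmeetc B hB)
            (Nat.mul_le_mul_left 2 (hDc B hB))
      _ = _ := by rw [sum_const, smul_eq_mul]
  rcases Nat.eq_zero_or_pos 𝓖.card with h0 | hpos
  · rw [h0]; exact Nat.zero_le _
  · exact Nat.le_of_mul_le_mul_left hsum hpos

/-- A vertex that is not `σ`-bad lies in at most `(2 ^ k * σ / badThreshold k) * n ^ (s - 1)` bad
sets of size `s = k - |P|`. Fed into the exchange bound, this improves `card_goodExtensions_le` by a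
small factor. -/
lemma card_goodExtensions_le_mixing {H : Finset (Finset V)} {k : ℕ} {v : V}
    (hs : (H : Set (Finset V)).Sized k) (hfree : ¬ HasRegularSubgraph 2 H)
    (hn : 4 * k ≤ Fintype.card V) {σ : ℝ} (hσ0 : 0 ≤ σ) (hσ : σ ≤ badThreshold k) {P : Finset V}
    (hP : P.Nonempty) (hPk : P.card + 2 ≤ k) :
    ((goodExtensions H k v σ P).card : ℝ) ≤ k * ((1 / Fintype.card V +
      2 ^ (k + 1) * σ / badThreshold k) * (Fintype.card V : ℝ) ^ (k - P.card - 1)) := by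
  set n := Fintype.card V with hn'
  have hP1 : 1 ≤ P.card := card_pos.2 hP
  have hn0 : (0 : ℝ) < n := by exact_mod_cast (by omega : 0 < n)
  have hθ := badThreshold_pos k
  set s := k - P.card with hs'
  set R : ℝ := 2 ^ k * σ / badThreshold k * (n : ℝ) ^ (s - 1) with hR
  have hR0 : 0 ≤ R := by positivity
  have h1 := card_goodExtensions_le_of_card_badSets_le hs hfree hn hσ (v := v) hP hPk
    (M := ⌊R⌋₊) (by
      intro a ha
      refine Nat.le_floor ?_
      unfold IsBad at ha
      rw [not_le, card_singleton] at ha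
      have h2 := card_badSets_filter_mul_le H (k := k) (v := v) (σ := badThreshold k) s {a}
      have h3 : (n : ℝ) ^ (k - 1 - 1) = n ^ (k - 1 - s) * n ^ (s - 1) := by
        rw [← pow_add]; congr 1; omega
      have hpow : (0 : ℝ) < (n : ℝ) ^ (k - 1 - s) := by positivity
      have h4 := h2.trans (mul_le_mul_of_nonneg_left ha.le (by positivity))
      rw [← hn', h3] at h4
      rw [hR, ← mul_le_mul_iff_left₀ (mul_pos hθ hpow)]
      refine h4.trans (le_of_eq ?_)
      field_simp)
  have h2 : ((goodExtensions H k v σ P).card : ℝ) ≤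
      (s : ℕ) * (n : ℝ) ^ (s - 2) + 2 * ((s : ℕ) * (⌊R⌋₊ : ℕ)) := by exact_mod_cast h1
  have h3 : ((⌊R⌋₊ : ℕ) : ℝ) ≤ R := Nat.floor_le hR0
  have h4 : ((s : ℕ) : ℝ) ≤ k := by exact_mod_cast Nat.sub_le _ _
  calc _ ≤ (s : ℕ) * (n : ℝ) ^ (s - 2) + 2 * ((s : ℕ) * (⌊R⌋₊ : ℕ)) := h2
    _ ≤ k * (n : ℝ) ^ (s - 2) + 2 * (k * R) := by gcongr
    _ = _ := by
      have h5 : (n : ℝ) ^ (s - 1) = n ^ (s - 2) * n := by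
        rw [← pow_succ]; congr 1; omega
      rw [hR, h5, pow_succ]; field_simp

/-! ### Edges with a bad vertex or a bad subset -/

open Classical in
/-- The vertices that are bad as one-element sets. -/
noncomputable def badVertices (H : Finset (Finset V)) (k : ℕ) (v : V) (σ : ℝ) : Finset V :=
  univ.filter (fun a => IsBad H k v σ {a})

lemma mem_badVertices {H : Finset (Finset V)} {k : ℕ} {v : V} {σ : ℝ} {a : V} :
    a ∈ badVertices H k v σ ↔ IsBad H k v σ {a} := by
  simp [badVertices]

lemma codegree_empty (N : Finset (Finset V)) : codegree N ∅ = N.card := by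
  simp [codegree]

lemma card_badSets_mul_le (H : Finset (Finset V)) {k : ℕ} {v : V} {σ : ℝ} (s : ℕ) :
    ((badSets H k v σ s).card : ℝ) * (σ * (Fintype.card V : ℝ) ^ (k - 1 - s)) ≤
      2 ^ k * (missingLink H k v).card := by
  have h := card_badSets_filter_mul_le H (k := k) (v := v) (σ := σ) s ∅
  rwa [codegree_empty, filter_true_of_mem (fun _ _ => empty_subset _)] at h

lemma card_badVertices_mul_le (H : Finset (Finset V)) {k : ℕ} {v : V} {σ : ℝ} (hσ : 0 ≤ σ) :
    ((badVertices H k v σ).card : ℝ) * (σ * (Fintype.card V : ℝ) ^ (k - 2)) ≤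
      2 ^ k * (missingLink H k v).card := by
  refine le_trans ?_ (card_badSets_mul_le H (k := k) (v := v) (σ := σ) 1)
  have h1 : (badVertices H k v σ).card ≤ (badSets H k v σ 1).card := by
    refine card_le_card_of_injOn (fun a => {a}) ?_ ?_
    · intro a ha
      exact mem_coe.2 (mem_badSets.2 ⟨card_singleton a, mem_badVertices.1 (mem_coe.1 ha)⟩)
    · intro a _ b _ h
      exact singleton_injective h
  have h2 : k - 1 - 1 = k - 2 := by omega
  rw [h2]
  gcongr

/-- The general bound of order `|U| ^ (k - 1)` is applied inside `X`; all but two factors `|X|` are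
then replaced by `n`. -/
lemma card_edges_subset_badVertices_le {H : Finset (Finset V)} {k : ℕ} {v : V} (hk : 3 ≤ k)
    (hs : (H : Set (Finset V)).Sized k) (hfree : ¬ HasRegularSubgraph 2 H) (X : Finset V) :
    (((edgesAvoiding H v).filter (fun B => (B ∩ X).card = k)).card : ℝ) ≤
      (4098 + k * (k + 4)) * ((X.card : ℝ) * X.card * (Fintype.card V : ℝ) ^ (k - 3)) := by
  have h1 := card_le_mul_pow hk (H := (edgesAvoiding H v).filter (fun B => (B ∩ X).card = k))
    (U := X) (fun e he => card_of_mem_edgesAvoiding hs (mem_filter.1 (mem_coe.1 he)).1)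
    (by
      intro e he
      obtain ⟨he, hc⟩ := mem_filter.1 he
      have h2 := card_of_mem_edgesAvoiding hs he
      have h3 : e ∩ X = e := eq_of_subset_of_card_le inter_subset_left (by omega)
      rw [← h3]; exact inter_subset_right)
    (fun h => hfree (h.mono ((filter_subset _ _).trans (filter_subset _ _))))
  refine h1.trans (mul_le_mul_of_nonneg_left ?_ (by positivity))
  have hX : (X.card : ℝ) ≤ Fintype.card V := by exact_mod_cast card_le_univ X
  have h2 : (X.card : ℝ) ^ (k - 1) = X.card * X.card * (X.card : ℝ) ^ (k - 3) := by
    rw [← pow_two, ← pow_add]; congr 1; omega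
  rw [h2]
  gcongr

/-- Such an edge is a good extension of its set of `b` bad vertices, which gives `|X| ^ b * n ^ (k -
b - 1)` with `b ≥ 2`. -/
lemma card_edges_inter_badVertices_le {H : Finset (Finset V)} {k : ℕ} {v : V}
    (hs : (H : Set (Finset V)).Sized k) (hfree : ¬ HasRegularSubgraph 2 H)
    (hn : 4 * k ≤ Fintype.card V) {τ : ℝ} (hτ : τ ≤ badThreshold k) :
    ((edgesAvoiding H v).filter (fun B => 2 ≤ (B ∩ badVertices H k v τ).card ∧
      (B ∩ badVertices H k v τ).card < k)).card ≤
      k * ((badVertices H k v τ).card * (badVertices H k v τ).card *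
        Fintype.card V ^ (k - 3)) := by
  set X := badVertices H k v τ with hX
  set n := Fintype.card V with hn'
  have hsub : (edgesAvoiding H v).filter (fun B => 2 ≤ (B ∩ X).card ∧ (B ∩ X).card < k) ⊆
      (Ico 2 k).biUnion (fun b => (powersetCard b X).biUnion (goodExtensions H k v τ)) := by
    intro B hB
    obtain ⟨hB, h2, hlt⟩ := mem_filter.1 hB
    refine mem_biUnion.2 ⟨(B ∩ X).card, mem_Ico.2 ⟨h2, hlt⟩, mem_biUnion.2 ⟨B ∩ X,
      mem_powersetCard.2 ⟨inter_subset_right, rfl⟩, mem_goodExtensions.2 ⟨hB, inter_subset_left,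
      fun a ha hbad => ?_⟩⟩⟩
    rw [mem_sdiff, mem_inter] at ha
    exact ha.2 ⟨ha.1, mem_badVertices.2 hbad⟩
  refine (card_le_card hsub).trans ((card_biUnion_le_card_mul _ _
    (X.card * X.card * n ^ (k - 3)) fun b hb => ?_).trans (Nat.mul_le_mul_right _ ?_))
  · rw [mem_Ico] at hb
    refine (card_biUnion_le_card_mul _ _ (n ^ (k - b - 1)) fun U hU => ?_).trans ?_
    · have hUc := (mem_powersetCard.1 hU).2
      have h1 := card_goodExtensions_le hs hfree hn hτ (v := v) (P := U)
        (card_pos.1 (by omega)) (by omega)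
      rwa [hUc] at h1
    · rw [card_powersetCard]
      calc X.card.choose b * n ^ (k - b - 1) ≤ X.card ^ b * n ^ (k - b - 1) :=
            Nat.mul_le_mul_right _ (Nat.choose_le_pow _ _)
        _ = X.card * X.card * (X.card ^ (b - 2) * n ^ (k - b - 1)) := by
            rw [← mul_assoc, ← pow_two, ← pow_add]; congr 2; omega
        _ ≤ X.card * X.card * (n ^ (b - 2) * n ^ (k - b - 1)) := by
            gcongr
            exact card_le_univ X
        _ = X.card * X.card * n ^ (k - 3) := by rw [← pow_add]; congr 2; omega
  · rw [Nat.card_Ico]; exact Nat.sub_le _ _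

/-- Two scales are needed: the number of `τ`-bad vertices costs a factor `1 / τ`, which the saving
`σ` of the mixing bound must beat. If the edge has a second, merely `σ`-bad vertex, the pair is
prescribed instead. -/
lemma card_edges_inter_badVertices_eq_one_le {H : Finset (Finset V)} {k : ℕ} {v : V} (hk : 3 ≤ k)
    (hs : (H : Set (Finset V)).Sized k) (hfree : ¬ HasRegularSubgraph 2 H)
    (hn : 4 * k ≤ Fintype.card V) {σ τ : ℝ} (hσ : 0 ≤ σ) (hστ : σ ≤ τ) (hτ : τ ≤ badThreshold k) :
    (((edgesAvoiding H v).filter (fun B => (B ∩ badVertices H k v τ).card = 1)).card : ℝ) ≤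
      (badVertices H k v τ).card * (k * ((1 / Fintype.card V +
        2 ^ (k + 1) * σ / badThreshold k) * (Fintype.card V : ℝ) ^ (k - 2))) +
      (badVertices H k v τ).card * (badVertices H k v σ).card *
        (Fintype.card V : ℝ) ^ (k - 3) := by
  set X := badVertices H k v τ with hX
  set Y := badVertices H k v σ with hY
  set n := Fintype.card V with hn'
  have hsub : (edgesAvoiding H v).filter (fun B => (B ∩ X).card = 1) ⊆
      X.biUnion (fun u => goodExtensions H k v σ {u}) ∪
      (X ×ˢ Y).biUnion (fun p => if p.1 = p.2 then ∅ else goodExtensions H k v τ {p.1, p.2}) := by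
    intro B hB
    obtain ⟨hB, h1⟩ := mem_filter.1 hB
    obtain ⟨u, hu⟩ := card_eq_one.1 h1
    have huB : u ∈ B ∩ X := by rw [hu]; exact mem_singleton_self u
    rw [mem_inter] at huB
    have hgood : ∀ a ∈ B, a ≠ u → ¬ IsBad H k v τ {a} := by
      intro a ha hau hbad
      have : a ∈ B ∩ X := mem_inter.2 ⟨ha, mem_badVertices.2 hbad⟩
      rw [hu, mem_singleton] at this
      exact hau this
    rw [mem_union]
    by_cases h : ∀ a ∈ B \ {u}, ¬ IsBad H k v σ {a}
    · exact Or.inl (mem_biUnion.2 ⟨u, huB.2, mem_goodExtensions.2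
        ⟨hB, singleton_subset_iff.2 huB.1, h⟩⟩)
    · push Not at h
      obtain ⟨w, hw, hbad⟩ := h
      rw [mem_sdiff, mem_singleton] at hw
      refine Or.inr (mem_biUnion.2 ⟨(u, w), mem_product.2 ⟨huB.2, mem_badVertices.2 hbad⟩, ?_⟩)
      rw [if_neg (fun h => hw.2 h.symm)]
      refine mem_goodExtensions.2 ⟨hB, ?_, fun a ha => ?_⟩
      · simp [insert_subset_iff, huB.1, hw.1]
      · rw [mem_sdiff, mem_insert, not_or] at ha
        exact hgood a ha.1 ha.2.1
  have hc1 : ((X.biUnion (fun u => goodExtensions H k v σ {u})).card : ℝ) ≤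
      X.card * (k * ((1 / n + 2 ^ (k + 1) * σ / badThreshold k) * (n : ℝ) ^ (k - 2))) := by
    calc ((X.biUnion (fun u => goodExtensions H k v σ {u})).card : ℝ)
        ≤ ∑ u ∈ X, ((goodExtensions H k v σ {u}).card : ℝ) := by exact_mod_cast card_biUnion_le
      _ ≤ ∑ _u ∈ X, (k * ((1 / n + 2 ^ (k + 1) * σ / badThreshold k) * (n : ℝ) ^ (k - 2))) := by
          refine sum_le_sum fun u _ => ?_
          have h1 := card_goodExtensions_le_mixing hs hfree hn (v := v) hσ (hστ.trans hτ)
            (P := {u}) (singleton_nonempty u) (by rw [card_singleton]; omega)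
          have h2 : k - ({u} : Finset V).card - 1 = k - 2 := by rw [card_singleton]; omega
          rwa [h2] at h1
      _ = _ := by rw [sum_const, nsmul_eq_mul]
  have hc2 : ((X ×ˢ Y).biUnion (fun p => if p.1 = p.2 then ∅ else
      goodExtensions H k v τ {p.1, p.2})).card ≤ X.card * Y.card * n ^ (k - 3) := by
    rw [← card_product]
    refine card_biUnion_le_card_mul _ _ _ fun p _ => ?_
    split_ifs with h
    · simp
    · have h1 := card_goodExtensions_le hs hfree hn hτ (v := v) (P := {p.1, p.2})
        (insert_nonempty _ _) (by rw [card_pair h]; omega)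
      have h2 : k - ({p.1, p.2} : Finset V).card - 1 = k - 3 := by rw [card_pair h]; omega
      rwa [h2] at h1
  have h1 := (card_le_card hsub).trans (card_union_le _ _)
  calc _ ≤ ((X.biUnion (fun u => goodExtensions H k v σ {u})).card : ℝ) +
        ((X ×ˢ Y).biUnion (fun p => if p.1 = p.2 then ∅ else
          goodExtensions H k v τ {p.1, p.2})).card := by exact_mod_cast h1
    _ ≤ _ := by
      refine add_le_add hc1 ?_
      exact_mod_cast hc2

/-- `B` contains a `τ`-bad vertex or a bad set of intermediate size. -/
def HasBadSubset (H : Finset (Finset V)) (k : ℕ) (v : V) (τ : ℝ) (B : Finset V) : Prop :=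
  (∃ a ∈ B, IsBad H k v τ {a}) ∨
    ∃ P ⊆ B, 2 ≤ P.card ∧ P.card + 2 ≤ k ∧ IsBad H k v (badThreshold k) P

open Classical in
-- With no `τ`-bad vertex, the edge is a good extension of a bad set of size `p`. The number of such
-- sets is of order `|N| / n ^ (k - 1 - p)`, and the mixing bound restores this power with a small
-- factor.
lemma card_edges_avoiding_badVertices_le {H : Finset (Finset V)} {k : ℕ} {v : V}
    (hs : (H : Set (Finset V)).Sized k) (hfree : ¬ HasRegularSubgraph 2 H)
    (hn : 4 * k ≤ Fintype.card V) {τ : ℝ} (hτ0 : 0 ≤ τ) (hτ : τ ≤ badThreshold k) :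
    (((edgesAvoiding H v).filter (fun B => (B ∩ badVertices H k v τ).card = 0 ∧
      HasBadSubset H k v τ B)).card : ℝ) ≤
      k * (k * ((1 / Fintype.card V + 2 ^ (k + 1) * τ / badThreshold k) *
        (2 ^ k * (missingLink H k v).card / badThreshold k))) := by
  set X := badVertices H k v τ with hX
  set n := Fintype.card V with hn'
  have hθ := badThreshold_pos k
  have hsub : (edgesAvoiding H v).filter (fun B => (B ∩ X).card = 0 ∧
      HasBadSubset H k v τ B) ⊆ (Ico 2 (k - 1)).biUnion
        (fun p => (badSets H k v (badThreshold k) p).biUnion (goodExtensions H k v τ)) := by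
    intro B hB
    obtain ⟨hB, h0, hbad⟩ := mem_filter.1 hB
    have hgood : ∀ a ∈ B, ¬ IsBad H k v τ {a} := by
      intro a ha h
      rw [card_eq_zero] at h0
      exact notMem_empty a (h0 ▸ mem_inter.2 ⟨ha, mem_badVertices.2 h⟩)
    rcases hbad with ⟨a, ha, h⟩ | ⟨P, hPB, hP2, hPk, hP⟩
    · exact absurd h (hgood a ha)
    · exact mem_biUnion.2 ⟨P.card, mem_Ico.2 ⟨hP2, by omega⟩, mem_biUnion.2 ⟨P,
        mem_badSets.2 ⟨rfl, hP⟩, mem_goodExtensions.2 ⟨hB, hPB, fun a ha =>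
          hgood a (mem_sdiff.1 ha).1⟩⟩⟩
  set c : ℝ := 1 / n + 2 ^ (k + 1) * τ / badThreshold k with hc
  have hc0 : 0 ≤ c := by positivity
  set D : ℝ := k * (c * (2 ^ k * (missingLink H k v).card / badThreshold k)) with hD
  have hD0 : 0 ≤ D := by positivity
  have hp : ∀ p ∈ Ico 2 (k - 1), (((badSets H k v (badThreshold k) p).biUnion
      (goodExtensions H k v τ)).card : ℝ) ≤ D := by
    intro p hp
    rw [mem_Ico] at hp
    have h1 := card_badSets_mul_le H (k := k) (v := v) (σ := badThreshold k) p
    calc (((badSets H k v (badThreshold k) p).biUnion (goodExtensions H k v τ)).card : ℝ)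
        ≤ ∑ P ∈ badSets H k v (badThreshold k) p, ((goodExtensions H k v τ P).card : ℝ) := by
          exact_mod_cast card_biUnion_le
      _ ≤ ∑ _P ∈ badSets H k v (badThreshold k) p, k * (c * (n : ℝ) ^ (k - 1 - p)) := by
          refine sum_le_sum fun P hP => ?_
          have hPc := (mem_badSets.1 hP).1
          have h1 := card_goodExtensions_le_mixing hs hfree hn (v := v) hτ0 hτ
            (P := P) (card_pos.1 (by omega)) (by omega)
          have h2 : k - P.card - 1 = k - 1 - p := by omega
          rwa [h2] at h1
      _ = k * (c * (((badSets H k v (badThreshold k) p).card : ℝ) *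
            (badThreshold k * (n : ℝ) ^ (k - 1 - p)) / badThreshold k)) := by
          rw [sum_const, nsmul_eq_mul]; field_simp
      _ ≤ D := by rw [hD]; gcongr
  calc _ ≤ (((Ico 2 (k - 1)).biUnion (fun p => (badSets H k v (badThreshold k) p).biUnion
        (goodExtensions H k v τ))).card : ℝ) := by exact_mod_cast card_le_card hsub
    _ ≤ ∑ p ∈ Ico 2 (k - 1), (((badSets H k v (badThreshold k) p).biUnion
        (goodExtensions H k v τ)).card : ℝ) := by exact_mod_cast card_biUnion_le
    _ ≤ ∑ _p ∈ Ico 2 (k - 1), D := sum_le_sum hp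
    _ = ((k - 1 - 2 : ℕ) : ℝ) * D := by rw [sum_const, nsmul_eq_mul, Nat.card_Ico]
    _ ≤ k * D := by
      gcongr
      omega

open Classical in
/-- Few edges avoiding `v` contain a bad vertex or a bad set of intermediate size. -/
lemma card_filter_hasBadSubset_le {H : Finset (Finset V)} {k : ℕ} {v : V} (hk : 3 ≤ k)
    (hs : (H : Set (Finset V)).Sized k) (hfree : ¬ HasRegularSubgraph 2 H)
    (hn : 4 * k ≤ Fintype.card V) {σ τ η : ℝ} (hσ : 0 < σ) (hστ : σ ≤ τ)
    (hτ : τ ≤ badThreshold k)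
    (hN : ((missingLink H k v).card : ℝ) ≤ η * (Fintype.card V : ℝ) ^ (k - 1)) :
    (((edgesAvoiding H v).filter (HasBadSubset H k v τ)).card : ℝ) ≤
      (missingLink H k v).card * ((4099 + k * (k + 5)) * (2 ^ k * η / σ) * (2 ^ k / τ) +
        (2 ^ k / τ) * k * (1 / Fintype.card V + 2 ^ (k + 1) * σ / badThreshold k) +
        k * k * (2 ^ k / badThreshold k) *
          (1 / Fintype.card V + 2 ^ (k + 1) * τ / badThreshold k)) := by
  set X := badVertices H k v τ with hX
  set Y := badVertices H k v σ with hY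
  set n := Fintype.card V with hn'
  set N : ℝ := ((missingLink H k v).card : ℝ) with hN'
  have hθ := badThreshold_pos k
  have hτ0 : 0 < τ := hσ.trans_le hστ
  have hn0 : (0 : ℝ) < n := by exact_mod_cast (by omega : 0 < n)
  have hcard : ((edgesAvoiding H v).filter (HasBadSubset H k v τ)).card ≤
      ((edgesAvoiding H v).filter (fun B => (B ∩ X).card = k)).card +
      ((edgesAvoiding H v).filter (fun B => 2 ≤ (B ∩ X).card ∧ (B ∩ X).card < k)).card +
      ((edgesAvoiding H v).filter (fun B => (B ∩ X).card = 1)).card +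
      ((edgesAvoiding H v).filter
        (fun B => (B ∩ X).card = 0 ∧ HasBadSubset H k v τ B)).card := by
    refine (card_le_card (t := (((edgesAvoiding H v).filter (fun B => (B ∩ X).card = k) ∪
      (edgesAvoiding H v).filter (fun B => 2 ≤ (B ∩ X).card ∧ (B ∩ X).card < k)) ∪
      (edgesAvoiding H v).filter (fun B => (B ∩ X).card = 1)) ∪
      (edgesAvoiding H v).filter
        (fun B => (B ∩ X).card = 0 ∧ HasBadSubset H k v τ B)) ?_).trans ?_
    · intro B hB
      obtain ⟨hB, hbad⟩ := mem_filter.1 hB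
      have h1 : (B ∩ X).card ≤ k := by
        rw [← card_of_mem_edgesAvoiding hs hB]; exact card_le_card inter_subset_left
      simp only [mem_union, mem_filter, hB, hbad, true_and, and_true]
      omega
    · refine (card_union_le _ _).trans (Nat.add_le_add_right ?_ _)
      refine (card_union_le _ _).trans (Nat.add_le_add_right ?_ _)
      exact card_union_le _ _
  have h1 := card_edges_subset_badVertices_le (v := v) hk hs hfree X
  have h2 := card_edges_inter_badVertices_le (v := v) hs hfree hn hτ
  have h3 := card_edges_inter_badVertices_eq_one_le (v := v) hk hs hfree hn hσ.le hστ hτ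
  have h4 := card_edges_avoiding_badVertices_le (v := v) hs hfree hn hτ0.le hτ
  rw [← hX] at h2 h3 h4
  rw [← hY] at h3
  have h2' : (((edgesAvoiding H v).filter
      (fun B => 2 ≤ (B ∩ X).card ∧ (B ∩ X).card < k)).card : ℝ) ≤
      k * ((X.card : ℝ) * X.card * (n : ℝ) ^ (k - 3)) := by exact_mod_cast h2
  -- One factor `|X|` is traded for `|N|`, so that every term is proportional to `|N|`; a second
  -- factor `|X|` or `|Y|` is only a small multiple of `n`.
  have hXL : (X.card : ℝ) * (n : ℝ) ^ (k - 2) ≤ N * (2 ^ k / τ) := by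
    have := card_badVertices_mul_le H (k := k) (v := v) hτ0.le
    rw [mul_div_assoc', le_div_iff₀ hτ0]
    linarith
  have hYn : (Y.card : ℝ) ≤ 2 ^ k * η / σ * n := by
    have h5 := card_badVertices_mul_le H (k := k) (v := v) hσ.le
    have h6 : (n : ℝ) ^ (k - 1) = n ^ (k - 2) * n := by
      rw [← pow_succ]; congr 1; omega
    have hpow : (0 : ℝ) < (n : ℝ) ^ (k - 2) := by positivity
    rw [h6] at hN
    have h7 := h5.trans (mul_le_mul_of_nonneg_left hN (by positivity))
    rw [← mul_le_mul_iff_left₀ (mul_pos hσ hpow)]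
    refine h7.trans (le_of_eq ?_)
    field_simp
  have hXY : (X.card : ℝ) ≤ Y.card := by
    have : X ⊆ Y := fun a ha => mem_badVertices.2 ((mem_badVertices.1 ha).mono hστ)
    exact_mod_cast card_le_card this
  have hQ : (X.card : ℝ) * Y.card * (n : ℝ) ^ (k - 3) ≤ N * ((2 ^ k * η / σ) * (2 ^ k / τ)) := by
    have h6 : (n : ℝ) ^ (k - 2) = n ^ (k - 3) * n := by
      rw [← pow_succ]; congr 1; omega
    have hε : 0 ≤ 2 ^ k * η / σ := by
      by_contra hneg
      have : (0 : ℝ) ≤ Y.card := by positivity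
      nlinarith
    calc (X.card : ℝ) * Y.card * (n : ℝ) ^ (k - 3)
        ≤ X.card * (2 ^ k * η / σ * n) * (n : ℝ) ^ (k - 3) := by gcongr
      _ = 2 ^ k * η / σ * (X.card * (n : ℝ) ^ (k - 2)) := by rw [h6]; ring
      _ ≤ 2 ^ k * η / σ * (N * (2 ^ k / τ)) := by gcongr
      _ = _ := by ring
  have hQ' : (X.card : ℝ) * X.card * (n : ℝ) ^ (k - 3) ≤
      N * ((2 ^ k * η / σ) * (2 ^ k / τ)) := le_trans (by gcongr) hQ
  have hcard' : (((edgesAvoiding H v).filter (HasBadSubset H k v τ)).card : ℝ) ≤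
      ((edgesAvoiding H v).filter (fun B => (B ∩ X).card = k)).card +
      ((edgesAvoiding H v).filter (fun B => 2 ≤ (B ∩ X).card ∧ (B ∩ X).card < k)).card +
      ((edgesAvoiding H v).filter (fun B => (B ∩ X).card = 1)).card +
      ((edgesAvoiding H v).filter
        (fun B => (B ∩ X).card = 0 ∧ HasBadSubset H k v τ B)).card := by
    exact_mod_cast hcard
  have h1' : (((edgesAvoiding H v).filter (fun B => (B ∩ X).card = k)).card : ℝ) ≤
      (4098 + k * (k + 4)) * (N * ((2 ^ k * η / σ) * (2 ^ k / τ))) :=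
    h1.trans (mul_le_mul_of_nonneg_left hQ' (by positivity))
  have h2'' := h2'.trans (mul_le_mul_of_nonneg_left hQ' (Nat.cast_nonneg k))
  set c₁ : ℝ := 1 / n + 2 ^ (k + 1) * σ / badThreshold k with hc₁
  set c₂ : ℝ := 1 / n + 2 ^ (k + 1) * τ / badThreshold k with hc₂
  have hc₁0 : 0 ≤ c₁ := by positivity
  have h3' : (X.card : ℝ) * (k * (c₁ * (n : ℝ) ^ (k - 2))) ≤ N * (2 ^ k / τ * k * c₁) := by
    calc (X.card : ℝ) * (k * (c₁ * (n : ℝ) ^ (k - 2)))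
        = k * c₁ * (X.card * (n : ℝ) ^ (k - 2)) := by ring
      _ ≤ k * c₁ * (N * (2 ^ k / τ)) := by gcongr
      _ = _ := by ring
  calc _ ≤ _ := hcard'
    _ ≤ (4098 + k * (k + 4)) * (N * ((2 ^ k * η / σ) * (2 ^ k / τ))) +
        k * (N * ((2 ^ k * η / σ) * (2 ^ k / τ))) +
        (N * (2 ^ k / τ * k * c₁) + N * ((2 ^ k * η / σ) * (2 ^ k / τ))) +
        k * (k * (c₂ * (2 ^ k * N / badThreshold k))) :=
      add_le_add (add_le_add (add_le_add h1' h2'') (h3.trans (add_le_add h3' hQ))) h4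
    _ = _ := by ring

/-! ### Edges without bad subsets -/

/-- At full size `k - 1`, badness just says that the codegree is positive, and the only candidate
missing set is `P` itself. -/
lemma mem_missingLink_of_isBad {H : Finset (Finset V)} {k : ℕ} {v : V} {P : Finset V}
    (hP : P.card = k - 1) (h : IsBad H k v (badThreshold k) P) : P ∈ missingLink H k v := by
  unfold IsBad at h
  rw [hP, Nat.sub_self, pow_zero, mul_one] at h
  have hpos : (0 : ℝ) < codegree (missingLink H k v) P := (badThreshold_pos k).trans_le h
  have hpos' : 0 < codegree (missingLink H k v) P := by exact_mod_cast hpos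
  obtain ⟨A, hA⟩ := card_pos.1 hpos'
  obtain ⟨hA, hPA⟩ := mem_filter.1 hA
  rwa [eq_of_subset_of_card_le hPA (by rw [(mem_missingLink.1 hA).1.2, hP])]

/-- Two meeting edges without bad subsets share exactly one vertex. -/
lemma card_inter_eq_one_of_not_hasBadSubset {H : Finset (Finset V)} {k : ℕ} {v : V}
    (hs : (H : Set (Finset V)).Sized k) (hfree : ¬ HasRegularSubgraph 2 H)
    (hn : 4 * k ≤ Fintype.card V) {τ : ℝ} (hτ : τ ≤ badThreshold k) {B B' : Finset V}
    (hB : B ∈ edgesAvoiding H v) (hB' : B' ∈ edgesAvoiding H v) (hg : ¬ HasBadSubset H k v τ B)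
    (hg' : ¬ HasBadSubset H k v τ B') (hne : B ≠ B') (hmeet : ¬ Disjoint B B') :
    (B ∩ B').card = 1 := by
  have hBc := card_of_mem_edgesAvoiding hs hB
  have hBc' := card_of_mem_edgesAvoiding hs hB'
  have hpos : 0 < (B ∩ B').card := by
    rw [card_pos, ← not_disjoint_iff_nonempty_inter]; exact hmeet
  have h1 := card_sdiff_add_card_inter B B'
  have h2 := card_sdiff_add_card_inter B' B
  rw [inter_comm] at h2
  have hsd : 0 < (B \ B').card := by
    rw [card_pos, sdiff_nonempty]
    exact fun h => hne (eq_of_subset_of_card_le h (by omega))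
  by_contra hcon
  -- With at least two common vertices, `B \ B'` has at most `k - 2` elements, so `HasBadSubset`
  -- covers it: by its first clause if it is a single vertex, by its second otherwise.
  have key : ∀ {B B' : Finset V}, B.card = k → (B \ B').card + (B ∩ B').card = k →
      0 < (B \ B').card → 2 ≤ (B ∩ B').card → ¬ HasBadSubset H k v τ B →
      ¬ IsBad H k v (badThreshold k) (B \ B') := by
    intro B B' hBc h1 hsd h2 hg hbad
    unfold HasBadSubset at hg
    push Not at hg
    rcases Nat.lt_or_ge (B \ B').card 2 with hlt | hge
    · obtain ⟨a, ha⟩ := card_eq_one.1 (by omega : (B \ B').card = 1)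
      have haB : a ∈ B \ B' := by rw [ha]; exact mem_singleton_self a
      rw [ha] at hbad
      exact hg.1 a (mem_sdiff.1 haB).1 (hbad.mono hτ)
    · exact hg.2 _ sdiff_subset hge (by omega) hbad
  rcases isBad_or_isBad hs hfree hn hB hB' hne hmeet (R := B \ B') (S := B' \ B)
    (by intro x; rw [mem_sdiff, mem_sdiff]) disjoint_sdiff_sdiff (by omega) with h | h
  · exact key hBc (by omega) hsd (by omega) hg h
  · exact key hBc' (by rw [inter_comm]; omega) (by omega) (by rw [inter_comm]; omega) hg' h

/-- The two erased edges are a balanced partition of the symmetric difference into sets of size `k -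
1`, where bad means missing. -/
lemma erase_mem_missingLink_or {H : Finset (Finset V)} {k : ℕ} {v : V}
    (hs : (H : Set (Finset V)).Sized k) (hfree : ¬ HasRegularSubgraph 2 H)
    (hn : 4 * k ≤ Fintype.card V) {B B' : Finset V}
    (hB : B ∈ edgesAvoiding H v) (hB' : B' ∈ edgesAvoiding H v) (hne : B ≠ B') {w : V}
    (hi : B ∩ B' = {w}) :
    B.erase w ∈ missingLink H k v ∨ B'.erase w ∈ missingLink H k v := by
  have hw : w ∈ B ∩ B' := by rw [hi]; exact mem_singleton_self w
  rw [mem_inter] at hw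
  have hmem : ∀ x, x ∈ B → x ∈ B' → x = w := by
    intro x h h'
    rw [← mem_singleton, ← hi, mem_inter]
    exact ⟨h, h'⟩
  have hBc : (B.erase w).card = k - 1 := by
    rw [card_erase_of_mem hw.1, card_of_mem_edgesAvoiding hs hB]
  have hBc' : (B'.erase w).card = k - 1 := by
    rw [card_erase_of_mem hw.2, card_of_mem_edgesAvoiding hs hB']
  refine (isBad_or_isBad hs hfree hn hB hB' hne (Finset.not_disjoint_iff.2 ⟨w, hw.1, hw.2⟩)
    (R := B.erase w) (S := B'.erase w) (fun x => ?_) ?_ (by rw [hBc, hBc'])).imp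
    (mem_missingLink_of_isBad hBc) (mem_missingLink_of_isBad hBc')
  · rw [mem_erase, mem_erase]
    constructor
    · rintro (⟨h1, h2⟩ | ⟨h1, h2⟩)
      · exact Or.inl ⟨h2, fun h => h1 (hmem x h2 h)⟩
      · exact Or.inr ⟨h2, fun h => h1 (hmem x h h2)⟩
    · rintro (⟨h1, h2⟩ | ⟨h1, h2⟩)
      · exact Or.inl ⟨fun h => h2 (h ▸ hw.2), h1⟩
      · exact Or.inr ⟨fun h => h2 (h ▸ hw.1), h1⟩
  · rw [Finset.disjoint_left]
    intro x hx hx'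
    rw [mem_erase] at hx hx'
    exact hx.1 (hmem x hx.2 hx'.2)

/-- One missing set comes from the partition into `B.erase w` and `B'.erase w`, another from the
partition obtained by exchanging `a` for `c`. Since `k - 1 ≥ 2`, the parts of the latter contain
vertices from both edges, so the two missing sets differ. -/
lemma two_le_card_missingLink {H : Finset (Finset V)} {k : ℕ} {v : V} (hk : 3 ≤ k)
    (hs : (H : Set (Finset V)).Sized k) (hfree : ¬ HasRegularSubgraph 2 H)
    (hn : 4 * k ≤ Fintype.card V) {B B' : Finset V}
    (hB : B ∈ edgesAvoiding H v) (hB' : B' ∈ edgesAvoiding H v) (hne : B ≠ B')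
    (hi : (B ∩ B').card = 1) : 2 ≤ (missingLink H k v).card := by
  obtain ⟨w, hw⟩ := card_eq_one.1 hi
  have hwm : w ∈ B ∩ B' := by rw [hw]; exact mem_singleton_self w
  rw [mem_inter] at hwm
  have hBc := card_of_mem_edgesAvoiding hs hB
  have hBc' := card_of_mem_edgesAvoiding hs hB'
  have hmem : ∀ x, x ∈ B → x ∈ B' → x = w := by
    intro x h h'
    rw [← mem_singleton, ← hw, mem_inter]
    exact ⟨h, h'⟩
  have hPc : (B.erase w).card = k - 1 := by rw [card_erase_of_mem hwm.1, hBc]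
  have hPc' : (B'.erase w).card = k - 1 := by rw [card_erase_of_mem hwm.2, hBc']
  have hPB' : ∀ x ∈ B.erase w, x ∉ B' := by
    intro x hx h
    rw [mem_erase] at hx
    exact hx.1 (hmem x hx.2 h)
  have hPB : ∀ x ∈ B'.erase w, x ∉ B := by
    intro x hx h
    rw [mem_erase] at hx
    exact hx.1 (hmem x h hx.2)
  obtain ⟨a, ha, b, hb, hab⟩ := one_lt_card.1 (by omega : 1 < (B.erase w).card)
  obtain ⟨c, hc, d, hd, hcd⟩ := one_lt_card.1 (by omega : 1 < (B'.erase w).card)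
  have haB' := hPB' a ha
  have hcB := hPB c hc
  set R := insert a ((B'.erase w).erase c) with hR
  set S := insert c ((B.erase w).erase a) with hS
  have hRc : R.card = k - 1 := by
    rw [hR, card_insert_of_notMem (fun h => haB' (mem_of_mem_erase (mem_of_mem_erase h))),
      card_erase_of_mem hc]; omega
  have hSc : S.card = k - 1 := by
    rw [hS, card_insert_of_notMem (fun h => hcB (mem_of_mem_erase (mem_of_mem_erase h))),
      card_erase_of_mem ha]; omega
  have hmix : R ∈ missingLink H k v ∨ S ∈ missingLink H k v := by
    refine (isBad_or_isBad hs hfree hn hB hB' hne (Finset.not_disjoint_iff.2 ⟨w, hwm.1, hwm.2⟩)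
      (R := R) (S := S) (fun x => ?_) ?_ (by rw [hRc, hSc])).imp
      (mem_missingLink_of_isBad hRc) (mem_missingLink_of_isBad hSc)
    · simp only [hR, hS, mem_insert, mem_erase] at ha hc ⊢
      constructor
      · rintro ((rfl | ⟨p, q, r⟩) | (rfl | ⟨p, q, r⟩))
        · exact Or.inl ⟨ha.2, haB'⟩
        · exact Or.inr ⟨r, fun h => q (hmem x h r)⟩
        · exact Or.inr ⟨hc.2, hcB⟩
        · exact Or.inl ⟨r, fun h => q (hmem x r h)⟩
      · rintro (⟨p, q⟩ | ⟨p, q⟩)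
        · by_cases hxa : x = a
          · exact Or.inl (Or.inl hxa)
          · exact Or.inr (Or.inr ⟨hxa, fun h => q (h ▸ hwm.2), p⟩)
        · by_cases hxc : x = c
          · exact Or.inr (Or.inl hxc)
          · exact Or.inl (Or.inr ⟨hxc, fun h => q (h ▸ hwm.1), p⟩)
    · rw [hR, hS, disjoint_insert_left, disjoint_insert_right, mem_insert, not_or]
      refine ⟨⟨fun h => haB' (h ▸ mem_of_mem_erase hc), by simp⟩, by simp, ?_⟩
      rw [Finset.disjoint_left]
      intro x hx hx'
      exact hPB x (mem_of_mem_erase hx) (mem_of_mem_erase (mem_of_mem_erase hx'))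
  have haR : a ∈ R := mem_insert_self _ _
  have hdR : d ∈ R := mem_insert_of_mem (mem_erase.2 ⟨hcd.symm, hd⟩)
  have hcS : c ∈ S := mem_insert_self _ _
  have hbS : b ∈ S := mem_insert_of_mem (mem_erase.2 ⟨hab.symm, hb⟩)
  have hin : ∀ {A : Finset V} {x y : V}, x ∈ A → y ∈ A → x ∉ B' → y ∉ B →
      A ≠ B.erase w ∧ A ≠ B'.erase w := by
    intro A x y hx hy hxB' hyB
    exact ⟨fun h => hyB (mem_of_mem_erase (h ▸ hy)), fun h => hxB' (mem_of_mem_erase (h ▸ hx))⟩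
  have hR' := hin haR hdR haB' (hPB d hd)
  have hS' := hin hbS hcS (hPB' b hb) hcB
  rcases erase_mem_missingLink_or hs hfree hn hB hB' hne hw with h1 | h1 <;>
    rcases hmix with h2 | h2
  · exact one_lt_card.2 ⟨_, h1, _, h2, hR'.1.symm⟩
  · exact one_lt_card.2 ⟨_, h1, _, h2, hS'.1.symm⟩
  · exact one_lt_card.2 ⟨_, h1, _, h2, hR'.2.symm⟩
  · exact one_lt_card.2 ⟨_, h1, _, h2, hS'.2.symm⟩

/-- A linear family of edges in which, at each vertex, all but one edge leaves a missing set. -/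
lemma mul_card_le_of_linear {k : ℕ} (hk : 3 ≤ k) {v : V} {𝓡 N : Finset (Finset V)}
    (hc : ∀ B ∈ 𝓡, B.card = k) (hv : ∀ B ∈ 𝓡, v ∉ B)
    (hlin : ∀ B ∈ 𝓡, ∀ B' ∈ 𝓡, B ≠ B' → ¬ Disjoint B B' → (B ∩ B').card = 1)
    (hN : ∀ B ∈ 𝓡, ∀ B' ∈ 𝓡, B ≠ B' → ∀ w, B ∩ B' = {w} → B.erase w ∈ N ∨ B'.erase w ∈ N) :
    k * 𝓡.card ≤ (Fintype.card V - 1) + N.card := by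
  have hlin' : ∀ B ∈ 𝓡, ∀ B' ∈ 𝓡, B ≠ B' → ∀ w, w ∈ B → w ∈ B' → B ∩ B' = {w} := by
    intro B hB B' hB' hne w hw hw'
    obtain ⟨u, hu⟩ := card_eq_one.1 (hlin B hB B' hB' hne (Finset.not_disjoint_iff.2 ⟨w, hw, hw'⟩))
    have : w ∈ B ∩ B' := mem_inter.2 ⟨hw, hw'⟩
    rw [hu, mem_singleton] at this
    rw [hu, this]
  have h1 : k * 𝓡.card = ∑ w ∈ univ.erase v, (𝓡.filter (fun B => w ∈ B)).card := by
    have hdc := sum_card_bipartiteAbove_eq_sum_card_bipartiteBelow (s := 𝓡) (t := univ.erase v)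
      (fun B w => w ∈ B)
    simp only [bipartiteAbove, bipartiteBelow] at hdc
    rw [← hdc, sum_congr rfl (g := fun _ => k), sum_const, smul_eq_mul, mul_comm]
    intro B hB
    rw [← hc B hB]
    congr 1
    ext x
    simp only [mem_filter, mem_erase, mem_univ, and_true]
    exact ⟨fun h => h.2, fun h => ⟨fun hx => hv B hB (hx ▸ h), h⟩⟩
  have h2 : ∀ w ∈ univ.erase v, (𝓡.filter (fun B => w ∈ B)).card ≤
      1 + ((𝓡.filter (fun B => w ∈ B)).filter (fun B => B.erase w ∈ N)).card := by
    intro w _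
    rw [← card_filter_add_card_filter_not (s := 𝓡.filter (fun B => w ∈ B))
      (fun B => B.erase w ∈ N), add_comm]
    refine Nat.add_le_add_right ?_ _
    rw [card_le_one]
    intro B hB B' hB'
    simp only [mem_filter] at hB hB'
    by_contra hne
    rcases hN B hB.1.1 B' hB'.1.1 hne w (hlin' B hB.1.1 B' hB'.1.1 hne w hB.1.2 hB'.1.2)
      with h | h
    · exact hB.2 h
    · exact hB'.2 h
  -- No missing set is counted twice: it has at least two vertices, so by linearity it determines
  -- `B`, and then `w`.
  have h3 : ∑ w ∈ univ.erase v,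
      ((𝓡.filter (fun B => w ∈ B)).filter (fun B => B.erase w ∈ N)).card ≤ N.card := by
    rw [← card_sigma]
    refine card_le_card_of_injOn (fun p => p.2.erase p.1) ?_ ?_
    · rintro ⟨w, B⟩ hp
      exact mem_coe.2 (mem_filter.1 (mem_sigma.1 (mem_coe.1 hp)).2).2
    · rintro ⟨w, B⟩ hp ⟨w', B'⟩ hp' h
      have hp := (mem_sigma.1 (mem_coe.1 hp)).2
      have hp' := (mem_sigma.1 (mem_coe.1 hp')).2
      simp only [mem_filter] at hp hp' h
      have hBB : B = B' := by
        by_contra hne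
        have hsub : B.erase w ⊆ B ∩ B' := by
          intro x hx
          exact mem_inter.2 ⟨mem_of_mem_erase hx, mem_of_mem_erase (h ▸ hx)⟩
        have hcard := card_le_card hsub
        rw [card_erase_of_mem hp.1.2, hc B hp.1.1] at hcard
        have hmeet : ¬ Disjoint B B' := by
          rw [not_disjoint_iff_nonempty_inter, ← card_pos]; omega
        have := hlin B hp.1.1 B' hp'.1.1 hne hmeet
        omega
      subst hBB
      have hww : w = w' := by
        by_contra hne
        have : w ∈ B.erase w' := mem_erase.2 ⟨hne, hp.1.2⟩
        rw [← h] at this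
        exact notMem_erase w B this
      rw [hww]
  calc k * 𝓡.card = _ := h1
    _ ≤ ∑ w ∈ univ.erase v,
        (1 + ((𝓡.filter (fun B => w ∈ B)).filter (fun B => B.erase w ∈ N)).card) := sum_le_sum h2
    _ = (Fintype.card V - 1) + _ := by
        rw [sum_add_distrib, sum_const, smul_eq_mul, mul_one, card_erase_of_mem (mem_univ v),
          card_univ]
    _ ≤ _ := Nat.add_le_add_left h3 _

/-- Removing `v` identifies the edges through `v` with the sets that are not missing. The extremal
problem becomes a comparison of the edges avoiding `v` with the missing sets. -/
lemma card_add_card_missingLink {H : Finset (Finset V)} {k : ℕ}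
    (hs : (H : Set (Finset V)).Sized k) (v : V) :
    H.card + (missingLink H k v).card =
      (Fintype.card V - 1).choose (k - 1) + (edgesAvoiding H v).card := by
  have h1 := card_filter_add_card_filter_not (s := H) (fun e => v ∈ e)
  have h2 := card_filter_add_card_filter_not (s := powersetCard (k - 1) (univ.erase v))
    (fun A => insert v A ∈ H)
  rw [card_powersetCard, card_erase_of_mem (mem_univ v), card_univ] at h2
  have h3 : (H.filter (fun e => v ∈ e)).card =
      ((powersetCard (k - 1) (univ.erase v)).filter (fun A => insert v A ∈ H)).card := by
    refine card_bij (fun e _ => e.erase v) ?_ ?_ ?_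
    · intro e he
      obtain ⟨he, hv⟩ := mem_filter.1 he
      refine mem_filter.2 ⟨mem_powersetCard.2 ⟨erase_subset_erase _ (subset_univ _), ?_⟩, ?_⟩
      · rw [card_erase_of_mem hv, hs he]
      · rwa [insert_erase hv]
    · intro e he e' he' h
      rw [← insert_erase (mem_filter.1 he).2, h, insert_erase (mem_filter.1 he').2]
    · intro A hA
      obtain ⟨hA, hAH⟩ := mem_filter.1 hA
      have hvA : v ∉ A := fun h => notMem_erase v univ ((mem_powersetCard.1 hA).1 h)
      exact ⟨insert v A, mem_filter.2 ⟨hAH, mem_insert_self _ _⟩, erase_insert hvA⟩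
  have h4 : missingLink H k v =
    (powersetCard (k - 1) (univ.erase v)).filter (fun A => ¬ insert v A ∈ H) := rfl
  have h5 : edgesAvoiding H v = H.filter (fun e => ¬ v ∈ e) := rfl
  rw [h4, h5]
  omega

/-! ### Stars with a maximal matching -/

lemma IsMatchingOmitting.mul_card_add_card_sdiff {k : ℕ} {v : V} {M : Finset (Finset V)}
    (hM : IsMatchingOmitting k v M) :
    k * M.card + (univ.erase v \ M.biUnion id).card = Fintype.card V - 1 := by
  have hsub : M.biUnion id ⊆ univ.erase v := by
    intro x hx
    obtain ⟨e, he, hxe⟩ := mem_biUnion.1 hx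
    exact mem_erase.2 ⟨fun h => hM.2.1 e he (h ▸ hxe), mem_univ _⟩
  have hc : (M.biUnion id).card = k * M.card := by
    rw [card_biUnion hM.2.2, 
      sum_const_nat (m := k) (f := fun u => (id u).card) (fun e he => hM.1 he), mul_comm]
  have := card_sdiff_add_card_eq_card hsub
  rw [card_erase_of_mem (mem_univ v), card_univ] at this
  omega

lemma IsMatchingOmitting.card_le {k : ℕ} (hk : 1 ≤ k) {v : V} {M : Finset (Finset V)}
    (hM : IsMatchingOmitting k v M) : M.card ≤ (Fintype.card V - 1) / k := by
  rw [Nat.le_div_iff_mul_le hk, mul_comm]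
  have := hM.mul_card_add_card_sdiff
  omega

/-- A smaller matching leaves at least `k` vertices other than `v` uncovered, and these contain a
further edge. -/
lemma card_of_maximal_isMatchingOmitting {k : ℕ} (hk : 1 ≤ k) {v : V} {M : Finset (Finset V)}
    (hM : Maximal (IsMatchingOmitting k v) M) : M.card = (Fintype.card V - 1) / k := by
  refine le_antisymm (hM.prop.card_le hk) ?_
  by_contra hlt
  rw [not_le] at hlt
  have h1 := hM.prop.mul_card_add_card_sdiff
  have h2 : k * (M.card + 1) ≤ Fintype.card V - 1 := by
    rw [mul_comm]; exact (Nat.le_div_iff_mul_le hk).1 hlt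
  rw [mul_add, mul_one] at h2
  obtain ⟨e, he, hec⟩ := exists_subset_card_eq (by omega : k ≤ (univ.erase v \ M.biUnion id).card)
  have hdisj : ∀ a ∈ M, Disjoint e a := by
    intro a ha
    rw [Finset.disjoint_left]
    intro x hx hxa
    exact (mem_sdiff.1 (he hx)).2 (mem_biUnion.2 ⟨a, ha, hxa⟩)
  have hins : IsMatchingOmitting k v (insert e M) := by
    refine ⟨?_, ?_, ?_⟩
    · intro a ha
      rcases mem_insert.1 (mem_coe.1 ha) with rfl | h
      · exact hec
      · exact hM.prop.1 h
    · intro a ha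
      rcases mem_insert.1 ha with rfl | h
      · exact fun h => (mem_erase.1 (mem_sdiff.1 (he h)).1).1 rfl
      · exact hM.prop.2.1 a h
    · rw [coe_insert]
      exact hM.prop.2.2.insert fun a ha _ => hdisj a ha
  have heM : e ∈ M := hM.2 hins (subset_insert e M) (mem_insert_self e M)
  have := hdisj e heM
  rw [disjoint_self_iff_empty] at this
  rw [this, card_empty] at hec
  omega

lemma mem_fullStar {k : ℕ} {v : V} {e : Finset V} : e ∈ fullStar k v ↔ e.card = k ∧ v ∈ e := by
  simp [fullStar, mem_powersetCard]

lemma card_of_isStarWithMaximalMatching {k : ℕ} (hk : 1 ≤ k) {H : Finset (Finset V)}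
    (h : IsStarWithMaximalMatching k H) :
    H.card = (Fintype.card V - 1).choose (k - 1) + (Fintype.card V - 1) / k := by
  obtain ⟨v, M, hM, rfl⟩ := h
  have hs : ((fullStar k v ∪ M : Finset (Finset V)) : Set (Finset V)).Sized k := by
    intro e he
    rcases mem_union.1 (mem_coe.1 he) with h | h
    · exact (mem_fullStar.1 h).1
    · exact hM.prop.1 h
  have h1 := card_add_card_missingLink hs v
  have h2 : missingLink (fullStar k v ∪ M) k v = ∅ := by
    rw [eq_empty_iff_forall_notMem]
    intro A hA
    rw [mem_missingLink] at hA
    refine hA.2 (mem_union_left _ (mem_fullStar.2 ⟨?_, mem_insert_self _ _⟩))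
    rw [card_insert_of_notMem hA.1.1, hA.1.2]; omega
  have h3 : edgesAvoiding (fullStar k v ∪ M) v = M := by
    ext e
    rw [edgesAvoiding, mem_filter, mem_union, mem_fullStar]
    exact ⟨fun h => h.1.resolve_left fun h' => h.2 h'.2,
      fun h => ⟨Or.inr h, hM.prop.2.1 e h⟩⟩
  rw [h2, h3, card_empty, add_zero, card_of_maximal_isMatchingOmitting hk hM] at h1
  exact h1

lemma isStarWithMaximalMatching_of_missingLink_eq_empty {k : ℕ} (hk : 1 ≤ k)
    {H : Finset (Finset V)} (hs : (H : Set (Finset V)).Sized k) {v : V}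
    (hN : missingLink H k v = ∅)
    (hd : ((edgesAvoiding H v : Finset (Finset V)) : Set (Finset V)).PairwiseDisjoint id)
    (hc : (edgesAvoiding H v).card = (Fintype.card V - 1) / k) :
    IsStarWithMaximalMatching k H := by
  have hM : IsMatchingOmitting k v (edgesAvoiding H v) :=
    ⟨fun e he => hs (mem_filter.1 (mem_coe.1 he)).1, fun e he => (mem_filter.1 he).2, hd⟩
  refine ⟨v, edgesAvoiding H v, ⟨hM, fun M hM' hle => ?_⟩, ?_⟩
  · exact (eq_of_subset_of_card_le hle (by rw [hc]; exact hM'.card_le hk)).ge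
  · ext e
    rw [mem_union, mem_fullStar, edgesAvoiding, mem_filter]
    constructor
    · intro he
      by_cases hv : v ∈ e
      · exact Or.inl ⟨hs he, hv⟩
      · exact Or.inr ⟨he, hv⟩
    · rintro (⟨hec, hv⟩ | h)
      · by_contra hcon
        have : e.erase v ∈ missingLink H k v :=
          mem_missingLink.2 ⟨⟨notMem_erase v e, by rw [card_erase_of_mem hv, hec]⟩,
            by rwa [insert_erase hv]⟩
        rw [hN] at this
        exact notMem_empty _ this
      · exact h.1

/-- For odd `k`, a star together with a matching has no `2`-regular subgraph. -/
lemma not_hasRegularSubgraph_of_isStarWithMaximalMatching {k : ℕ} (hodd : Odd k)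
    {H : Finset (Finset V)} (h : IsStarWithMaximalMatching k H) : ¬ HasRegularSubgraph 2 H := by
  obtain ⟨v, M, hM, rfl⟩ := h
  obtain ⟨hMs, hMv, hMd⟩ := hM.prop
  rintro ⟨W, F, hW, hF, hFW, hdeg⟩
  have huniq : ∀ {a b : Finset V} {x : V}, a ∈ M → b ∈ M → x ∈ a → x ∈ b → a = b := by
    intro a b x ha hb hxa hxb
    by_contra hab
    exact Finset.disjoint_left.1 (hMd ha hb hab) hxa hxb
  have hFM : ∀ e ∈ F, v ∉ e → e ∈ M := by
    intro e he hv
    exact (mem_union.1 (hF he)).resolve_left fun h => hv (mem_fullStar.1 h).2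
  have hvW : v ∈ W := by
    by_contra hv
    obtain ⟨x, hx⟩ := hW
    obtain ⟨a, b, hab, hab'⟩ := card_eq_two.1 (hdeg x hx)
    have ha : a ∈ F.filter (fun e => x ∈ e) := by rw [hab']; simp
    have hb : b ∈ F.filter (fun e => x ∈ e) := by rw [hab']; simp
    rw [mem_filter] at ha hb
    exact hab (huniq (hFM a ha.1 fun h => hv (hFW a ha.1 h))
      (hFM b hb.1 fun h => hv (hFW b hb.1 h)) ha.2 hb.2)
  obtain ⟨A, B, hAB, hF2⟩ := card_eq_two.1 (hdeg v hvW)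
  have hAm : A ∈ F.filter (fun e => v ∈ e) := by rw [hF2]; simp
  have hBm : B ∈ F.filter (fun e => v ∈ e) := by rw [hF2]; simp
  rw [mem_filter] at hAm hBm
  have hother : ∀ e ∈ F, e ≠ A → e ≠ B → v ∉ e := by
    intro e he hA hB hv
    have : e ∈ F.filter (fun e => v ∈ e) := mem_filter.2 ⟨he, hv⟩
    rw [hF2, mem_insert, mem_singleton] at this
    tauto
  have hcard : ∀ e ∈ F, e.card = k := by
    intro e he
    rcases mem_union.1 (hF he) with h | h
    · exact (mem_fullStar.1 h).1
    · exact hMs h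
  set F' := F.filter (fun e => v ∉ e) with hF'
  have hF'M : ∀ e ∈ F', e ∈ M := fun e he => hFM e (mem_filter.1 he).1 (mem_filter.1 he).2
  have hsymm : ∀ {A B : Finset V}, A ∈ F → A ≠ B → v ∈ A → v ∈ B →
      (∀ e ∈ F, e ≠ A → e ≠ B → v ∉ e) → ∀ x, x ∈ A → x ∉ B → x ∈ F'.biUnion id := by
    intro A B hA hne hvA hvB hother x hxA hxB
    obtain ⟨a, b, hab, hab'⟩ := card_eq_two.1 (hdeg x (hFW A hA hxA))
    have key : ∀ c, c ∈ F.filter (fun e => x ∈ e) → c ≠ A → x ∈ F'.biUnion id := by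
      intro c hc hcA
      rw [mem_filter] at hc
      exact mem_biUnion.2 ⟨c, mem_filter.2 ⟨hc.1, hother c hc.1 hcA
        (fun h => hxB (h ▸ hc.2))⟩, hc.2⟩
    by_cases haA : a = A
    · exact key b (by rw [hab']; simp) (fun h => hab (haA.trans h.symm))
    · exact key a (by rw [hab']; simp) haA
  -- Edges of `F` other than `A`, `B` are matching edges and cover a vertex at most once; degree 2
  -- then forces exactly one of `A`, `B` at each vertex they cover.
  have hun : F'.biUnion id = (A \ B) ∪ (B \ A) := by
    ext x
    rw [mem_union, mem_sdiff, mem_sdiff]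
    constructor
    · intro hx
      obtain ⟨e, he, hxe⟩ := mem_biUnion.1 hx
      simp only [id] at hxe
      have heF := (mem_filter.1 he).1
      have hve := (mem_filter.1 he).2
      have heA : e ≠ A := fun h => hve (h ▸ hAm.2)
      have heB : e ≠ B := fun h => hve (h ▸ hBm.2)
      have hd : (F.filter (fun e => x ∈ e)).card = 2 := hdeg x (hFW e heF hxe)
      by_cases hxA : x ∈ A <;> by_cases hxB : x ∈ B
      · exfalso
        have hsub : ({e, A, B} : Finset (Finset V)) ⊆ F.filter (fun e => x ∈ e) := by
          simp [insert_subset_iff, heF, hxe, hAm.1, hBm.1, hxA, hxB]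
        have := card_le_card hsub
        rw [card_insert_of_notMem (by simp [heA, heB]), card_pair hAB] at this
        omega
      · exact Or.inl ⟨hxA, hxB⟩
      · exact Or.inr ⟨hxB, hxA⟩
      · exfalso
        have hsub : F.filter (fun e => x ∈ e) ⊆ {e} := by
          intro e' he'
          rw [mem_filter] at he'
          rw [mem_singleton]
          exact huniq (hFM e' he'.1 (hother e' he'.1 (fun h => hxA (h ▸ he'.2))
            (fun h => hxB (h ▸ he'.2)))) (hF'M e he) he'.2 hxe
        have := card_le_card hsub
        rw [card_singleton] at this
        omega
    · rintro (⟨h1, h2⟩ | ⟨h1, h2⟩)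
      · exact hsymm hAm.1 hAB hAm.2 hBm.2 hother x h1 h2
      · exact hsymm hBm.1 hAB.symm hBm.2 hAm.2 (fun e he h h' => hother e he h' h) x h1 h2
  have hc1 : (F'.biUnion id).card = k * F'.card := by
    rw [card_biUnion (fun a ha b hb h => hMd (hF'M a ha) (hF'M b hb) h),
      sum_const_nat (m := k) (f := fun u => (id u).card) (fun e he => hMs (hF'M e he)), mul_comm]
  rw [hun, card_union_of_disjoint disjoint_sdiff_sdiff] at hc1
  have h1 := card_sdiff_add_card_inter A B
  have h2 := card_sdiff_add_card_inter B A
  rw [inter_comm] at h2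
  have hA := hcard A hAm.1
  have hB := hcard B hBm.1
  have hpos : 0 < (A ∩ B).card := card_pos.2 ⟨v, mem_inter.2 ⟨hAm.2, hBm.2⟩⟩
  have hsd : 0 < (A \ B).card := by
    rw [card_pos, sdiff_nonempty]
    exact fun h => hAB (eq_of_subset_of_card_le h (by omega))
  -- Oddness gives `k ∣ |A \ B|`, which is impossible as `0 < |A \ B| < k`.
  have hdvd : k ∣ 2 * (A \ B).card := ⟨F'.card, by omega⟩
  have hcop : Nat.Coprime k 2 := Nat.coprime_two_right.2 hodd
  have := Nat.le_of_dvd hsd (hcop.dvd_of_dvd_mul_left hdvd)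
  omega

/-! ### The extremal bound and the choice of constants -/

lemma badThreshold_le_one (k : ℕ) : badThreshold k ≤ 1 := by
  unfold badThreshold
  rw [div_le_one (by positivity)]
  exact_mod_cast Nat.one_le_iff_ne_zero.2 (by positivity)

open Classical in
/-- A `k`-graph without `2`-regular subgraphs in which few of the edges that avoid `v` have bad
subsets satisfies the extremal bound, and is extremal only as a star with a matching. -/
lemma card_le_of_card_filter_hasBadSubset_le {H : Finset (Finset V)} {k : ℕ} {v : V} (hk : 3 ≤ k)
    (hs : (H : Set (Finset V)).Sized k) (hfree : ¬ HasRegularSubgraph 2 H)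
    (hn : 4 * k ≤ Fintype.card V) {τ : ℝ} (hτ : τ ≤ badThreshold k)
    (hbad : 8 * ((edgesAvoiding H v).filter (HasBadSubset H k v τ)).card ≤
      (missingLink H k v).card) :
    H.card ≤ (Fintype.card V - 1).choose (k - 1) + (Fintype.card V - 1) / k ∧
      (H.card = (Fintype.card V - 1).choose (k - 1) + (Fintype.card V - 1) / k →
        IsStarWithMaximalMatching k H) := by
  have hcount := card_add_card_missingLink (k := k) hs v
  have hsplit := card_filter_add_card_filter_not (s := edgesAvoiding H v) (HasBadSubset H k v τ)
  set 𝓑 := (edgesAvoiding H v).filter (HasBadSubset H k v τ) with h𝓑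
  set 𝓡 := (edgesAvoiding H v).filter (fun B => ¬ HasBadSubset H k v τ B) with h𝓡
  have hlin : ∀ B ∈ 𝓡, ∀ B' ∈ 𝓡, B ≠ B' → ¬ Disjoint B B' → (B ∩ B').card = 1 := by
    intro B hB B' hB' hne hmeet
    obtain ⟨hB, hg⟩ := mem_filter.1 hB
    obtain ⟨hB', hg'⟩ := mem_filter.1 hB'
    exact card_inter_eq_one_of_not_hasBadSubset hs hfree hn hτ hB hB' hg hg' hne hmeet
  have hvB : ∀ B ∈ edgesAvoiding H v, v ∉ B := fun B hB => (mem_filter.1 hB).2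
  rcases Nat.lt_or_ge (missingLink H k v).card 2 with hN | hN
  · have h𝓑0 : 𝓑.card = 0 := by omega
    have h𝓡eq : 𝓡 = edgesAvoiding H v :=
      eq_of_subset_of_card_le (filter_subset _ _) (by omega)
    have hd : ((edgesAvoiding H v : Finset (Finset V)) : Set (Finset V)).PairwiseDisjoint id := by
      intro B hB B' hB' hne
      by_contra hmeet
      have h1 := hlin B (h𝓡eq ▸ hB) B' (h𝓡eq ▸ hB') hne hmeet
      have h2 := two_le_card_missingLink hk hs hfree hn hB hB' hne h1
      omega
    have hM : IsMatchingOmitting k v (edgesAvoiding H v) :=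
      ⟨fun B hB => card_of_mem_edgesAvoiding hs hB, hvB, hd⟩
    have hle := hM.card_le (by omega)
    refine ⟨by omega, fun heq => ?_⟩
    exact isStarWithMaximalMatching_of_missingLink_eq_empty (by omega) hs
      (card_eq_zero.1 (by omega)) hd (by omega)
  · have h1 := mul_card_le_of_linear hk (v := v) (𝓡 := 𝓡) (N := missingLink H k v)
      (fun B hB => card_of_mem_edgesAvoiding hs (mem_filter.1 hB).1)
      (fun B hB => hvB B (mem_filter.1 hB).1) hlin
      (fun B hB B' hB' hne w hw => erase_mem_missingLink_or hs hfree hn (mem_filter.1 hB).1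
        (mem_filter.1 hB').1 hne hw)
    have h2 := Nat.div_add_mod (Fintype.card V - 1) k
    have h3 := Nat.mod_lt (Fintype.card V - 1) (by omega : k > 0)
    have h4 : k * 𝓡.card + 1 ≤ k * ((Fintype.card V - 1) / k + 1) + (missingLink H k v).card := by
      rw [mul_add, mul_one]; omega
    have h5 : 𝓡.card < (Fintype.card V - 1) / k + 1 + (missingLink H k v).card / 3 + 1 := by
      by_contra hge
      rw [not_lt] at hge
      have h6 := Nat.mul_le_mul_left k hge
      have h7 : 3 * ((missingLink H k v).card / 3 + 1) ≤ k * ((missingLink H k v).card / 3 + 1) :=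
        Nat.mul_le_mul_right _ hk
      have h8 : k * ((Fintype.card V - 1) / k + 1 + (missingLink H k v).card / 3 + 1) =
        k * ((Fintype.card V - 1) / k + 1) + k * ((missingLink H k v).card / 3 + 1) := by ring
      omega
    -- Besides the floor of `(n - 1) / k`, the edges avoiding `v` contribute at most `|N| / 8 + |N|
    -- / 3 + 1` with both quotients rounded down, which is less than `|N|` once `|N| ≥ 2`.
    have : H.card < (Fintype.card V - 1).choose (k - 1) + (Fintype.card V - 1) / k := by
      omega
    exact ⟨this.le, fun h => absurd h this.ne⟩

open Classical in
-- The factor of `|N|` in `card_filter_hasBadSubset_le` splits into five terms, and the hypotheses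
-- on the constants bound each by `1 / 64`.
lemma eight_mul_card_filter_hasBadSubset_le {H : Finset (Finset V)} {k : ℕ} {v : V} (hk : 3 ≤ k)
    (hs : (H : Set (Finset V)).Sized k) (hfree : ¬ HasRegularSubgraph 2 H)
    (hn : 4 * k ≤ Fintype.card V) {σ τ η : ℝ} (hσ : 0 < σ) (hτ0 : 0 < τ)
    (hτle : τ ≤ badThreshold k) (hτθ : 64 * k ^ 2 * 2 ^ k * 2 ^ (k + 1) * τ ≤ badThreshold k ^ 2)
    (hστ : 64 * k * 2 ^ k * 2 ^ (k + 1) * σ ≤ τ * badThreshold k)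
    (hηστ : 64 * (4099 + k * (k + 5)) * 2 ^ k * 2 ^ k * η ≤ σ * τ)
    (hnτ : 64 * k * 2 ^ k ≤ τ * Fintype.card V)
    (hnθ : 64 * k ^ 2 * 2 ^ k ≤ badThreshold k * Fintype.card V)
    (hN : ((missingLink H k v).card : ℝ) ≤ η * (Fintype.card V : ℝ) ^ (k - 1)) :
    8 * ((edgesAvoiding H v).filter (HasBadSubset H k v τ)).card ≤ (missingLink H k v).card := by
  have hθ := badThreshold_pos k
  have hn0 : (0 : ℝ) < Fintype.card V := by exact_mod_cast (by omega : 0 < Fintype.card V)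
  have hk1 : (1 : ℝ) ≤ k := by exact_mod_cast (by omega : 1 ≤ k)
  have hp : (1 : ℝ) ≤ 2 ^ k := one_le_pow₀ (by norm_num)
  have hp' : (1 : ℝ) ≤ 2 ^ (k + 1) := one_le_pow₀ (by norm_num)
  set θ := badThreshold k with hθdef
  set n : ℝ := (Fintype.card V : ℝ) with hndef
  have hσle : σ ≤ τ := by
    have h1 : (1 : ℝ) ≤ 64 * k * 2 ^ k * 2 ^ (k + 1) :=
      one_le_mul_of_one_le_of_one_le (one_le_mul_of_one_le_of_one_le
        (one_le_mul_of_one_le_of_one_le (by norm_num) hk1) hp) hp'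
    have h2 : τ * badThreshold k ≤ τ := mul_le_of_le_one_right hτ0.le (badThreshold_le_one k)
    exact (le_mul_of_one_le_left hσ.le h1).trans (hστ.trans h2)
  have h := card_filter_hasBadSubset_le hk hs hfree hn hσ hσle hτle hN
  rw [← hθdef, ← hndef] at h
  have e1 : (4099 + k * (k + 5)) * (2 ^ k * η / σ) * (2 ^ k / τ) ≤ 1 / 64 := by
    rw [show (4099 + k * (k + 5)) * (2 ^ k * η / σ) * (2 ^ k / τ) =
      ((4099 + k * (k + 5)) * 2 ^ k * 2 ^ k * η) / (σ * τ) by field_simp,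
      div_le_div_iff₀ (by positivity) (by norm_num)]
    linarith
  have e2 : (2 ^ k / τ) * k * (1 / n) ≤ 1 / 64 := by
    rw [show (2 ^ k / τ) * k * (1 / n) = (k * 2 ^ k) / (τ * n) by field_simp,
      div_le_div_iff₀ (by positivity) (by norm_num)]
    linarith
  have e3 : (2 ^ k / τ) * k * (2 ^ (k + 1) * σ / θ) ≤ 1 / 64 := by
    rw [show (2 ^ k / τ) * k * (2 ^ (k + 1) * σ / θ) = (k * 2 ^ k * 2 ^ (k + 1) * σ) / (τ * θ) by
      field_simp, div_le_div_iff₀ (by positivity) (by norm_num)]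
    linarith
  have e4 : k * k * (2 ^ k / θ) * (1 / n) ≤ 1 / 64 := by
    rw [show k * k * (2 ^ k / θ) * (1 / n) = (k ^ 2 * 2 ^ k) / (θ * n) by field_simp,
      div_le_div_iff₀ (by positivity) (by norm_num)]
    linarith
  have e5 : k * k * (2 ^ k / θ) * (2 ^ (k + 1) * τ / θ) ≤ 1 / 64 := by
    rw [show k * k * (2 ^ k / θ) * (2 ^ (k + 1) * τ / θ) =
      (k ^ 2 * 2 ^ k * 2 ^ (k + 1) * τ) / θ ^ 2 by field_simp,
      div_le_div_iff₀ (by positivity) (by norm_num)]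
    linarith
  have h8 : (((edgesAvoiding H v).filter (HasBadSubset H k v τ)).card : ℝ) ≤
      (missingLink H k v).card * (1 / 8) := by
    refine h.trans (mul_le_mul_of_nonneg_left ?_ (Nat.cast_nonneg _))
    rw [mul_add (2 ^ k / τ * k : ℝ), mul_add (k * k * (2 ^ k / θ) : ℝ)]
    linarith
  have : (8 * ((edgesAvoiding H v).filter (HasBadSubset H k v τ)).card : ℝ) ≤
    (missingLink H k v).card := by linarith
  exact_mod_cast this

end
end UniformHypergraph

theorem theorem1p3 (k : ℕ) (hk : 3 ≤ k) (hodd : Odd k) :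
    ∃ n₀ : ℕ, ∀ n : ℕ, n₀ ≤ n →
      ∀ (V : Type*) [Fintype V] [DecidableEq V], Fintype.card V = n →
        ∀ H : Finset (Finset V), (H : Set (Finset V)).Sized k →
          (¬ UniformHypergraph.HasRegularSubgraph 2 H →
            H.card ≤ (n - 1).choose (k - 1) + (n - 1) / k ∧
            (H.card = (n - 1).choose (k - 1) + (n - 1) / k ↔
              UniformHypergraph.IsStarWithMaximalMatching k H)) ∧
          (UniformHypergraph.IsStarWithMaximalMatching k H →
            ¬ UniformHypergraph.HasRegularSubgraph 2 H) := by
  have hk0 : (0 : ℝ) < k := by exact_mod_cast (by omega : 0 < k)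
  have hθ := UniformHypergraph.badThreshold_pos k
  set θ := UniformHypergraph.badThreshold k with hθdef
  -- The constants `τ`, `σ`, `η` are chosen successively, each turning one requirement of
  -- `eight_mul_card_filter_hasBadSubset_le` into an equality.
  set τ : ℝ := θ ^ 2 / (64 * k ^ 2 * 2 ^ k * 2 ^ (k + 1)) with hτdef
  have hτ : 0 < τ := by positivity
  have hτθ : τ ≤ θ := by
    refine (div_le_self (by positivity) ?_).trans
      (pow_le_of_le_one hθ.le (UniformHypergraph.badThreshold_le_one k) two_ne_zero)
    have hk1 : (1 : ℝ) ≤ k := by exact_mod_cast (by omega : 1 ≤ k)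
    have hp : ∀ m : ℕ, (1 : ℝ) ≤ 2 ^ m := fun m => one_le_pow₀ (by norm_num)
    exact one_le_mul_of_one_le_of_one_le (one_le_mul_of_one_le_of_one_le
      (one_le_mul_of_one_le_of_one_le (by norm_num) (one_le_pow₀ hk1)) (hp k)) (hp (k + 1))
  set σ : ℝ := τ * θ / (64 * k * 2 ^ k * 2 ^ (k + 1)) with hσdef
  have hσ : 0 < σ := by positivity
  set η : ℝ := σ * τ / (64 * (4099 + k * (k + 5)) * 2 ^ k * 2 ^ k) with hηdef
  have hη : 0 < η := by positivity
  set c₁ : ℝ := 4097 + k * (k + 4) with hc₁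
  set c₂ : ℝ := k * k + (1 + c₁) * ((k - 1 : ℕ) : ℝ) ^ (k - 1) with hc₂
  set c₃ : ℝ := k * (k * k + 2 * c₂) with hc₃
  -- From `r ≥ R` follow both the stability hypothesis `2 * c₂ ≤ r` and the bound `2 * c₃ / r ≤ η`
  -- on the density of missing sets; `R₁` handles the terms with `1 / n`.
  obtain ⟨R, hR⟩ := exists_nat_ge (max (2 * c₂) (2 * c₃ / η))
  obtain ⟨R₁, hR₁⟩ := exists_nat_ge (max (64 * k * 2 ^ k / τ) (64 * k ^ 2 * 2 ^ k / θ))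
  refine ⟨max (R ^ 12) (max R₁ (4 * k)), ?_⟩
  intro n hn V _ _ hV H hs
  subst hV
  refine ⟨fun hfree => ?_, UniformHypergraph.not_hasRegularSubgraph_of_isStarWithMaximalMatching
    hodd⟩
  have hmain : H.card ≤ (Fintype.card V - 1).choose (k - 1) + (Fintype.card V - 1) / k ∧
      (H.card = (Fintype.card V - 1).choose (k - 1) + (Fintype.card V - 1) / k →
        UniformHypergraph.IsStarWithMaximalMatching k H) := by
    have hn4 : 4 * k ≤ Fintype.card V := ((le_max_right _ _).trans (le_max_right _ _)).trans hn
    have hnR : R ^ 12 ≤ Fintype.card V := (le_max_left _ _).trans hn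
    have hnR₁ : (R₁ : ℝ) ≤ Fintype.card V := by
      exact_mod_cast ((le_max_left _ _).trans (le_max_right _ _)).trans hn
    rcases Nat.lt_or_ge H.card ((Fintype.card V - 1).choose (k - 1)) with hlt | hge
    · have hlt' := Nat.lt_add_right ((Fintype.card V - 1) / k) hlt
      exact ⟨hlt'.le, fun h => absurd h hlt'.ne⟩
    obtain ⟨r, hr, hrn, hnr⟩ := UniformHypergraph.exists_twelfth_root
      (by omega : 1 ≤ Fintype.card V)
    have hRr : (R : ℝ) ≤ r := by
      exact_mod_cast Nat.lt_succ_iff.1 (lt_of_pow_lt_pow_left₀ 12 (by omega) (hnR.trans_lt hnr))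
    have hr0 : (0 : ℝ) < r := by exact_mod_cast hr
    obtain ⟨v, hv⟩ := UniformHypergraph.exists_card_missingLink_le hk hs hfree hge hr hrn hnr
      hc₁ hc₂ hc₃ (((le_max_left _ _).trans hR).trans hRr)
    refine UniformHypergraph.card_le_of_card_filter_hasBadSubset_le (v := v) (τ := τ) hk hs hfree
      hn4 hτθ (UniformHypergraph.eight_mul_card_filter_hasBadSubset_le (η := η) hk hs hfree
        hn4 hσ hτ
        hτθ (le_of_eq ?_) (le_of_eq ?_) (le_of_eq ?_) ?_ ?_ (hv.trans ?_))
    · exact mul_div_cancel₀ _ (by positivity)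
    · exact mul_div_cancel₀ _ (by positivity)
    · exact mul_div_cancel₀ _ (by positivity)
    · have := ((le_max_left _ _).trans hR₁).trans hnR₁
      rwa [div_le_iff₀' hτ] at this
    · have := ((le_max_right _ _).trans hR₁).trans hnR₁
      rwa [div_le_iff₀' hθ] at this
    · have h1 := ((le_max_right _ _).trans hR).trans hRr
      rw [div_le_iff₀' hη] at h1
      rw [mul_div_assoc', div_le_iff₀ hr0]
      have h2 := mul_le_mul_of_nonneg_right h1
        (pow_nonneg (Nat.cast_nonneg (α := ℝ) (Fintype.card V)) (k - 1))
      rwa [mul_right_comm η] at h2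
  exact ⟨hmain.1, hmain.2, UniformHypergraph.card_of_isStarWithMaximalMatching (by omega)⟩
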